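/- **Setting.** Let $C^\circ$ be a commutative monoid with an additive involution $\alpha\mapsto\alpha^\vee$ (classes of objects of a self-dual linear category, e.g. $\pi_0(\mathcal M)$), such that $\alpha+\beta=0$ implies $\alpha=\beta=0$, and which has an additive map to an abelian group $K$ sending only $0$ to $0$; put $C=C^\circ\setminus\{0\}$. Let $C^{\mathrm{sd}}$ be a set (classes of self-dual objects, e.g. $\pi_0(\mathcal M^{\mathrm{sd}})$) with an action $(\alpha,\theta)\mapsto\bar\alpha+\theta$ of $C^\circ$ such that $\overline{\alpha^\vee}+\theta=\bar\alpha+\theta$. Let $L=\bigoplus_{\alpha\in C^\circ}L_\alpha$ be an involutive graded Lie algebra over $\mathbb Q$: each $L_\alpha$ is $\mathbb Z$-graded, the bracket is additive in classes and degrees and satisfies the graded antisymmetry and Jacobi identities, and $x\mapsto x^\vee$ is a degree-preserving linear involution with $L_\alpha^\vee=L_{\alpha^\vee}$ and $[x^\vee,y^\vee]=-[x,y]^\vee$. Let $M=\bigoplus_{\theta\in C^{\mathrm{sd}}}M_\theta$ be a graded twisted module: a linear map $\heartsuit\colon L\otimes M\to M$ of degree $0$ with $L_\alpha\heartsuit M_\theta\subset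 M_{\bar\alpha+\theta}$, $x\heartsuit m=-x^\vee\heartsuit m$, and $x\heartsuit(y\heartsuit m)-(-1)^{ab}\,y\heartsuit(x\heartsuit m)=[x,y]\heartsuit m-[x,y^\vee]\heartsuit m$ for $x,y$ homogeneous of degrees $a,b$. (The main example is $L=\check H_*(\mathcal M^{\mathrm{pl}};\mathbb Q)$, $M=\mathring H_*(\mathcal M^{\mathrm{sd}};\mathbb Q)$ for a moduli stack $\mathcal M$ of objects and the stack $\mathcal M^{\mathrm{sd}}$ of self-dual objects.) Let $U(L)$ be the universal enveloping algebra of the graded Lie algebra $L$, with product $*$, and let $U^{\mathrm{tw}}=(U(L)\otimes M)/I$, where $I$ is the $U(L)$-submodule generated by all $x\otimes m-x^\vee\otimes m-1\otimes(x\heartsuit m)$, $x\in L$, $m\in M$; the action of $U(L)$ on $U^{\mathrm{tw}}$ is written $\diamond$. Let $U^{\mathrm{tw}}_\theta\subset U^{\mathrm{tw}}$ be the span of all $x_1\diamond\cdots\diamond x_n\diamond m$ with $x_i\in L_{\alpha_i}$, $m\in M_\rho$, $\bar\alpha_1+\cdots+\bar\alpha_n+\rho=\theta$, and let $\hat U^{\mathrm{tw}}=\prod_{\theta\in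 C^{\mathrm{sd}}}U^{\mathrm{tw}}_\theta$. A *self-dual stability condition* is a map $\tau\colon C\to T$ to a totally ordered set with an order-reversing involution $t\mapsto-t$ having a unique fixed point $0$, such that $\tau(\alpha)=-\tau(\alpha^\vee)$ and, whenever $\beta=\alpha+\gamma$ in $C$, one of $\tau(\alpha)<\tau(\beta)<\tau(\gamma)$, $\tau(\alpha)=\tau(\beta)=\tau(\gamma)$, $\tau(\alpha)>\tau(\beta)>\tau(\gamma)$ holds. Let $\tau,\tilde\tau$ be two such conditions (possibly with different $T$). For each of them let families $\varepsilon_\alpha(\cdot)\in L_\alpha$ $(\alpha\in C)$ and $\varepsilon^{\mathrm{sd}}_\theta(\cdot)\in M_\theta$ $(\theta\in C^{\mathrm{sd}})$ of degree $0$ with $\varepsilon_{\alpha^\vee}(\cdot)=\varepsilon_\alpha(\cdot)^\vee$ be given (the enumerative invariants $[\mathcal M^{\mathrm{pl},\mathrm{ss}}_\alpha(\cdot)]_{\mathrm{inv}}$ and $[\mathcal M^{\mathrm{sd},\mathrm{ss}}_\theta(\cdot)]_{\mathrm{inv}}$). **Coefficients.** For $n\ge1$ let $S(\alpha_1,\dots,\alpha_n;\tau,\tilde\tau)=\prod_{i=1}^{n-1}s_i$,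 where $s_i=1$ if $\tau(\alpha_i)>\tau(\alpha_{i+1})$ and $\tilde\tau(\alpha_1+\cdots+\alpha_i)\le\tilde\tau(\alpha_{i+1}+\cdots+\alpha_n)$; $s_i=-1$ if $\tau(\alpha_i)\le\tau(\alpha_{i+1})$ and $\tilde\tau(\alpha_1+\cdots+\alpha_i)>\tilde\tau(\alpha_{i+1}+\cdots+\alpha_n)$; and $s_i=0$ otherwise. For $n\ge0$ let $S^{\mathrm{sd}}(\alpha_1,\dots,\alpha_n;\tau,\tilde\tau)=\prod_{i=1}^{n}s'_i$, where, with the convention $\tau(\alpha_{n+1})=0$, $s'_i=1$ if $\tau(\alpha_i)>\tau(\alpha_{i+1})$ and $\tilde\tau(\alpha_1+\cdots+\alpha_i)\le0$; $s'_i=-1$ if $\tau(\alpha_i)\le\tau(\alpha_{i+1})$ and $\tilde\tau(\alpha_1+\cdots+\alpha_i)>0$; and $s'_i=0$ otherwise. Define $$U(\alpha_1,\dots,\alpha_n;\tau,\tilde\tau)=\sum\frac{(-1)^{l-1}}{l}\prod_{i=1}^lS(\beta_{b_{i-1}+1},\dots,\beta_{b_i};\tau,\tilde\tau)\prod_{i=1}^m\frac1{(a_i-a_{i-1})!},$$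 summed over $1\le l\le m\le n$, $0=a_0<\cdots<a_m=n$, $0=b_0<\cdots<b_l=m$ such that, with $\beta_i=\alpha_{a_{i-1}+1}+\cdots+\alpha_{a_i}$ and $\gamma_i=\beta_{b_{i-1}+1}+\cdots+\beta_{b_i}$, one has $\tau(\alpha_j)=\tau(\beta_i)$ for $a_{i-1}<j\le a_i$ and $\tilde\tau(\gamma_i)=\tilde\tau(\alpha_1+\cdots+\alpha_n)$; and $$U^{\mathrm{sd}}(\alpha_1,\dots,\alpha_n;\tau,\tilde\tau)=\sum\binom{-1/2}{l}\prod_{i=1}^lS(\beta_{b_{i-1}+1},\dots,\beta_{b_i};\tau,\tilde\tau)\cdot S^{\mathrm{sd}}(\beta_{b_l+1},\dots,\beta_m;\tau,\tilde\tau)\prod_{i=1}^m\frac1{(a_i-a_{i-1})!}\cdot\frac1{2^{n-a_m}(n-a_m)!},$$ summed over $0\le l\le m\le n$, $0=a_0<\cdots<a_m\le n$, $0=b_0<\cdots<b_l\le m$ with $\tau(\alpha_j)=\tau(\beta_i)$ for $a_{i-1}<j\le a_i$, $\tau(\alpha_j)=0$ for $j>a_m$, and $\tilde\tau(\gamma_i)=0$.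 Let $\tilde U(\alpha_1,\dots,\alpha_n;\tau,\tilde\tau)$ and $\tilde U^{\mathrm{sd}}(\alpha_{1,1},\dots,\alpha_{1,m_1};\dots;\alpha_{n,1},\dots,\alpha_{n,m_n};\tau,\tilde\tau)$ be any rational coefficients such that, in free non-commuting variables $\alpha\in C$, $$\sum\tilde U(\alpha_1,\dots,\alpha_n)\,[[[\alpha_1,\alpha_2],\dots],\alpha_n]=\sum U(\alpha_1,\dots,\alpha_n)\,\alpha_1\cdots\alpha_n$$ in each non-zero multidegree (multiset of variables), and $$\sum\tilde U^{\mathrm{sd}}(\dots)\prod_{i=1}^n\bigl(x_i-x_i^\vee\bigr)=\sum U^{\mathrm{sd}}(\alpha_1,\dots,\alpha_n)\,\alpha_1\cdots\alpha_n,\qquad x_i=[[[\alpha_{i,1},\alpha_{i,2}],\dots],\alpha_{i,m_i}],$$ in each multidegree with respect to the orbits $\{\alpha,\alpha^\vee\}$ (including $0$), where $n\ge0$, all $m_i\geq1$, and $(\cdot)^\vee$ is the anti-automorphism of the free associative algebra extending $\alpha\mapsto\alpha^\vee$. **Hypotheses.** The wall-crossing formulae hold: for all $\alpha\in C$ and $\theta\in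 C^{\mathrm{sd}}$, $$\varepsilon_\alpha(\tilde\tau)=\sum_{n>0,\ \alpha=\alpha_1+\cdots+\alpha_n}\tilde U(\alpha_1,\dots,\alpha_n;\tau,\tilde\tau)\,[[[\varepsilon_{\alpha_1}(\tau),\varepsilon_{\alpha_2}(\tau)],\dots],\varepsilon_{\alpha_n}(\tau)],$$ $$\varepsilon^{\mathrm{sd}}_\theta(\tilde\tau)=\sum\tilde U^{\mathrm{sd}}(\alpha_{1,1},\dots;\dots;\dots,\alpha_{n,m_n};\tau,\tilde\tau)\,[[\varepsilon_{\alpha_{1,1}}(\tau),\dots],\varepsilon_{\alpha_{1,m_1}}(\tau)]\heartsuit\cdots\heartsuit[[\varepsilon_{\alpha_{n,1}}(\tau),\dots],\varepsilon_{\alpha_{n,m_n}}(\tau)]\heartsuit\varepsilon^{\mathrm{sd}}_\rho(\tau),$$ the latter over $n\ge0$, $m_i>0$, $\alpha_{i,j}\in C$, $\rho\in C^{\mathrm{sd}}$ with $\sum\bar\alpha_{i,j}+\rho=\theta$, each sum having only finitely many non-zero terms. For both $\tau$ and $\tilde\tau$, define $$\delta_\alpha(\tau)=\sum_{\substack{\alpha=\alpha_1+\cdots+\alpha_n\\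 \tau(\alpha_1)=\cdots=\tau(\alpha_n)}}\frac1{n!}\,\varepsilon_{\alpha_1}(\tau)*\cdots*\varepsilon_{\alpha_n}(\tau)\in U(L),$$ $$\delta^{\mathrm{sd}}_\theta(\tau)=\sum_{\substack{\theta=\bar\alpha_1+\cdots+\bar\alpha_n+\rho\\ \tau(\alpha_1)=\cdots=\tau(\alpha_n)=0}}\frac1{2^nn!}\,\varepsilon_{\alpha_1}(\tau)\diamond\cdots\diamond\varepsilon_{\alpha_n}(\tau)\diamond\varepsilon^{\mathrm{sd}}_\rho(\tau)\in U^{\mathrm{tw}}$$ (all $\alpha_i\in C$), assuming that each of these sums has only finitely many non-zero terms. **Theorem.** Suppose that for each $\theta\in C^{\mathrm{sd}}$ there are only finitely many non-zero terms with $\bar\alpha_1+\cdots+\bar\alpha_n+\rho=\theta$ on each side. Then in $\hat U^{\mathrm{tw}}$ $$\sum_{\substack{n\ge0,\ \alpha_1,\dots,\alpha_n\in C,\ \rho\in C^{\mathrm{sd}}:\\ \tau(\alpha_1)>\cdots>\tau(\alpha_n)>0}}\delta_{\alpha_1}(\tau)\diamond\cdots\diamond\delta_{\alpha_n}(\tau)\diamond\delta^{\mathrm{sd}}_\rho(\tau)=\sum_{\substack{n\ge0,\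 \alpha_1,\dots,\alpha_n\in C,\ \rho\in C^{\mathrm{sd}}:\\ \tilde\tau(\alpha_1)>\cdots>\tilde\tau(\alpha_n)>0}}\delta_{\alpha_1}(\tilde\tau)\diamond\cdots\diamond\delta_{\alpha_n}(\tilde\tau)\diamond\delta^{\mathrm{sd}}_\rho(\tilde\tau).$$ -/

import Mathlib

open scoped TensorProduct

namespace SDWallCrossing

/-! ### Classes and self-dual stability conditions

`Γ` is the abelian monoid of classes of objects, with involution `α ↦ α^∨` written `star α`; the set
of classes of non-zero objects is `Γ` without `0`. `Θ` is the set of classes of self-dual objects, on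
which `Γ` acts: `α +ᵥ θ` is the class written `\bar α + θ`. -/

/-- The set `C` of classes of non-zero objects. -/
abbrev NZ (Γ : Type*) [AddCommMonoid Γ] : Type _ := {α : Γ // α ≠ 0}

/-- The involution on classes of non-zero objects. -/
def NZ.dual {Γ : Type*} [AddCommMonoid Γ] [StarAddMonoid Γ] (α : NZ Γ) : NZ Γ :=
  ⟨star α.1, star_ne_zero.mpr α.2⟩

/-- The sum of the classes in a tuple. -/
def total {Γ : Type*} [AddCommMonoid Γ] (w : List (NZ Γ)) : Γ := (w.map Subtype.val).sum

/-- A self-dual stability condition with values in the totally ordered set `T`. Only the values of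
`slope` at non-zero classes are meaningful (the value at `0` is never used). -/
structure SDStability (Γ : Type*) [AddCommMonoid Γ] [StarAddMonoid Γ] (T : Type*)
    [LinearOrder T] where
  /-- the order-reversing involution of `T` -/
  neg : T → T
  neg_neg : ∀ t, neg (neg t) = t
  neg_le_neg : ∀ s t, s ≤ t → neg t ≤ neg s
  /-- the unique fixed point of the involution -/
  zero : T
  neg_eq_self_iff : ∀ t, neg t = t ↔ t = zero
  slope : Γ → T
  slope_star : ∀ α, α ≠ 0 → slope α = neg (slope (star α))
  seesaw : ∀ α γ, α ≠ 0 → γ ≠ 0 → α + γ ≠ 0 →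
    (slope α < slope (α + γ) ∧ slope (α + γ) < slope γ) ∨
    (slope α = slope (α + γ) ∧ slope (α + γ) = slope γ) ∨
    (slope α > slope (α + γ) ∧ slope (α + γ) > slope γ)

/-! ### Combinatorial coefficients -/

section Coefficients

variable {Γ : Type*} [AddCommMonoid Γ] [StarAddMonoid Γ]
  {T T' : Type*} [LinearOrder T] [LinearOrder T']

/-- `S(α₁, …, αₙ; τ, τ')` for `n ≥ 1`. -/
def coeffS (τ : SDStability Γ T) (τ' : SDStability Γ T') (w : List Γ) : ℚ :=
  ∏ i ∈ Finset.range (w.length - 1),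
    if τ.slope (w.getD i 0) > τ.slope (w.getD (i + 1) 0) ∧
        τ'.slope (w.take (i + 1)).sum ≤ τ'.slope (w.drop (i + 1)).sum then 1
    else if τ.slope (w.getD i 0) ≤ τ.slope (w.getD (i + 1) 0) ∧
        τ'.slope (w.take (i + 1)).sum > τ'.slope (w.drop (i + 1)).sum then -1
    else 0

/-- The slope of the `i`-th entry (counted from `0`) of the tuple, with the convention
`τ(α_{n+1}) = 0` just behind the last entry. -/
def slopeAt (τ : SDStability Γ T) (w : List Γ) (i : ℕ) : T :=
  if i < w.length then τ.slope (w.getD i 0) else τ.zero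

/-- `S^sd(α₁, …, αₙ; τ, τ')` for `n ≥ 0`. -/
def coeffSsd (τ : SDStability Γ T) (τ' : SDStability Γ T') (w : List Γ) : ℚ :=
  ∏ i ∈ Finset.range w.length,
    if slopeAt τ w i > slopeAt τ w (i + 1) ∧ τ'.slope (w.take (i + 1)).sum ≤ τ'.zero then 1
    else if slopeAt τ w i ≤ slopeAt τ w (i + 1) ∧
        τ'.slope (w.take (i + 1)).sum > τ'.zero then -1
    else 0

/-- The generalized binomial coefficient `binom(-1/2, l)`. -/
def binomNegHalf (l : ℕ) : ℚ := ∏ k ∈ Finset.range l, (-1 / 2 - (k : ℚ)) / ((k : ℚ) + 1)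

/-- `U(α₁, …, αₙ; τ, τ')` for `n ≥ 1`. The composition `c` cuts `α₁, …, αₙ` into `m` non-empty
consecutive blocks with sums `β₁, …, β_m`; the composition `d` cuts `β₁, …, β_m` into `l` non-empty
consecutive blocks, with sums `γ₁, …, γ_l`. -/
def coeffU (τ : SDStability Γ T) (τ' : SDStability Γ T') (w : List Γ) : ℚ :=
  ∑ c : Composition w.length, ∑ d : Composition c.length,
    if (∀ A ∈ w.splitWrtComposition c, ∀ a ∈ A, τ.slope a = τ.slope A.sum) ∧
        (∀ B ∈ ((w.splitWrtComposition c).map List.sum).splitWrtComposition d,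
          τ'.slope B.sum = τ'.slope w.sum) then
      (-1) ^ (d.length - 1) / (d.length : ℚ) *
        ((((w.splitWrtComposition c).map List.sum).splitWrtComposition d).map
          (coeffS τ τ')).prod *
        (c.blocks.map fun k => 1 / (k.factorial : ℚ)).prod
    else 0

/-- `U^sd(α₁, …, αₙ; τ, τ')` for `n ≥ 0`. The first `p` entries are cut by `c` into `m` non-empty
consecutive blocks with sums `β₁, …, β_m`, while the other entries have slope `0`; the first `q` of
the `βᵢ` are cut by `d` into `l` non-empty consecutive blocks, with sums `γ₁, …, γ_l` of new slope
`0`. -/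
def coeffUsd (τ : SDStability Γ T) (τ' : SDStability Γ T') (w : List Γ) : ℚ :=
  ∑ p ∈ Finset.range (w.length + 1), ∑ c : Composition p,
    ∑ q ∈ Finset.range (c.length + 1), ∑ d : Composition q,
      if (∀ A ∈ (w.take p).splitWrtComposition c, ∀ a ∈ A, τ.slope a = τ.slope A.sum) ∧
          (∀ a ∈ w.drop p, τ.slope a = τ.zero) ∧
          (∀ B ∈ ((((w.take p).splitWrtComposition c).map List.sum).take q).splitWrtComposition d,
            τ'.slope B.sum = τ'.zero) then
        binomNegHalf d.length *
          ((((((w.take p).splitWrtComposition c).map List.sum).take q).splitWrtComposition d).map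
            (coeffS τ τ')).prod *
          coeffSsd τ τ' ((((w.take p).splitWrtComposition c).map List.sum).drop q) *
          (c.blocks.map fun k => 1 / (k.factorial : ℚ)).prod *
          (1 / (2 ^ (w.length - p) * ((w.length - p).factorial : ℚ)))
      else 0

/-- The left-nested product `b(… b(b(x₁, x₂), x₃) …, xₙ)` (and `0` for the empty tuple), used for
iterated brackets. -/
def nested {L : Type*} [Zero L] (b : L → L → L) : List L → L
  | [] => 0
  | x :: xs => xs.foldl b x

/-- The iterated commutator `[[[α₁, α₂], …], αₙ]` in the free associative algebra on `C`. -/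
noncomputable def freeBracket (w : List (NZ Γ)) : FreeAlgebra ℚ (NZ Γ) :=
  nested (fun x y => x * y - y * x) (w.map (FreeAlgebra.ι ℚ))

/-- The anti-automorphism of the free associative algebra on `C` that extends `α ↦ α^∨`. On the
free Lie algebra it satisfies `[x^∨, y^∨] = -[x, y]^∨`. -/
noncomputable def freeDual (x : FreeAlgebra ℚ (NZ Γ)) : FreeAlgebra ℚ (NZ Γ) :=
  (FreeAlgebra.lift ℚ
    (fun α : NZ Γ => MulOpposite.op (FreeAlgebra.ι ℚ α.dual)) x).unop

/-- `Ut` is a choice of coefficients `Ũ(…; τ, τ')`: rational numbers with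
`∑ Ũ(α₁, …, αₙ) [[[α₁, α₂], …], αₙ] = ∑ U(α₁, …, αₙ) α₁ * ⋯ * αₙ`
identically in free variables `α ∈ C`, i.e. the parts of each multidegree agree. -/
def IsLieCoeff (τ : SDStability Γ T) (τ' : SDStability Γ T') (Ut : List (NZ Γ) → ℚ) : Prop :=
  ∀ s : Multiset (NZ Γ), s ≠ 0 →
    ∑ᶠ w ∈ {w : List (NZ Γ) | (w : Multiset (NZ Γ)) = s}, Ut w • freeBracket w =
    ∑ᶠ w ∈ {w : List (NZ Γ) | (w : Multiset (NZ Γ)) = s},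
      coeffU τ τ' (w.map Subtype.val) • (w.map (FreeAlgebra.ι ℚ)).prod

/-- The orbit `{α, α^∨}` of the involution. -/
def NZ.orbit (α : NZ Γ) : Sym2 (NZ Γ) := s(α, α.dual)

/-- `Ut` is a choice of coefficients `Ũ^sd(…; …; τ, τ')` for tuples of non-empty tuples: rational
numbers with
`∑ Ũ^sd(α₁₁, …; …; αₙ₁, …) [[α₁₁, …], …] ♥ ⋯ ♥ [[αₙ₁, …], …] ♥ ρ = ∑ U^sd(α₁, …, αₙ) α₁ ⋄ ⋯ ⋄ αₙ ⋄ ρ`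
identically in free variables, where `x ♥ - = x ⋄ - - x^∨ ⋄ -`. As `♥` mixes `α` and `α^∨`, the parts
of the same multidegree in the orbits `{α, α^∨}` are compared. -/
def IsTwistedLieCoeff (τ : SDStability Γ T) (τ' : SDStability Γ T')
    (Ut : List (List (NZ Γ)) → ℚ) : Prop :=
  ∀ s : Multiset (Sym2 (NZ Γ)),
    ∑ᶠ ww ∈ {ww : List (List (NZ Γ)) | (∀ w ∈ ww, w ≠ []) ∧
        (ww.flatten.map NZ.orbit : Multiset (Sym2 (NZ Γ))) = s},
      Ut ww • (ww.map fun w => freeBracket w - freeDual (freeBracket w)).prod =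
    ∑ᶠ w ∈ {w : List (NZ Γ) | (w.map NZ.orbit : Multiset (Sym2 (NZ Γ))) = s},
      coeffUsd τ τ' (w.map Subtype.val) • (w.map (FreeAlgebra.ι ℚ)).prod

end Coefficients

/-! ### Involutive graded Lie algebras and twisted modules -/

/-- The structure of an involutive graded Lie algebra on the rational vector space `L`, with a
decomposition over classes compatible with all operations: `piece α a` is the part of class `α` and
degree `a`. -/
structure InvGradedLie (Γ : Type*) [AddCommMonoid Γ] [StarAddMonoid Γ]
    (L : Type*) [AddCommGroup L] [Module ℚ L] where
  piece : Γ → ℤ → Submodule ℚ L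
  indep : iSupIndep fun p : Γ × ℤ => piece p.1 p.2
  iSup_eq_top : ⨆ p : Γ × ℤ, piece p.1 p.2 = ⊤
  bracket : L →ₗ[ℚ] L →ₗ[ℚ] L
  bracket_mem : ∀ {α β a b x y}, x ∈ piece α a → y ∈ piece β b →
    bracket x y ∈ piece (α + β) (a + b)
  bracket_antisymm : ∀ {α β a b x y}, x ∈ piece α a → y ∈ piece β b →
    bracket x y + ((a * b).negOnePow : ℤ) • bracket y x = 0
  jacobi : ∀ {α β a b x y}, x ∈ piece α a → y ∈ piece β b → ∀ z,
    bracket x (bracket y z) - ((a * b).negOnePow : ℤ) • bracket y (bracket x z) =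
      bracket (bracket x y) z
  dual : L →ₗ[ℚ] L
  dual_mem : ∀ {α a x}, x ∈ piece α a → dual x ∈ piece (star α) a
  dual_dual : ∀ x, dual (dual x) = x
  bracket_dual : ∀ x y, bracket (dual x) (dual y) = -dual (bracket x y)

variable {Γ : Type*} [AddCommMonoid Γ] [StarAddMonoid Γ] {L : Type*} [AddCommGroup L] [Module ℚ L]

/-- The structure of a graded twisted module over `𝓛` on the rational vector space `M`, with a
compatible decomposition over classes: `piece θ m` is the part of class `θ` and degree `m`. -/
structure TwistedModule (𝓛 : InvGradedLie Γ L) (Θ : Type*) [AddAction Γ Θ]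
    (M : Type*) [AddCommGroup M] [Module ℚ M] where
  piece : Θ → ℤ → Submodule ℚ M
  indep : iSupIndep fun p : Θ × ℤ => piece p.1 p.2
  iSup_eq_top : ⨆ p : Θ × ℤ, piece p.1 p.2 = ⊤
  /-- the twisted action `x ♥ m` -/
  act : L →ₗ[ℚ] M →ₗ[ℚ] M
  act_mem : ∀ {α θ a k x m}, x ∈ 𝓛.piece α a → m ∈ piece θ k → act x m ∈ piece (α +ᵥ θ) (a + k)
  act_dual : ∀ x m, act x m = -act (𝓛.dual x) m
  jacobi : ∀ {α β a b x y}, x ∈ 𝓛.piece α a → y ∈ 𝓛.piece β b → ∀ m,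
    act x (act y m) - ((a * b).negOnePow : ℤ) • act y (act x m) =
      act (𝓛.bracket x y) m - act (𝓛.bracket x (𝓛.dual y)) m

/-- The relations `x y - (-1)^(ab) y x = [x, y]`, for homogeneous `x`, `y` of degrees `a`, `b`. -/
inductive EnvRel (𝓛 : InvGradedLie Γ L) : TensorAlgebra ℚ L → TensorAlgebra ℚ L → Prop
  | mk {α β : Γ} {a b : ℤ} {x y : L} (hx : x ∈ 𝓛.piece α a) (hy : y ∈ 𝓛.piece β b) :
      EnvRel 𝓛
        (TensorAlgebra.ι ℚ x * TensorAlgebra.ι ℚ y -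
          ((a * b).negOnePow : ℤ) • (TensorAlgebra.ι ℚ y * TensorAlgebra.ι ℚ x))
        (TensorAlgebra.ι ℚ (𝓛.bracket x y))

/-- The universal enveloping algebra `U(L)` of a graded Lie algebra. -/
def Env (𝓛 : InvGradedLie Γ L) : Type _ := RingQuot (EnvRel 𝓛)

noncomputable instance (𝓛 : InvGradedLie Γ L) : Ring (Env 𝓛) :=
  inferInstanceAs (Ring (RingQuot (EnvRel 𝓛)))

noncomputable instance (𝓛 : InvGradedLie Γ L) : Algebra ℚ (Env 𝓛) :=
  inferInstanceAs (Algebra ℚ (RingQuot (EnvRel 𝓛)))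

/-- The quotient map from the tensor algebra to `U(L)`. -/
noncomputable def Env.mk (𝓛 : InvGradedLie Γ L) : TensorAlgebra ℚ L →ₐ[ℚ] Env 𝓛 :=
  RingQuot.mkAlgHom ℚ (EnvRel 𝓛)

/-- The canonical map `L → U(L)`. -/
noncomputable def Env.of (𝓛 : InvGradedLie Γ L) : L →ₗ[ℚ] Env 𝓛 :=
  (Env.mk 𝓛).toLinearMap ∘ₗ TensorAlgebra.ι ℚ

variable {Θ : Type*} [AddAction Γ Θ] {M : Type*} [AddCommGroup M] [Module ℚ M]

/-- The `U(L)`-submodule of `U(L) ⊗ M` generated by the elements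
`x ⊗ m - x^∨ ⊗ m - 1 ⊗ (x ♥ m)`. -/
noncomputable def twRel {𝓛 : InvGradedLie Γ L} (𝓜 : TwistedModule 𝓛 Θ M) :
    Submodule (Env 𝓛) (Env 𝓛 ⊗[ℚ] M) :=
  Submodule.span (Env 𝓛)
    {z | ∃ (x : L) (m : M), z = Env.of 𝓛 x ⊗ₜ[ℚ] m - Env.of 𝓛 (𝓛.dual x) ⊗ₜ[ℚ] m -
      (1 : Env 𝓛) ⊗ₜ[ℚ] 𝓜.act x m}

/-- The twisted enveloping module `U^tw(L; M)`; the action `⋄` of `U(L)` is the scalar action. -/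
abbrev Utw {𝓛 : InvGradedLie Γ L} (𝓜 : TwistedModule 𝓛 Θ M) : Type _ :=
  (Env 𝓛 ⊗[ℚ] M) ⧸ twRel 𝓜

/-- The canonical map `M → U^tw(L; M)`, `m ↦ 1 ⊗ m`. -/
noncomputable def Utw.of {𝓛 : InvGradedLie Γ L} (𝓜 : TwistedModule 𝓛 Θ M) (m : M) : Utw 𝓜 :=
  (twRel 𝓜).mkQ ((1 : Env 𝓛) ⊗ₜ[ℚ] m)

/-- `x₁ ⋄ ⋯ ⋄ xₙ ⋄ m` lies in the class `α₁ + ⋯ + αₙ + ρ` part if each `xᵢ` lies in the class `αᵢ`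
part of `L` and `m` in the class `ρ` part of `M`. The subspace `U^tw_θ` is the span of these. -/
noncomputable def UtwPiece {𝓛 : InvGradedLie Γ L} (𝓜 : TwistedModule 𝓛 Θ M) (θ : Θ) :
    Submodule ℚ (Utw 𝓜) :=
  Submodule.span ℚ
    {z | ∃ (w : List (Γ × L)) (ρ : Θ) (m : M), (∀ p ∈ w, p.2 ∈ ⨆ a : ℤ, 𝓛.piece p.1 a) ∧
      m ∈ ⨆ k : ℤ, 𝓜.piece ρ k ∧ (w.map Prod.fst).sum +ᵥ ρ = θ ∧
      z = (w.map fun p => Env.of 𝓛 p.2).prod • Utw.of 𝓜 m}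

/-- The completed twisted enveloping module, the product of all `U^tw_θ`. -/
abbrev UtwHat {𝓛 : InvGradedLie Γ L} (𝓜 : TwistedModule 𝓛 Θ M) : Type _ :=
  ∀ θ : Θ, UtwPiece 𝓜 θ

/-! ### Invariants and wall-crossing -/

/-- A family of invariants for one stability condition: `ord α` stands for the invariant counting
semistable objects of class `α ∈ C`, and `sd θ` for the one counting semistable self-dual objects of
class `θ`. Both are of (shifted) degree `0`. As duality exchanges the semistable objects of classes
`α` and `α^∨`, the corresponding invariants are dual. -/
structure Invariants {𝓛 : InvGradedLie Γ L} (𝓜 : TwistedModule 𝓛 Θ M) where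
  ord : NZ Γ → L
  ord_mem : ∀ α, ord α ∈ 𝓛.piece α.1 0
  ord_dual : ∀ α, ord α.dual = 𝓛.dual (ord α)
  sd : Θ → M
  sd_mem : ∀ θ, sd θ ∈ 𝓜.piece θ 0

variable {𝓛 : InvGradedLie Γ L} {𝓜 : TwistedModule 𝓛 Θ M}
  {T T' : Type*} [LinearOrder T] [LinearOrder T']

/-- One term of the ordinary wall-crossing formula. -/
def wcfTerm (e : Invariants 𝓜) (Ut : List (NZ Γ) → ℚ) (w : List (NZ Γ)) : L :=
  Ut w • nested (fun x y => 𝓛.bracket x y) (w.map e.ord)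

/-- The ordinary wall-crossing formula with coefficients `Ut`, expressing the invariants `e'`
through `e`; the sum has only finitely many non-zero terms. -/
def WallCrossing (e e' : Invariants 𝓜) (Ut : List (NZ Γ) → ℚ) : Prop :=
  ∀ α : NZ Γ,
    {w : List (NZ Γ) | w ≠ [] ∧ total w = α ∧ wcfTerm e Ut w ≠ 0}.Finite ∧
    e'.ord α = ∑ᶠ w ∈ {w : List (NZ Γ) | w ≠ [] ∧ total w = α}, wcfTerm e Ut w

/-- One term of the self-dual wall-crossing formula. -/
def wcfSdTerm (e : Invariants 𝓜) (Ut : List (List (NZ Γ)) → ℚ)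
    (p : List (List (NZ Γ)) × Θ) : M :=
  Ut p.1 • p.1.foldr (fun w m => 𝓜.act (nested (fun x y => 𝓛.bracket x y) (w.map e.ord)) m)
    (e.sd p.2)

/-- The self-dual wall-crossing formula with coefficients `Ut`, expressing the invariants `e'`
through `e`; the sum has only finitely many non-zero terms. -/
def WallCrossingSd (e e' : Invariants 𝓜) (Ut : List (List (NZ Γ)) → ℚ) : Prop :=
  ∀ θ : Θ,
    {p : List (List (NZ Γ)) × Θ | (∀ w ∈ p.1, w ≠ []) ∧ total p.1.flatten +ᵥ p.2 = θ ∧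
      wcfSdTerm e Ut p ≠ 0}.Finite ∧
    e'.sd θ = ∑ᶠ p ∈ {p : List (List (NZ Γ)) × Θ | (∀ w ∈ p.1, w ≠ []) ∧
      total p.1.flatten +ᵥ p.2 = θ}, wcfSdTerm e Ut p

/-- The tuples of classes in `C` with sum `α` and all of the same slope. -/
def deltaIndex (τ : SDStability Γ T) (α : NZ Γ) : Set (List (NZ Γ)) :=
  {w | total w = α ∧ ∀ β ∈ w, ∀ γ ∈ w, τ.slope β = τ.slope γ}

/-- One term of `δ_α(τ)`. -/
noncomputable def deltaTerm (e : Invariants 𝓜) (w : List (NZ Γ)) : Env 𝓛 :=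
  (1 / (w.length.factorial : ℚ)) • (w.map fun β => Env.of 𝓛 (e.ord β)).prod

/-- The element `δ_α(τ)` of `U(L)`. -/
noncomputable def delta (τ : SDStability Γ T) (e : Invariants 𝓜) (α : NZ Γ) : Env 𝓛 :=
  ∑ᶠ w ∈ deltaIndex τ α, deltaTerm e w

/-- The pairs of a tuple of classes in `C` of slope `0` and a `ρ`, with total class `θ`. -/
def deltaSdIndex (τ : SDStability Γ T) (θ : Θ) : Set (List (NZ Γ) × Θ) :=
  {p | total p.1 +ᵥ p.2 = θ ∧ ∀ β ∈ p.1, τ.slope β = τ.zero}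

/-- One term of `δ^sd_θ(τ)`. -/
noncomputable def deltaSdTerm (e : Invariants 𝓜) (p : List (NZ Γ) × Θ) : Utw 𝓜 :=
  (1 / (2 ^ p.1.length * (p.1.length.factorial : ℚ))) •
    ((p.1.map fun β => Env.of 𝓛 (e.ord β)).prod • Utw.of 𝓜 (e.sd p.2))

/-- The element `δ^sd_θ(τ)` of `U^tw(L; M)`. -/
noncomputable def deltaSd (τ : SDStability Γ T) (e : Invariants 𝓜) (θ : Θ) : Utw 𝓜 :=
  ∑ᶠ p ∈ deltaSdIndex τ θ, deltaSdTerm e p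

/-- The sums defining `δ_α(τ)` and `δ^sd_θ(τ)` have only finitely many non-zero terms. -/
def DeltaFinite (τ : SDStability Γ T) (e : Invariants 𝓜) : Prop :=
  (∀ α : NZ Γ, {w ∈ deltaIndex τ α | deltaTerm e w ≠ 0}.Finite) ∧
  (∀ θ : Θ, {p ∈ deltaSdIndex τ θ | deltaSdTerm e p ≠ 0}.Finite)

/-- The pairs of a tuple with `τ(α₁) > ⋯ > τ(αₙ) > 0` and a `ρ`, with total class `θ`. -/
def ksIndex (τ : SDStability Γ T) (θ : Θ) : Set (List (NZ Γ) × Θ) :=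
  {p | p.1.Pairwise (fun α β => τ.slope α > τ.slope β) ∧ (∀ α ∈ p.1, τ.slope α > τ.zero) ∧
    total p.1 +ᵥ p.2 = θ}

/-- The term `δ_{α₁}(τ) ⋄ ⋯ ⋄ δ_{αₙ}(τ) ⋄ δ^sd_ρ(τ)`. -/
noncomputable def ksTerm (τ : SDStability Γ T) (e : Invariants 𝓜) (p : List (NZ Γ) × Θ) : Utw 𝓜 :=
  (p.1.map (delta τ e)).prod • deltaSd τ e p.2

/-- For each `θ`, only finitely many of the terms of class `θ` are non-zero. -/
def KSFinite (τ : SDStability Γ T) (e : Invariants 𝓜) : Prop :=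
  ∀ θ : Θ, {p ∈ ksIndex τ θ | ksTerm τ e p ≠ 0}.Finite

/-! The terms of class `θ` lie in `U^tw_θ`. -/

lemma prod_smul_mem {w : List (Γ × L)} (hw : ∀ p ∈ w, p.2 ∈ ⨆ a : ℤ, 𝓛.piece p.1 a)
    {θ : Θ} {z : Utw 𝓜} (hz : z ∈ UtwPiece 𝓜 θ) :
    (w.map fun p => Env.of 𝓛 p.2).prod • z ∈ UtwPiece 𝓜 ((w.map Prod.fst).sum +ᵥ θ) := by
  unfold UtwPiece at hz
  induction hz using Submodule.span_induction with
  | mem z hz =>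
    obtain ⟨v, ρ, m, hv, hm, rfl, rfl⟩ := hz
    refine Submodule.subset_span ⟨w ++ v, ρ, m, ?_, hm, ?_, ?_⟩
    · intro p hp
      rcases List.mem_append.mp hp with h | h
      · exact hw p h
      · exact hv p h
    · simp [add_vadd]
    · simp [mul_smul]
  | zero => rw [smul_zero]; exact Submodule.zero_mem _
  | add x y _ _ hx hy => rw [smul_add]; exact Submodule.add_mem _ hx hy
  | smul c x _ hx =>
    rw [smul_comm]
    exact Submodule.smul_mem _ c hx

lemma ord_prod_smul_mem (e : Invariants 𝓜) (w : List (NZ Γ)) {θ : Θ} {z : Utw 𝓜}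
    (hz : z ∈ UtwPiece 𝓜 θ) :
    (w.map fun β => Env.of 𝓛 (e.ord β)).prod • z ∈ UtwPiece 𝓜 (total w +ᵥ θ) := by
  have h := prod_smul_mem (w := w.map fun β : NZ Γ => ((β : Γ), e.ord β)) (𝓛 := 𝓛) (𝓜 := 𝓜)
    (by
      intro p hp
      obtain ⟨β, -, rfl⟩ := List.mem_map.mp hp
      exact Submodule.mem_iSup_of_mem 0 (e.ord_mem β)) hz
  simpa [total, List.map_map, Function.comp_def] using h

lemma deltaSd_mem (τ : SDStability Γ T) (e : Invariants 𝓜) (θ : Θ) :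
    deltaSd τ e θ ∈ UtwPiece 𝓜 θ := by
  refine finsum_mem_induction (· ∈ UtwPiece 𝓜 θ) (Submodule.zero_mem _)
    (fun _ _ => Submodule.add_mem _) ?_
  rintro ⟨w, ρ⟩ ⟨rfl, -⟩
  refine Submodule.smul_mem _ _ (ord_prod_smul_mem e w (Submodule.subset_span ?_))
  exact ⟨[], ρ, e.sd ρ, by simp, Submodule.mem_iSup_of_mem 0 (e.sd_mem ρ), by simp, by simp⟩

lemma delta_smul_mem (τ : SDStability Γ T) (e : Invariants 𝓜) (α : NZ Γ) {θ : Θ} {z : Utw 𝓜}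
    (hz : z ∈ UtwPiece 𝓜 θ) : delta τ e α • z ∈ UtwPiece 𝓜 ((α : Γ) +ᵥ θ) := by
  refine finsum_mem_induction (fun u : Env 𝓛 => u • z ∈ UtwPiece 𝓜 ((α : Γ) +ᵥ θ)) ?_ ?_ ?_
  · rw [zero_smul]; exact Submodule.zero_mem _
  · intro x y hx hy
    rw [add_smul]; exact Submodule.add_mem _ hx hy
  · rintro w ⟨hw, -⟩
    rw [← hw, deltaTerm, smul_assoc]
    exact Submodule.smul_mem _ _ (ord_prod_smul_mem e w hz)

lemma ksTerm_mem (τ : SDStability Γ T) (e : Invariants 𝓜) (p : List (NZ Γ) × Θ) :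
    ksTerm τ e p ∈ UtwPiece 𝓜 (total p.1 +ᵥ p.2) := by
  obtain ⟨w, ρ⟩ := p
  induction w with
  | nil => simpa [ksTerm, total] using deltaSd_mem τ e ρ
  | cons α w ih =>
    have h := delta_smul_mem τ e α ih
    simpa [ksTerm, total, mul_smul, add_vadd] using h

/-- The sum of all `δ_{α₁}(τ) ⋄ ⋯ ⋄ δ_{αₙ}(τ) ⋄ δ^sd_ρ(τ)` with `τ(α₁) > ⋯ > τ(αₙ) > 0`, as an
element of the completed twisted enveloping module. -/
noncomputable def ksSum (τ : SDStability Γ T) (e : Invariants 𝓜) : UtwHat 𝓜 := fun θ =>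
  ⟨∑ᶠ p ∈ ksIndex τ θ, ksTerm τ e p, by
    refine finsum_mem_induction (· ∈ UtwPiece 𝓜 θ) (Submodule.zero_mem _)
      (fun _ _ => Submodule.add_mem _) ?_
    rintro p ⟨-, -, rfl⟩
    exact ksTerm_mem τ e p⟩

end SDWallCrossing

open SDWallCrossing

/-! Fix a class θ. After expansion of `delta`, `deltaSd` and the invariants for τ', both sides
become sums of words ε_{α₁} ⋄ ⋯ ⋄ ε_{αₙ} ⋄ ε^sd_ρ of class θ in the invariants for τ. Two things are
needed: the coefficients of each word agree, and the expansions may be rearranged.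

Coefficients. A family of coefficients is a formal series in non-commuting letters. Such series have
a product `conv` and a substitution `subst`, in which a block of letters is replaced by its sum.
Substitution is multiplicative (`subst_conv`) and associative (`subst_subst`), and `ev_expand` says
that these operations compute the expansion of words whose letters are themselves sums of words. In
this language δ is the exponential of ε at a fixed slope, and δ^sd is exp(½ε) applied to ε^sd. The
series U is exp for τ, followed by S, followed by log for τ'. The series U^sd contains the factor
(1+x)^{-1/2} that cancels the square root exp(½ log(1+x)) coming from δ^sd(τ'). So
`conv_subst_wordU` reduces to `conv_subst_wordS`, the corresponding statement about δ. There S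
factors through τ-descending words (`wordS_cons`), and so does S^sd up to a final τ-descending word
(`wordSsd_eq`). What remains is `conv_subst_dec`, the inversion of the Harder–Narasimhan recursion
for τ'. It holds because the partial sums of a word have exactly one first minimum of the slope
(`splitSum_firstMin`).

The wall-crossing formulae are stated with brackets and ♥. In degree 0 brackets become commutators,
and x ♥ m becomes (x - x^∨) ⋄ m. The defining identities of Ũ and Ũ^sd in the free algebra,
evaluated one multidegree at a time, therefore turn these formulae into series with coefficients U
and U^sd (`Env.of_wallCrossing`, `Utw.of_wallCrossing`).

Rearrangement. The hypotheses bound the non-zero products of δ's, not the words in ε's, and a priori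
words could cancel. They cannot: a positive combination of words in non-zero invariants is non-zero
(`Invariants.Positive.ne_zero`). This rests on a Poincaré–Birkhoff–Witt statement,
`exists_leading_form`: suitable linear forms on L and M multiply to a form on words of length n that
vanishes on shorter words and descends to the twisted enveloping module. It is proved by
straightening words in a homogeneous eigenbasis of the involution and checking all ambiguities as in
the diamond lemma. Now dualise the letters of negative slope in a word, which does not change its
class, and sort by slope. The result occurs in some non-zero product of δ's, so each class has only
finitely many words (`finitelyManyWords`). -/

namespace SDWallCrossing

/-! ### Sums over deconcatenations and block substitution -/

section Words

variable {X R : Type*}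

/-- The sum of `B u v` over all ways to write a word as a concatenation `u ++ v`. -/
def splitSum [AddCommMonoid R] : (List X → List X → R) → List X → R
  | B, [] => B [] []
  | B, a :: w => B [] (a :: w) + splitSum (fun u v => B (a :: u) v) w

lemma splitSum_nil [AddCommMonoid R] (B : List X → List X → R) : splitSum B [] = B [] [] := rfl

lemma splitSum_cons [AddCommMonoid R] (B : List X → List X → R) (a : X) (w : List X) :
    splitSum B (a :: w) = B [] (a :: w) + splitSum (fun u v => B (a :: u) v) w := rfl

lemma splitSum_eq_sum [AddCommMonoid R] (B : List X → List X → R) (w : List X) :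
    splitSum B w = ∑ i ∈ Finset.range (w.length + 1), B (w.take i) (w.drop i) := by
  induction w generalizing B with
  | nil => simp [splitSum]
  | cons a w ih =>
    rw [splitSum_cons, ih, List.length_cons, Finset.sum_range_succ' _ (w.length + 1), add_comm]
    simp

lemma splitSum_congr [AddCommMonoid R] {B B' : List X → List X → R} {w : List X}
    (h : ∀ u v, u ++ v = w → B u v = B' u v) : splitSum B w = splitSum B' w := by
  rw [splitSum_eq_sum, splitSum_eq_sum]
  exact Finset.sum_congr rfl fun i _ => h _ _ (List.take_append_drop i w)

lemma splitSum_add [AddCommMonoid R] (B B' : List X → List X → R) (w : List X) :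
    splitSum (fun u v => B u v + B' u v) w = splitSum B w + splitSum B' w := by
  simp [splitSum_eq_sum, Finset.sum_add_distrib]

lemma splitSum_zero [AddCommMonoid R] (w : List X) :
    splitSum (fun _ _ => (0 : R)) w = 0 := by
  simp [splitSum_eq_sum]

lemma splitSum_mul_left [Semiring R] (c : R) (B : List X → List X → R) (w : List X) :
    splitSum (fun u v => c * B u v) w = c * splitSum B w := by
  simp [splitSum_eq_sum, Finset.mul_sum]

lemma splitSum_mul_right [Semiring R] (c : R) (B : List X → List X → R) (w : List X) :
    splitSum (fun u v => B u v * c) w = splitSum B w * c := by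
  simp [splitSum_eq_sum, Finset.sum_mul]

/-- Both ways to sum over `w = u ++ v ++ x` agree. -/
lemma splitSum_assoc [AddCommMonoid R] (B : List X → List X → List X → R) (w : List X) :
    splitSum (fun u x => splitSum (fun a b => B a b x) u) w =
      splitSum (fun a v => splitSum (fun b x => B a b x) v) w := by
  induction w generalizing B with
  | nil => rfl
  | cons c w ih =>
    simp only [splitSum_cons, splitSum_nil, splitSum_add, ih, add_assoc]

/-- The product of formal series in non-commuting variables. -/
def conv (f g : List X → ℚ) (w : List X) : ℚ := splitSum (fun u v => f u * g v) w

lemma conv_assoc (f g h : List X → ℚ) : conv (conv f g) h = conv f (conv g h) := by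
  funext w
  simp only [conv, ← splitSum_mul_left, ← splitSum_mul_right]
  rw [splitSum_assoc (fun a b x => f a * g b * h x)]
  simp [mul_assoc]

lemma conv_mul_left (c : ℚ) (f g : List X → ℚ) (w : List X) :
    conv (fun u => c * f u) g w = c * conv f g w := by
  simp only [conv, mul_assoc, splitSum_mul_left]

/-- The series `1`. -/
def oneSeries (w : List X) : ℚ := if w = [] then 1 else 0

lemma splitSum_nil_left [AddCommMonoid R] {B : List X → List X → R} {w : List X}
    (h : ∀ a u v, B (a :: u) v = 0) : splitSum B w = B [] w := by
  cases w with
  | nil => rfl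
  | cons a w => simp [splitSum_cons, h, splitSum_zero]

lemma one_conv (f : List X → ℚ) : conv oneSeries f = f := by
  funext w
  rw [conv, splitSum_nil_left] <;> simp [oneSeries]

lemma splitSum_length {B : ℕ → ℕ → ℚ} (w : List X) :
    splitSum (fun u v : List X => B u.length v.length) w =
      ∑ p ∈ Finset.HasAntidiagonal.antidiagonal w.length, B p.1 p.2 := by
  rw [splitSum_eq_sum, Finset.Nat.sum_antidiagonal_eq_sum_range_succ_mk]
  refine Finset.sum_congr rfl fun i hi => ?_
  simp only [Finset.mem_range] at hi
  simp [min_eq_left (Nat.lt_succ_iff.mp hi)]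

/-- Induction on the length of words, with access to all proper suffixes. -/
lemma suffix_induction {P : List X → Prop} (w : List X) (nil : P [])
    (cons : ∀ a w, (∀ u v, u ++ v = w → P v) → P (a :: w)) : P w := by
  induction h : w.length using Nat.strong_induction_on generalizing w with
  | _ n ih =>
    cases w with
    | nil => exact nil
    | cons a w =>
      refine cons a w fun u v huv => ih v.length ?_ v rfl
      subst huv h
      simp

variable [AddCommSemigroup X]

/-- The sum of the letters of the word `a :: w`. -/
def tot (a : X) (w : List X) : X := w.foldl (· + ·) a

@[simp] lemma tot_nil (a : X) : tot a [] = a := rfl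

lemma tot_cons (a b : X) (w : List X) : tot a (b :: w) = tot (a + b) w := rfl

lemma tot_add (a b : X) (w : List X) : tot (a + b) w = a + tot b w := by
  induction w generalizing b with
  | nil => rfl
  | cons c w ih => rw [tot_cons, tot_cons, add_assoc, ih]

lemma tot_append (a : X) (u v : List X) : tot a (u ++ v) = tot (tot a u) v := by
  simp [tot, List.foldl_append]

/-- Substitution of the series `f` for block sums: the sum of `F(β₁, …, βₘ) f(w₁) ⋯ f(wₘ)` over all
ways to cut a word into non-empty blocks `wᵢ`, with sums `βᵢ`. -/
def subst (f : List X → ℚ) : (List X → ℚ) → List X → ℚ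
  | F, [] => F []
  | F, a :: w => ∑ i : Fin (w.length + 1), f (a :: w.take i) *
      subst f (fun t => F (tot a (w.take i) :: t)) (w.drop i)
termination_by _ w => w.length
decreasing_by simp

@[simp] lemma subst_nil (f F : List X → ℚ) : subst f F [] = F [] := by rw [subst]

lemma subst_cons (f F : List X → ℚ) (a : X) (w : List X) :
    subst f F (a :: w) = splitSum (fun u v => f (a :: u) * subst f (fun t => F (tot a u :: t)) v) w
    := by
  rw [subst, splitSum_eq_sum, Finset.sum_range]

lemma subst_congr_left {f f' : List X → ℚ} (h : ∀ a w, f (a :: w) = f' (a :: w)) (F : List X → ℚ) :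
    subst f F = subst f' F := by
  funext w
  induction w using suffix_induction generalizing F with
  | nil => simp
  | cons a w ih =>
    rw [subst_cons, subst_cons]
    exact splitSum_congr fun u v huv => by rw [h, ih u v huv]

lemma subst_mul_left (f F : List X → ℚ) (c : ℚ) (w : List X) :
    subst f (fun t => c * F t) w = c * subst f F w := by
  induction w using suffix_induction generalizing F with
  | nil => simp
  | cons a w ih =>
    rw [subst_cons, subst_cons, ← splitSum_mul_left]
    exact splitSum_congr fun u v huv => by rw [ih u v huv]; ring

lemma subst_add (f F G : List X → ℚ) (w : List X) :
    subst f (fun t => F t + G t) w = subst f F w + subst f G w := by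
  induction w using suffix_induction generalizing F G with
  | nil => simp
  | cons a w ih =>
    rw [subst_cons, subst_cons, subst_cons, ← splitSum_add]
    exact splitSum_congr fun u v huv => by rw [ih u v huv]; ring

lemma subst_zero (f : List X → ℚ) (w : List X) : subst f (fun _ => 0) w = 0 := by
  simpa using subst_mul_left f (fun _ => 0) 0 w

/-- Sums over blocks are compatible with forming totals. -/
lemma subst_tot (f : List X → ℚ) (G : X → List X → ℚ) (b : X) (w : List X) :
    subst f (fun t => G (tot b t) t) w = subst f (fun t => G (tot b w) t) w := by
  induction w using suffix_induction generalizing G b with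
  | nil => simp
  | cons a w ih =>
    rw [subst_cons, subst_cons]
    refine splitSum_congr fun u v huv => ?_
    simp only [tot_cons]
    rw [ih u v huv (fun x t => G x (tot a u :: t)) (b + tot a u)]
    subst huv
    rw [tot_append, tot_add, tot_add, tot_add, ← tot_add]

/-- Block substitution is multiplicative, in a bilinear form. -/
lemma subst_splitSum (f : List X → ℚ) (B : List X → List X → ℚ) (w : List X) :
    subst f (splitSum B) w = splitSum (fun u v => subst f (fun s => subst f (B s) v) u) w := by
  induction w using suffix_induction generalizing B with
  | nil => simp [splitSum]
  | cons a w ih =>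
    rw [subst_cons, splitSum_cons]
    simp only [splitSum_cons, subst_nil, subst_add, mul_add, splitSum_add]
    congr 1
    · rw [subst_cons]
    · simp only [subst_cons]
      rw [splitSum_assoc (fun u b v => f (a :: u) *
        subst f (fun t => subst f (B (tot a u :: t)) v) b)]
      refine splitSum_congr fun u v huv => ?_
      rw [ih u v huv, splitSum_mul_left]

lemma subst_mul_right (f F : List X → ℚ) (c : ℚ) (w : List X) :
    subst f (fun t => F t * c) w = subst f F w * c := by
  simp only [mul_comm _ c, subst_mul_left]

lemma subst_conv (f F G : List X → ℚ) :
    subst f (conv F G) = conv (subst f F) (subst f G) := by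
  funext w
  change subst f (splitSum fun u v => F u * G v) w = _
  rw [subst_splitSum, conv]
  simp only [subst_mul_left, subst_mul_right]

lemma subst_oneSeries (f : List X → ℚ) : subst f oneSeries = oneSeries := by
  funext w
  cases w with
  | nil => simp
  | cons a w => simp [subst_cons, oneSeries, subst_zero, splitSum_zero]

/-- Cutting into blocks preserves the total, so a factor that depends only on the total is constant
and leaves the sum. -/
lemma subst_cons_tot (f h : List X → ℚ) (k : X → ℚ) (a : X) (u : List X) :
    subst f (fun s => match s with
      | [] => 0
      | b :: t => h (b :: t) * k (tot b t)) (a :: u) = subst f h (a :: u) * k (tot a u) := by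
  rw [subst_cons, subst_cons, ← splitSum_mul_right]
  refine splitSum_congr fun x y hxy => ?_
  rw [subst_tot f (fun z t => h (tot a x :: t) * k z) (tot a x), subst_mul_right, ← tot_append, hxy,
    mul_assoc]

/-- Block substitution is associative. -/
lemma subst_subst (f h F : List X → ℚ) : subst f (subst h F) = subst (subst f h) F := by
  funext w
  induction w using suffix_induction generalizing F with
  | nil => simp
  | cons a w ih =>
    -- The outer substitution is written as a sum over deconcatenations, with `u` its first outer
    -- block, so that `subst_splitSum` applies. The empty word is kept apart because an outer block
    -- must be non-empty.
    have key : subst h F = fun s => F [] * oneSeries s + splitSum (fun u v => match u with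
        | [] => 0
        | b :: t => h (b :: t) * subst h (fun t' => F (tot b t :: t')) v) s := by
      funext s
      cases s with
      | nil => simp [oneSeries, splitSum]
      | cons b t => simp [oneSeries, splitSum_cons, subst_cons]
    rw [key, subst_add, subst_mul_left, subst_oneSeries, subst_splitSum, subst_cons, splitSum_cons]
    simp only [oneSeries, subst_nil, subst_zero]
    simp only [reduceCtorEq, if_false, mul_zero, zero_add]
    refine splitSum_congr fun u v huv => ?_
    rw [← ih u v huv (fun t => F (tot a u :: t)),
      ← subst_cons_tot f h (fun x => subst f (subst h fun t => F (x :: t)) v) a u]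
    congr 1
    funext s
    cases s with
    | nil => simp [subst_zero]
    | cons b t => simp only [subst_mul_left]

end Words

/-! ### Series depending only on the length of words -/

section LengthSeries

variable {X : Type*}

/-- The series whose coefficients depend only on the length of a word. -/
def lenSeries (X : Type*) (h : ℕ → ℚ) (w : List X) : ℚ := h w.length

/-- The generalized binomial coefficient `binom(c, n)`. -/
def genBinom (c : ℚ) (n : ℕ) : ℚ := ∏ k ∈ Finset.range n, (c - k) / ((k : ℚ) + 1)

/-- The coefficients of `exp(c x)`. -/
def expCoeff (c : ℚ) (n : ℕ) : ℚ := c ^ n / (n.factorial : ℚ)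

/-- The coefficients of `log(1 + x)`. -/
def logCoeff (n : ℕ) : ℚ := (-1) ^ (n - 1) / (n : ℚ)

/-- The binomial theorem, as exp(cx) exp(dx) = exp((c+d)x). -/
lemma conv_lenSeries_expCoeff (c d : ℚ) :
    conv (lenSeries X (expCoeff c)) (lenSeries X (expCoeff d)) = lenSeries X (expCoeff (c + d)) := by
  funext w
  rw [conv]
  change splitSum (fun u v : List X => expCoeff c u.length * expCoeff d v.length) w = _
  rw [splitSum_length (B := fun i j => expCoeff c i * expCoeff d j)]
  simp only [lenSeries, expCoeff]
  rw [(Commute.all c d).add_pow', Finset.sum_div]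
  refine Finset.sum_congr rfl fun p hp => ?_
  rw [Finset.HasAntidiagonal.mem_antidiagonal] at hp
  rw [← hp, nsmul_eq_mul, Nat.cast_add_choose]
  have := Nat.factorial_ne_zero (p.1 + p.2)
  field_simp

/-- The coefficient of X^k in (1+X) (ℓ^{r+1})' = (r+1) ℓ^r, where ℓ = log(1+X). -/
lemma coeff_log_pow_succ (r k : ℕ) :
    ((k : ℚ) + 1) * PowerSeries.coeff (k + 1) (PowerSeries.log ℚ ^ (r + 1)) +
      k * PowerSeries.coeff k (PowerSeries.log ℚ ^ (r + 1)) =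
      ((r : ℚ) + 1) * PowerSeries.coeff k (PowerSeries.log ℚ ^ r) := by
  have h1 : (1 + PowerSeries.X) * PowerSeries.derivative ℚ (PowerSeries.log ℚ) = 1 := by
    rw [PowerSeries.deriv_log]
    ext n
    rw [add_mul, one_mul, map_add]
    cases n with
    | zero => simp
    | succ n => simp [PowerSeries.coeff_succ_X_mul, PowerSeries.coeff_one, pow_succ]
  have h2 : (1 + PowerSeries.X) * PowerSeries.derivative ℚ (PowerSeries.log ℚ ^ (r + 1)) =
      ((r : ℚ) + 1) • PowerSeries.log ℚ ^ r := by
    rw [Derivation.leibniz_pow]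
    simp only [Nat.add_sub_cancel, smul_eq_mul]
    rw [mul_smul_comm, mul_left_comm, h1, mul_one, ← Nat.cast_smul_eq_nsmul ℚ]
    push_cast
    rfl
  have h3 := congrArg (PowerSeries.coeff k) h2
  rw [add_mul, one_mul, map_add] at h3
  rw [map_smul, smul_eq_mul, PowerSeries.coeff_derivative] at h3
  rw [← h3]
  cases k with
  | zero => simp [PowerSeries.coeff_zero_X_mul]
  | succ k =>
    rw [PowerSeries.coeff_succ_X_mul, PowerSeries.coeff_derivative]
    push_cast
    ring

lemma coeff_log_pow_of_lt {k r : ℕ} (h : k < r) :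
    PowerSeries.coeff k (PowerSeries.log ℚ ^ r) = 0 := by
  apply PowerSeries.coeff_of_lt_order
  refine lt_of_lt_of_le (Nat.cast_lt.mpr h) ?_
  refine le_trans ?_ (PowerSeries.le_order_pow _ _)
  rw [PowerSeries.order_log]
  simp

/-- This is exp(c log(1+x)) = (1+x)^c. By `coeff_log_pow_succ` the left side satisfies (k+1) b_{k+1}
= (c-k) b_k, the recursion of the binomial coefficients. Truncation at `N` loses nothing, as
log(1+x)^r starts in degree r. -/
lemma sum_coeff_log_pow (c : ℚ) (N k : ℕ) (h : k ≤ N) :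
    ∑ r ∈ Finset.range (N + 1), expCoeff c r * PowerSeries.coeff k (PowerSeries.log ℚ ^ r) =
      genBinom c k := by
  induction k with
  | zero =>
    rw [Finset.sum_eq_single 0]
    · simp [expCoeff, genBinom]
    · intro r _ hr
      rw [coeff_log_pow_of_lt (Nat.pos_of_ne_zero hr), mul_zero]
    · simp
  | succ k ih =>
    specialize ih (by omega)
    have hk : ((k : ℚ) + 1) ≠ 0 := by positivity
    rw [genBinom, Finset.prod_range_succ, ← genBinom, ← mul_right_inj' hk,
      show ((k : ℚ) + 1) * (genBinom c k * ((c - k) / (k + 1))) = c * genBinom c k - k * genBinom c k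
        by field_simp]
    have ih' := ih
    rw [Finset.sum_range_succ, coeff_log_pow_of_lt (Nat.lt_of_succ_le h), mul_zero, add_zero] at ih'
    have h0 : (k : ℚ) * (expCoeff c 0 * PowerSeries.coeff k (PowerSeries.log ℚ ^ 0)) = 0 := by
      cases k <;> simp [PowerSeries.coeff_one]
    have h0' : PowerSeries.coeff (k + 1) (PowerSeries.log ℚ ^ 0) = 0 := by
      simp [PowerSeries.coeff_one]
    have ih2 := congrArg ((k : ℚ) * ·) ih
    simp only [Finset.sum_range_succ' _ N, mul_add, h0, add_zero] at ih2
    rw [← ih2, ← ih', Finset.sum_range_succ' _ N, h0', mul_zero, add_zero, Finset.mul_sum,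
      Finset.mul_sum, Finset.mul_sum]
    rw [← Finset.sum_sub_distrib]
    refine Finset.sum_congr rfl fun r _ => ?_
    have h4 := coeff_log_pow_succ r k
    have h5 : expCoeff c (r + 1) * ((r : ℚ) + 1) = c * expCoeff c r := by
      have := Nat.factorial_ne_zero r
      simp only [expCoeff, Nat.factorial_succ, pow_succ]
      push_cast
      field_simp
    linear_combination (expCoeff c (r + 1)) * h4 + (PowerSeries.coeff k (PowerSeries.log ℚ ^ r)) * h5

variable [AddCommSemigroup X]

/-- For series that see only lengths, block substitution is composition of power series in one
variable. Cutting off the first block corresponds to one factor log(1+x) of a power. -/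
lemma subst_logCoeff_lenSeries (h : ℕ → ℚ) (w : List X) (N : ℕ) (hN : w.length ≤ N) :
    subst (lenSeries X logCoeff) (lenSeries X h) w =
      ∑ r ∈ Finset.range (N + 1), h r * PowerSeries.coeff w.length (PowerSeries.log ℚ ^ r) := by
  induction w using suffix_induction generalizing h N with
  | nil =>
    rw [Finset.sum_eq_single 0]
    · simp [lenSeries]
    · intro r _ hr
      rw [List.length_nil, coeff_log_pow_of_lt (Nat.pos_of_ne_zero hr), mul_zero]
    · simp
  | cons a w ih =>
    obtain _ | N := N
    · simp at hN
    simp only [List.length_cons, add_le_add_iff_right] at hN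
    have h1 : subst (lenSeries X logCoeff) (lenSeries X h) (a :: w) =
        splitSum (fun u v : List X => logCoeff (u.length + 1) *
          ∑ r ∈ Finset.range (N + 1), h (r + 1) *
            PowerSeries.coeff v.length (PowerSeries.log ℚ ^ r)) w := by
      rw [subst_cons]
      refine splitSum_congr fun u v huv => ?_
      rw [← ih u v huv (fun r => h (r + 1)) N (by subst huv; simp at hN; omega)]
      rfl
    rw [h1, splitSum_length (B := fun i j => logCoeff (i + 1) *
          ∑ r ∈ Finset.range (N + 1), h (r + 1) *
            PowerSeries.coeff j (PowerSeries.log ℚ ^ r)), Finset.sum_range_succ' _ (N + 1)]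
    simp only [List.length_cons, pow_zero, PowerSeries.coeff_one, Nat.add_eq_zero_iff, one_ne_zero,
      and_false, if_false, mul_zero, add_zero, Finset.mul_sum]
    rw [Finset.sum_comm]
    refine Finset.sum_congr rfl fun r _ => ?_
    rw [pow_succ', PowerSeries.coeff_mul, Finset.Nat.sum_antidiagonal_succ, mul_add,
      Finset.mul_sum]
    simp only [PowerSeries.coeff_log, if_true, zero_mul, mul_zero, zero_add]
    refine Finset.sum_congr rfl fun p _ => ?_
    simp [logCoeff, pow_succ]
    ring

lemma subst_log_exp (c : ℚ) :
    subst (lenSeries X logCoeff) (lenSeries X (expCoeff c)) = lenSeries X (genBinom c) := by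
  funext w
  rw [subst_logCoeff_lenSeries _ _ _ le_rfl, sum_coeff_log_pow _ _ _ le_rfl, lenSeries]

/-- The identity (1+x)^c (1+x)^{-c} = 1, obtained from exp(cx) exp(-cx) = 1 by substituting
log(1+x). -/
lemma conv_genBinom_neg (c : ℚ) :
    conv (lenSeries X (genBinom c)) (lenSeries X (genBinom (-c))) = oneSeries := by
  rw [← subst_log_exp, ← subst_log_exp, ← subst_conv, conv_lenSeries_expCoeff, add_neg_cancel,
    ← subst_oneSeries (lenSeries X logCoeff)]
  congr 1
  funext w
  cases w <;> simp [lenSeries, expCoeff, oneSeries]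

lemma genBinom_one_add_two (n : ℕ) : genBinom 1 (n + 2) = 0 := by
  refine Finset.prod_eq_zero (i := 1) (by simp) (by simp)

/-- Substitution into `1 + x`. -/
lemma subst_genBinom_one (f : List X → ℚ) (a : X) (w : List X) :
    subst f (lenSeries X (genBinom 1)) (a :: w) = f (a :: w) := by
  have key : ∀ v : List X, subst f (fun t => genBinom 1 (t.length + 1)) v = oneSeries v := by
    intro v
    cases v with
    | nil => simp [genBinom, oneSeries]
    | cons b v => simp [subst_cons, genBinom_one_add_two, oneSeries, subst_zero, splitSum_zero]
  have h1 : ∀ w : List X, splitSum (fun u v => f (a :: u) * oneSeries v) w = f (a :: w) := by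
    intro w
    rw [splitSum_eq_sum, Finset.sum_eq_single w.length]
    · simp [oneSeries]
    · intro i hi hne
      simp only [Finset.mem_range] at hi
      have : w.drop i ≠ [] := by simp; omega
      simp [oneSeries, this]
    · simp
  rw [subst_cons, ← h1]
  exact splitSum_congr fun u v _ => by rw [← key v]; rfl

end LengthSeries

/-! ### Combinatorics of slopes -/

section Slopes

variable {X : Type*} [AddCommSemigroup X] {T T' : Type*} [LinearOrder T] [LinearOrder T']

/-- The seesaw property of a slope function. -/
def SeeSaw (t : X → T) : Prop := ∀ a b,
  (t a < t (a + b) ∧ t (a + b) < t b) ∨ (t a = t (a + b) ∧ t (a + b) = t b) ∨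
    (t a > t (a + b) ∧ t (a + b) > t b)

lemma SeeSaw.le_iff {t : X → T} (h : SeeSaw t) (a b : X) : t a ≤ t b ↔ t a ≤ t (a + b) := by
  rcases h a b with h | h | h <;> constructor <;> intro _ <;> order

lemma SeeSaw.lt_iff {t : X → T} (h : SeeSaw t) (a b : X) : t b < t a ↔ t (a + b) < t a := by
  simpa using (h.le_iff a b).not

lemma SeeSaw.add_eq {t : X → T} (h : SeeSaw t) {a b : X} {s : T} (ha : t a = s) (hb : t b = s) :
    t (a + b) = s := by
  rcases h a b with h | h | h
  · exact absurd (h.1.trans h.2) (by simp [ha, hb])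
  · exact h.1.symm.trans ha
  · exact absurd (h.2.trans h.1) (by simp [ha, hb])

lemma SeeSaw.tot_eq {t : X → T} (h : SeeSaw t) {a : X} {w : List X} {s : T} (ha : t a = s)
    (hw : ∀ b ∈ w, t b = s) : t (tot a w) = s := by
  induction w generalizing a with
  | nil => exact ha
  | cons b w ih =>
    rw [tot_cons]
    exact ih (h.add_eq ha (hw b (by simp))) fun c hc => hw c (by simp [hc])

open Classical in
/-- The truth value of a proposition as a rational number. -/
noncomputable def tv (p : Prop) : ℚ := if p then 1 else 0

lemma tv_true {p : Prop} (h : p) : tv p = 1 := if_pos h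
lemma tv_false {p : Prop} (h : ¬p) : tv p = 0 := if_neg h

lemma tv_and (p q : Prop) : tv (p ∧ q) = tv p * tv q := by
  by_cases hp : p <;> by_cases hq : q <;> simp [tv, hp, hq]

/-- The smallest slope of a sum `l + w₁ + ⋯ + wᵢ`. -/
def minSlope (t : X → T) : X → List X → T
  | l, [] => t l
  | l, y :: w => min (t l) (minSlope t (l + y) w)

/-- `(-1)^n` if the sums `l + w₁ + ⋯ + wᵢ` for `i < n` have slope `> N`, and `0` otherwise. -/
noncomputable def signProper (t : X → T) (N : T) : X → List X → ℚ
  | _, [] => 1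
  | l, y :: w => -tv (N < t l) * signProper t N (l + y) w

/-- `(-1)^n` if the sums `l + w₁ + ⋯ + wᵢ` for `0 < i ≤ n` satisfy `P`, and `0` otherwise. -/
noncomputable def signPre (P : X → Prop) : X → List X → ℚ
  | _, [] => 1
  | l, y :: w => -tv (P (l + y)) * signPre P (l + y) w

/-- By `hP`, the condition on all partial sums is a single condition on their smallest slope. -/
lemma signPre_eq (t : X → T) (P : T → Prop) (hP : ∀ a b, P (min a b) ↔ P a ∧ P b) (l : X)
    (w : List X) :
    tv (P (t l)) * signPre (fun x => P (t x)) l w = (-1) ^ w.length * tv (P (minSlope t l w)) := by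
  induction w generalizing l with
  | nil => simp [signPre, minSlope]
  | cons y w ih =>
    rw [signPre, minSlope, hP, tv_and, List.length_cons, pow_succ]
    linear_combination (-tv (P (t l))) * ih (l + y)

/-- A word of partial sums is cut at its first minimal slope. -/
lemma splitSum_firstMin (t : X → T) (φ : T → ℚ) (l : X) (w : List X) :
    splitSum (fun u v => signProper t (t (tot l u)) l u * φ (t (tot l u)) *
      signPre (fun x => t (tot l u) ≤ t x) (tot l u) v) w =
      (-1) ^ w.length * φ (minSlope t l w) := by
  induction w generalizing l φ with
  | nil => simp [splitSum, signProper, signPre, minSlope]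
  | cons y w ih =>
    -- A cut further to the right is admissible only if its slope is below that of the initial sum
    -- `l`. This condition is absorbed into the weight φ, which is why the induction runs over all
    -- weights.
    have h2 := ih (fun x => φ x * tv (x < t l)) (l + y)
    have h1 := signPre_eq t (fun x => t l ≤ x) (fun a b => le_min_iff) (l + y) w
    rw [splitSum_cons]
    have h3 : splitSum (fun u v => signProper t (t (tot l (y :: u))) l (y :: u) *
          φ (t (tot l (y :: u))) * signPre (fun x => t (tot l (y :: u)) ≤ t x) (tot l (y :: u)) v) w
        = -splitSum (fun u v => signProper t (t (tot (l + y) u)) (l + y) u *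
          (φ (t (tot (l + y) u)) * tv (t (tot (l + y) u) < t l)) *
            signPre (fun x => t (tot (l + y) u) ≤ t x) (tot (l + y) u) v) w := by
      rw [neg_eq_neg_one_mul, ← splitSum_mul_left]
      refine splitSum_congr fun u v _ => ?_
      rw [tot_cons, signProper]
      ring
    rw [h3, h2]
    simp only [tot_nil, signProper, signPre, one_mul, minSlope, List.length_cons, pow_succ]
    -- If `l` already has minimal slope, only the cut at the start survives; otherwise only cuts
    -- further right do.
    rcases le_or_gt (t l) (minSlope t (l + y) w) with h | h
    · rw [min_eq_left h]
      rw [tv_true h] at h1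
      rw [tv_false (not_lt.mpr h)]
      linear_combination (-φ (t l)) * h1
    · rw [min_eq_right h.le]
      rw [tv_false (not_le.mpr h)] at h1
      rw [tv_true h]
      linear_combination (-φ (t l)) * h1

/-- The indicator of words with slopes `s > t(α₁) > ⋯ > t(αₙ) > z`. -/
noncomputable def decBelow (t : X → T) (z : T) : T → List X → ℚ
  | _, [] => 1
  | s, a :: w => tv (z < t a ∧ t a < s) * decBelow t z (t a) w

/-- The indicator of words with slopes `t(α₁) > ⋯ > t(αₙ) > z`. -/
noncomputable def dec (t : X → T) (z : T) : List X → ℚ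
  | [] => 1
  | a :: w => tv (z < t a) * decBelow t z (t a) w

/-- `(-1)^(n-1)` if all proper non-empty prefixes have larger slope than the word. -/
noncomputable def signS (t : X → T) : List X → ℚ
  | [] => 1
  | a :: w => signProper t (t (tot a w)) a w

/-- `(-1)^n` if all non-empty prefixes satisfy `P`. -/
noncomputable def signSsd (P : X → Prop) : List X → ℚ
  | [] => 1
  | a :: w => -tv (P a) * signPre P a w

lemma signPre_translate {P Q : X → Prop} (b : X) (h : ∀ x, P x ↔ Q (b + x)) (l : X) (w : List X) :
    signPre P l w = signPre Q (b + l) w := by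
  induction w generalizing l with
  | nil => rfl
  | cons y w ih => rw [signPre, signPre, ih, h, add_assoc]

lemma signSsd_translate {P Q : X → Prop} (b : X) (h : ∀ x, P x ↔ Q (b + x)) (w : List X) :
    signSsd P w = signPre Q b w := by
  cases w with
  | nil => rfl
  | cons y w => rw [signSsd, signPre, signPre_translate b h, h]

lemma subst_conv_cons (f F G : List X → ℚ) (a : X) (w : List X) :
    conv (subst f F) G (a :: w) = F [] * G (a :: w) +
      splitSum (fun u v => f (a :: u) * conv (subst f (fun t => F (tot a u :: t))) G v) w := by
  rw [conv, splitSum_cons, subst_nil]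
  congr 1
  simp only [subst_cons, ← splitSum_mul_right, conv, ← splitSum_mul_left]
  rw [splitSum_assoc (fun u v x => f (a :: u) * subst f (fun t => F (tot a u :: t)) v * G x)]
  simp only [mul_assoc]

/-- Induction on the first block. What follows it is the same expression with `s` replaced by the
slope of the block. By the seesaw property, a bound by this slope on the sums after the block is the
same bound on the partial sums of the whole word. So the block has to end at the first minimum of
the slope, and `splitSum_firstMin` evaluates the sum. -/
lemma conv_subst_decBelow {t : X → T} (ht : SeeSaw t) (z s : T) (hs : z < s) (w : List X) :
    conv (subst (signS t) (decBelow t z s)) (signSsd (fun x => z < t x)) w =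
      signSsd (fun x => s ≤ t x) w := by
  induction w using suffix_induction generalizing s with
  | nil => simp [conv, splitSum, decBelow, signSsd]
  | cons a w ih =>
    have h1 := splitSum_firstMin t (fun x => tv (z < x ∧ x < s)) a w
    rw [subst_conv_cons]
    have h2 : splitSum (fun u v => signS t (a :: u) *
          conv (subst (signS t) (fun t_1 => decBelow t z s (tot a u :: t_1)))
            (signSsd fun x => z < t x) v) w =
        splitSum (fun u v => signProper t (t (tot a u)) a u * tv (z < t (tot a u) ∧ t (tot a u) < s)
          * signPre (fun x => t (tot a u) ≤ t x) (tot a u) v) w := by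
      refine splitSum_congr fun u v huv => ?_
      simp only [signS, decBelow]
      have h3 : conv (subst (signS t) fun v => tv (z < t (tot a u) ∧ t (tot a u) < s) *
            decBelow t z (t (tot a u)) v) (signSsd fun x => z < t x) v =
          tv (z < t (tot a u) ∧ t (tot a u) < s) *
            conv (subst (signS t) (decBelow t z (t (tot a u)))) (signSsd fun x => z < t x) v := by
        simp only [conv, ← splitSum_mul_left]
        exact splitSum_congr fun _ _ _ => by rw [subst_mul_left, mul_assoc]
      rw [h3]
      by_cases h4 : z < t (tot a u) ∧ t (tot a u) < s
      · rw [ih u v huv _ h4.1, signSsd_translate (Q := fun x => t (tot a u) ≤ t x) (tot a u)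
          (fun x => ht.le_iff (tot a u) x), mul_assoc]
      · simp [tv_false h4]
    rw [h2, h1, decBelow, signSsd, signSsd, one_mul, neg_mul, neg_mul,
      signPre_eq t (fun x => z < x) (fun a b => lt_min_iff),
      signPre_eq t (fun x => s ≤ x) (fun a b => le_min_iff)]
    -- The smallest slope of a partial sum lies in (z, s), is at least `s`, or is at most `z`. In
    -- the first case the term with no block cancels the others.
    rcases lt_or_ge z (minSlope t a w) with h | h
    · rcases lt_or_ge (minSlope t a w) s with h' | h'
      · rw [tv_true h, tv_true ⟨h, h'⟩, tv_false (not_le.mpr h')]; ring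
      · rw [tv_true h, tv_false (fun h'' => not_lt.mpr h' h''.2), tv_true h']; ring
    · rw [tv_false (not_lt.mpr h), tv_false (fun h'' => not_lt.mpr h h''.1),
        tv_false (not_le.mpr (h.trans_lt hs))]; ring

/-- Inversion of the recursion of Harder--Narasimhan type. -/
lemma conv_subst_dec {t : X → T} (ht : SeeSaw t) (z : T) :
    conv (subst (signS t) (dec t z)) (signSsd (fun x => z < t x)) = oneSeries := by
  funext w
  cases w with
  | nil => simp [conv, splitSum, dec, signSsd, oneSeries]
  | cons a w =>
    have h1 := splitSum_firstMin t (fun x => tv (z < x)) a w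
    rw [subst_conv_cons]
    have h2 : splitSum (fun u v => signS t (a :: u) *
          conv (subst (signS t) (fun t_1 => dec t z (tot a u :: t_1)))
            (signSsd fun x => z < t x) v) w =
        splitSum (fun u v => signProper t (t (tot a u)) a u * tv (z < t (tot a u))
          * signPre (fun x => t (tot a u) ≤ t x) (tot a u) v) w := by
      refine splitSum_congr fun u v huv => ?_
      simp only [signS, dec]
      have h3 : conv (subst (signS t) fun v => tv (z < t (tot a u)) *
            decBelow t z (t (tot a u)) v) (signSsd fun x => z < t x) v =
          tv (z < t (tot a u)) *
            conv (subst (signS t) (decBelow t z (t (tot a u)))) (signSsd fun x => z < t x) v := by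
        simp only [conv, ← splitSum_mul_left]
        exact splitSum_congr fun _ _ _ => by rw [subst_mul_left, mul_assoc]
      rw [h3]
      by_cases h4 : z < t (tot a u)
      · rw [conv_subst_decBelow ht _ _ h4, signSsd_translate (Q := fun x => t (tot a u) ≤ t x)
          (tot a u) (fun x => ht.le_iff (tot a u) x), mul_assoc]
      · simp [tv_false h4]
    -- With no upper bound on the first slope, the term with no block and the sum over first blocks
    -- are opposite: each is, up to sign, the indicator that all partial sums have slope above `z`.
    rw [h2, h1, dec, signSsd, one_mul, neg_mul,
      signPre_eq t (fun x => z < x) (fun a b => lt_min_iff)]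
    simp [oneSeries]

/-! ### The coefficients `S` and `S^sd` -/

/-- The indicator of strictly descending slopes of the word `x :: w`. -/
noncomputable def descAux (t : X → T) : X → List X → ℚ
  | _, [] => 1
  | x, y :: w => tv (t y < t x) * descAux t y w

/-- The indicator of words with strictly descending slopes. -/
noncomputable def desc (t : X → T) : List X → ℚ
  | [] => 1
  | a :: w => descAux t a w

/-- The product of the factors of `S` after the letter `x`, where `l` is the sum of the letters up
to `x` and `N` is the slope of the word. -/
noncomputable def gapS (t : X → T) (t' : X → T') (N : T') : X → X → List X → ℚ
  | _, _, [] => 1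
  | l, x, y :: w => (tv (t y < t x) - tv (N < t' l)) * gapS t t' N (l + y) y w

/-- The product of the factors of `S^sd` after the letter `x`, where `l` is the sum of the letters
up to `x`. -/
noncomputable def gapSsd (t : X → T) (z : T) (t' : X → T') (z' : T') : X → X → List X → ℚ
  | l, x, [] => tv (z < t x) - tv (z' < t' l)
  | l, x, y :: w => (tv (t y < t x) - tv (z' < t' l)) * gapSsd t z t' z' (l + y) y w

/-- The coefficients `S`. -/
noncomputable def wordS (t : X → T) (t' : X → T') : List X → ℚ
  | [] => 1
  | a :: w => gapS t t' (t' (tot a w)) a a w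

/-- The coefficients `S^sd`. -/
noncomputable def wordSsd (t : X → T) (z : T) (t' : X → T') (z' : T') : List X → ℚ
  | [] => 1
  | a :: w => gapSsd t z t' z' a a w

/-- Expand the product of differences. At each gap the first term continues a τ-descending block,
and the second term closes the block with the sign and τ'-condition of `signProper`. Here `u` is the
rest of the block of `x`. -/
lemma gapS_eq (t : X → T) (t' : X → T') (N : T') (l x : X) (w : List X) :
    gapS t t' N l x w =
      splitSum (fun u v => descAux t x u * subst (desc t) (signProper t' N (tot l u)) v) w := by
  induction w generalizing l x with
  | nil => simp [gapS, splitSum, descAux, signProper]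
  | cons y w ih =>
    rw [gapS, splitSum_cons, subst_cons, sub_mul, sub_eq_add_neg, add_comm, ih]
    congr 1
    · rw [neg_mul_eq_neg_mul, ← splitSum_mul_left, descAux, one_mul]
      refine splitSum_congr fun u v _ => ?_
      simp only [tot_nil, signProper, desc, subst_mul_left, tot_add]
      ring
    · rw [← splitSum_mul_left]
      refine splitSum_congr fun u v _ => ?_
      rw [descAux, tot_cons, mul_assoc]

/-- A series whose coefficients refer to the total of the block word may use the total of the
original word instead. -/
lemma subst_of_tot {f G : List X → ℚ} {H : X → List X → ℚ}
    (h : ∀ b s, G (b :: s) = H (tot b s) (b :: s)) (a : X) (w : List X) :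
    subst f G (a :: w) = subst f (H (tot a w)) (a :: w) := by
  rw [subst_cons, subst_cons]
  refine splitSum_congr fun u v huv => ?_
  simp only [h]
  rw [subst_tot f (fun x t => H x (tot a u :: t)), ← tot_append, huv]

lemma subst_congr_cons {f F G : List X → ℚ} (h : ∀ b s, F (b :: s) = G (b :: s)) (a : X)
    (w : List X) : subst f F (a :: w) = subst f G (a :: w) :=
  subst_of_tot (H := fun _ => G) h a w

lemma wordS_cons (t : X → T) (t' : X → T') (a : X) (w : List X) :
    wordS t t' (a :: w) = subst (desc t) (signS t') (a :: w) := by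
  rw [wordS, gapS_eq, subst_of_tot (H := fun x s => match s with
    | [] => 0
    | b :: s => signProper t' (t' x) b s) (fun b s => rfl), subst_cons]
  rfl

/-- The product of the signs of `S^sd` at the sums `l`, `l + w₁`, … -/
noncomputable def signEnd (t' : X → T') (z' : T') (l : X) (w : List X) : ℚ :=
  -tv (z' < t' l) * signPre (fun x => z' < t' x) l w

lemma signEnd_cons (t' : X → T') (z' : T') (l b : X) (s : List X) :
    signEnd t' z' l (b :: s) = -tv (z' < t' l) * signEnd t' z' (l + b) s := by
  rw [signEnd, signPre, signEnd]

lemma dec_cons_cons (t : X → T) (z : T) (a b : X) (w : List X) :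
    dec t z (a :: b :: w) = tv (t b < t a) * dec t z (b :: w) := by
  simp only [dec, decBelow, tv_and]
  by_cases h : t b < t a
  · by_cases h' : z < t b
    · rw [tv_true (h'.trans h)]; ring
    · rw [tv_false h']; ring
  · rw [tv_false h]; ring

/-- The same expansion as for `gapS`. The last factor compares with `z`, so the letters after the
last closed block descend down to `z` and give the factor `dec t z`. -/
lemma gapSsd_eq (t : X → T) (z : T) (t' : X → T') (z' : T') (l x : X) (w : List X) :
    gapSsd t z t' z' l x w = dec t z (x :: w) + splitSum (fun u v => descAux t x u *
      conv (subst (desc t) (signEnd t' z' (tot l u))) (dec t z) v) w := by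
  induction w generalizing l x with
  | nil =>
    simp only [gapSsd, dec, decBelow, splitSum_nil, descAux, conv, subst_nil, signEnd, signPre,
      tot_nil]
    ring
  | cons y w ih =>
    rw [gapSsd, splitSum_cons, subst_conv_cons, ih, dec_cons_cons]
    have h1 : splitSum (fun u v => desc t (y :: u) * conv (subst (desc t)
        (fun s => signEnd t' z' (tot l []) (tot y u :: s))) (dec t z) v) w =
        -tv (z' < t' l) * splitSum (fun u v => descAux t y u *
          conv (subst (desc t) (signEnd t' z' (tot (l + y) u))) (dec t z) v) w := by
      rw [← splitSum_mul_left]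
      refine splitSum_congr fun u v _ => ?_
      simp only [signEnd_cons, tot_nil, desc]
      rw [show (subst (desc t) fun s => -tv (z' < t' l) * signEnd t' z' (l + tot y u) s) =
        fun s => -tv (z' < t' l) * subst (desc t) (signEnd t' z' (l + tot y u)) s from
        funext fun s => subst_mul_left _ _ _ _, conv_mul_left, tot_add]
      ring
    have h2 : splitSum (fun u v => descAux t x (y :: u) *
        conv (subst (desc t) (signEnd t' z' (tot l (y :: u)))) (dec t z) v) w =
        tv (t y < t x) * splitSum (fun u v => descAux t y u *
          conv (subst (desc t) (signEnd t' z' (tot (l + y) u))) (dec t z) v) w := by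
      rw [← splitSum_mul_left]
      refine splitSum_congr fun u v _ => ?_
      rw [descAux, tot_cons, mul_assoc]
    rw [h1, h2, signEnd, signPre, descAux, tot_nil]
    ring

lemma wordSsd_eq (t : X → T) (z : T) (t' : X → T') (z' : T') :
    wordSsd t z t' z' =
      conv (subst (desc t) (signSsd fun x => z' < t' x)) (dec t z) := by
  funext w
  cases w with
  | nil => simp [wordSsd, conv, splitSum, signSsd, dec]
  | cons a w =>
    rw [wordSsd, gapSsd_eq, subst_conv_cons, signSsd, one_mul]
    rfl

/-- The change of the slope function in sums over words with descending slopes. -/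
lemma conv_subst_wordS (t : X → T) (z : T) {t' : X → T'} (z' : T') (ht' : SeeSaw t') :
    conv (subst (wordS t t') (dec t' z')) (wordSsd t z t' z') = dec t z := by
  -- Both coefficients substitute `desc t` into series that depend on t' alone. By multiplicativity
  -- `desc t` is substituted into the product in `conv_subst_dec`, which is 1, and only `dec t z` is
  -- left.
  rw [subst_congr_left (wordS_cons t t'), ← subst_subst, wordSsd_eq, ← conv_assoc, ← subst_conv,
    conv_subst_dec ht', subst_oneSeries, one_conv]

/-! ### The coefficients `U` and `U^sd` -/

/-- The part of a series with total slope `s`. -/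
noncomputable def restrict (t : X → T) (s : T) (f : List X → ℚ) : List X → ℚ
  | [] => 0
  | a :: w => tv (t (tot a w) = s) * f (a :: w)

/-- `1/n!` on words whose letters have the slope of their sum. -/
noncomputable def sameSlope (t : X → T) : List X → ℚ
  | [] => 1
  | a :: w => tv (∀ b ∈ a :: w, t b = t (tot a w)) * expCoeff 1 (w.length + 1)

/-- `1/(2ⁿ n!)` on words with letters of slope `z`. -/
noncomputable def zeroSlope (t : X → T) (z : T) (w : List X) : ℚ :=
  tv (∀ b ∈ w, t b = z) * expCoeff (1 / 2) w.length

/-- The coefficients of `U` after summation over equal slopes. -/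
noncomputable def wordV (t : X → T) (t' : X → T') : List X → ℚ
  | [] => 0
  | a :: w => subst (restrict t' (t' (tot a w)) (wordS t t')) (lenSeries X logCoeff) (a :: w)

/-- The coefficients `U`. -/
noncomputable def wordU (t : X → T) (t' : X → T') : List X → ℚ :=
  subst (sameSlope t) (wordV t t')

/-- The coefficients `U^sd`. -/
noncomputable def wordUsd (t : X → T) (z : T) (t' : X → T') (z' : T') : List X → ℚ :=
  conv (subst (sameSlope t) (conv (subst (restrict t' z' (wordS t t'))
    (lenSeries X (genBinom (-1 / 2)))) (wordSsd t z t' z'))) (zeroSlope t z)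

/-- The coefficients of the sum over descending slopes in terms of the `ε`. -/
noncomputable def ksCoeff (t : X → T) (z : T) : List X → ℚ :=
  conv (subst (sameSlope t) (dec t z)) (zeroSlope t z)

lemma subst_forall_slope (t : X → T) (s : T) (f h : List X → ℚ) (w : List X) :
    subst f (fun v => tv (∀ b ∈ v, t b = s) * h v) w = subst (restrict t s f) h w := by
  induction w using suffix_induction generalizing h with
  | nil => simp [tv]
  | cons a w ih =>
    rw [subst_cons, subst_cons]
    refine splitSum_congr fun u v huv => ?_
    simp only [List.forall_mem_cons, tv_and, mul_assoc, subst_mul_left]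
    rw [ih u v huv (fun v => h (tot a u :: v)), restrict]
    ring

/-- In `wordV` the blocks must have the slope of the whole word, which varies with the word. On
total slope `s` it can be fixed to `s`. Conversely, blocks that all have slope `s` force total slope
`s` by the seesaw property, so no restriction on the total remains. -/
lemma restrict_wordU (t : X → T) {t' : X → T'} (ht' : SeeSaw t') (s : T') (a : X) (w : List X) :
    restrict t' s (wordU t t') (a :: w) =
      subst (sameSlope t) (subst (restrict t' s (wordS t t')) (lenSeries X logCoeff)) (a :: w) := by
  have h1 : ∀ s', subst (restrict t' s' (wordS t t')) (lenSeries X logCoeff) =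
      subst (wordS t t') (fun v => tv (∀ b ∈ v, t' b = s') * lenSeries X logCoeff v) :=
    fun s' => funext fun v => (subst_forall_slope _ _ _ _ _).symm
  rw [restrict, wordU]
  by_cases h : t' (tot a w) = s
  · rw [tv_true h, one_mul, subst_of_tot (H := fun x => subst (restrict t' (t' x) (wordS t t'))
      (lenSeries X logCoeff)) (fun b v => rfl), h]
  · rw [tv_false h, zero_mul, h1, subst_subst,
      subst_of_tot (H := fun x v => tv (t' x = s) *
        (tv (∀ b ∈ v, t' b = s) * lenSeries X logCoeff v)), tv_false h]
    · simp [subst_zero]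
    · intro b v
      by_cases hb : ∀ c ∈ b :: v, t' c = s
      · rw [tv_true (ht'.tot_eq (hb b (by simp)) fun c hc => hb c (by simp [hc])), one_mul]
      · rw [tv_false hb, zero_mul, mul_zero]

/-- At a fixed new slope this is exp(log(1+x)) = 1+x. It expresses δ(τ') through δ(τ) with
coefficients S. -/
lemma subst_wordU_sameSlope (t : X → T) {t' : X → T'} (ht' : SeeSaw t') (a : X) (w : List X) :
    subst (wordU t t') (sameSlope t') (a :: w) = subst (sameSlope t) (wordS t t') (a :: w) := by
  set s := t' (tot a w) with hs
  have h1 : subst (wordU t t') (sameSlope t') (a :: w) = subst (sameSlope t)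
      (subst (restrict t' s (wordS t t')) (lenSeries X (genBinom 1))) (a :: w) := by
    rw [subst_of_tot (H := fun x v => tv (∀ b ∈ v, t' b = t' x) * lenSeries X (expCoeff 1) v)
      (fun b v => rfl), ← hs, subst_forall_slope, subst_congr_left (restrict_wordU t ht' s),
      ← subst_subst, ← subst_subst, subst_log_exp]
  rw [h1, subst_congr_cons (G := restrict t' s (wordS t t')) (fun b v => subst_genBinom_one _ _ _),
    subst_of_tot (H := fun x v => tv (t' x = s) * wordS t t' v) (fun b v => rfl), subst_mul_left,
    tv_true hs.symm, one_mul]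

/-- At new slope zero, exp(½ log(1+x)) = (1+x)^{1/2}. -/
lemma subst_wordU_zeroSlope (t : X → T) {t' : X → T'} (z' : T') (ht' : SeeSaw t') :
    subst (wordU t t') (zeroSlope t' z') = subst (sameSlope t)
      (subst (restrict t' z' (wordS t t')) (lenSeries X (genBinom (1 / 2)))) := by
  funext w
  change subst (wordU t t')
    (fun v => tv (∀ b ∈ v, t' b = z') * lenSeries X (expCoeff (1 / 2)) v) w = _
  rw [subst_forall_slope, subst_congr_left (restrict_wordU t ht' z'), ← subst_subst, ← subst_subst,
    subst_log_exp]

/-- The identity of coefficients behind the wall-crossing theorem. -/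
theorem conv_subst_wordU (t : X → T) (z : T) {t' : X → T'} (z' : T') (ht' : SeeSaw t') :
    conv (subst (wordU t t') (ksCoeff t' z')) (wordUsd t z t' z') = ksCoeff t z := by
  have h1 : subst (wordU t t') (subst (sameSlope t') (dec t' z')) =
      subst (sameSlope t) (subst (wordS t t') (dec t' z')) := by
    rw [subst_subst, subst_congr_left (subst_wordU_sameSlope t ht'), ← subst_subst]
  -- The square root from δ^sd(τ') meets the factor with coefficients binom(-1/2, l) in U^sd and
  -- cancels. This expresses δ^sd(τ') through δ(τ) and δ^sd(τ) with coefficients S^sd.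
  have h2 : conv (subst (wordU t t') (zeroSlope t' z')) (wordUsd t z t' z') =
      conv (subst (sameSlope t) (wordSsd t z t' z')) (zeroSlope t z) := by
    rw [subst_wordU_zeroSlope t z' ht', wordUsd, ← conv_assoc, ← subst_conv, ← conv_assoc,
      ← subst_conv, neg_div, conv_genBinom_neg, subst_oneSeries, one_conv]
  rw [ksCoeff, subst_conv, conv_assoc, h2, h1, ← conv_assoc, ← subst_conv,
    conv_subst_wordS t z z' ht', ksCoeff]

end Slopes

/-! ### A Poincaré–Birkhoff–Witt theorem for twisted modules

A linear form on words in a homogeneous basis is constructed by straightening. -/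

section Straightening

open Module

variable {ι : Type*} [LinearOrder ι]

/-- The number of inversions of a word. -/
def inversions : List ι → ℕ
  | [] => 0
  | a :: w => w.countP (· < a) + inversions w

lemma inversions_swap (u v : List ι) {x y : ι} (h : y < x) :
    inversions (u ++ y :: x :: v) < inversions (u ++ x :: y :: v) := by
  induction u with
  | nil =>
    simp only [List.nil_append, inversions, List.countP_cons]
    simp [h, not_lt.mpr h.le]
    omega
  | cons a u ih =>
    simp only [List.cons_append, inversions]
    have : (u ++ y :: x :: v).countP (· < a) = (u ++ x :: y :: v).countP (· < a) :=
      List.Perm.countP_eq _ (List.Perm.append_left u (List.Perm.swap _ _ _))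
    omega

/-- The order on words by length and number of inversions. -/
def WordLT (w w' : List ι) : Prop :=
  w.length < w'.length ∨ (w.length = w'.length ∧ inversions w < inversions w')

lemma wordLT_wf : WellFounded (WordLT (ι := ι)) := by
  have h := InvImage.wf (fun w : List ι => (w.length, inversions w))
    (WellFounded.prod_lex (wellFounded_lt (α := ℕ)) (wellFounded_lt (α := ℕ)))
  refine Subrelation.wf ?_ h
  intro w w' hw
  rw [InvImage, Prod.lex_def]
  exact hw

lemma wordLT_induction {P : List ι → Prop} (w : List ι)
    (step : ∀ w, (∀ w', WordLT w' w → P w') → P w) : P w :=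
  wordLT_wf.induction w step

lemma WordLT.trans {w w' w'' : List ι} (h : WordLT w w') (h' : WordLT w' w'') : WordLT w w'' := by
  unfold WordLT at *; omega

lemma wordLT_swap (u v : List ι) {x y : ι} (h : y < x) :
    WordLT (u ++ y :: x :: v) (u ++ x :: y :: v) :=
  Or.inr ⟨by simp, inversions_swap u v h⟩

variable {L M : Type*} [AddCommGroup L] [Module ℚ L] [AddCommGroup M] [Module ℚ M]

/-- A graded Lie algebra with a homogeneous basis consisting of vectors with `x^∨ = ± x`, and its
action on a twisted module. Here `sgn` is the sign of interchanging basis vectors, and `neg` singles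
out the basis vectors with `x^∨ = -x`. -/
structure StraighteningData (ι : Type*) [LinearOrder ι] (L M : Type*) [AddCommGroup L] [Module ℚ L]
    [AddCommGroup M] [Module ℚ M] where
  b : Basis ι ℚ L
  br : L →ₗ[ℚ] L →ₗ[ℚ] L
  act : L →ₗ[ℚ] M →ₗ[ℚ] M
  sgn : ι → ι → ℚ
  neg : ι → Prop
  sgn_mul_self : ∀ i j, sgn i j * sgn i j = 1
  sgn_symm : ∀ i j, sgn i j = sgn j i
  anti : ∀ i j, br (b i) (b j) = -sgn i j • br (b j) (b i)
  jacobi : ∀ i j k, br (b i) (br (b j) (b k)) - sgn i j • br (b j) (br (b i) (b k)) =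
    br (br (b i) (b j)) (b k)
  sgn_br : ∀ i j k l, b.repr (br (b i) (b j)) k ≠ 0 → sgn k l = sgn i l * sgn j l
  neg_of_le : ∀ i j, neg i → i ≤ j → neg j
  neg_br : ∀ i j k, neg i → neg j → b.repr (br (b i) (b j)) k ≠ 0 → neg k
  act_jacobi : ∀ i j m, neg i → neg j →
    act (b i) (act (b j) m) - sgn i j • act (b j) (act (b i) m) = (2 : ℚ) • act (br (b i) (b j)) m

namespace StraighteningData

variable (D : StraighteningData ι L M) (F : List ι → M →ₗ[ℚ] ℚ)

lemma constr_congr {V : Type*} [AddCommGroup V] [Module ℚ V] {G G' : ι → V} {z : L}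
    (h : ∀ k, D.b.repr z k ≠ 0 → G k = G' k) : D.b.constr ℚ G z = D.b.constr ℚ G' z := by
  simp only [Basis.constr_apply]
  exact Finsupp.sum_congr fun k hk => by rw [h k (Finsupp.mem_support_iff.mp hk)]

lemma constr_comm {V : Type*} [AddCommGroup V] [Module ℚ V] (G : ι → ι → V) (z z' : L) :
    D.b.constr ℚ (fun k => D.b.constr ℚ (fun l => G k l) z') z =
      D.b.constr ℚ (fun l => D.b.constr ℚ (fun k => G k l) z) z' := by
  simp only [Basis.constr_apply, Finsupp.sum, Finset.smul_sum]
  rw [Finset.sum_comm]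
  exact Finset.sum_congr rfl fun _ _ => Finset.sum_congr rfl fun _ _ => smul_comm _ _ _

lemma eq_constr {V : Type*} [AddCommGroup V] [Module ℚ V] (f : L →ₗ[ℚ] V) (z : L) :
    f z = D.b.constr ℚ (fun k => f (D.b k)) z := by
  rw [← D.b.constr_self ℚ f]
  simp

/-- The linear extension of `F` in one letter. -/
noncomputable def lin (u v : List ι) : L →ₗ[ℚ] M →ₗ[ℚ] ℚ :=
  D.b.constr ℚ fun k => F (u ++ k :: v)

@[simp] lemma lin_basis (u v : List ι) (k : ι) : D.lin F u v (D.b k) = F (u ++ k :: v) := by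
  simp [lin]

/-- The defect of `F` in the commutation relations. -/
noncomputable def res (u : List ι) (i j : ι) (v : List ι) (m : M) : ℚ :=
  F (u ++ i :: j :: v) m - D.sgn i j * F (u ++ j :: i :: v) m -
    D.lin F u v (D.br (D.b i) (D.b j)) m

/-- The defect of `F` in the relations `x ⊗ m = ½ ⊗ (x ♥ m)` for `x^∨ = -x`. -/
noncomputable def resEnd (u : List ι) (i : ι) (m : M) : ℚ :=
  F (u ++ [i]) m - 1 / 2 * F u (D.act (D.b i) m)

lemma res_symm (u : List ι) (i j : ι) (v : List ι) (m : M) :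
    D.res F u j i v m = -D.sgn i j * D.res F u i j v m := by
  have h := D.sgn_mul_self i j
  rw [res, res, D.anti j i, ← D.sgn_symm i j]
  simp only [map_smul, LinearMap.smul_apply, smul_eq_mul]
  linear_combination (-F (u ++ j :: i :: v) m) * h

lemma sgn_cases (i j : ι) : D.sgn i j = 1 ∨ D.sgn i j = -1 := mul_self_eq_one_iff.mp (D.sgn_mul_self i j)

/-- An even letter commutes with itself: by antisymmetry the defect is its own negative. -/
lemma res_self {i : ι} (h : D.sgn i i = 1) (u v : List ι) (m : M) : D.res F u i i v m = 0 := by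
  have := D.res_symm F u i i v m
  rw [h] at this
  linarith

/-- All relations between words of length less than `n` hold. -/
def RelBelow (n : ℕ) : Prop :=
  (∀ u i j v m, u.length + v.length + 2 < n → D.res F u i j v m = 0) ∧
    ∀ u i m, D.neg i → u.length + 1 < n → D.resEnd F u i m = 0

variable {D F} {n : ℕ}

/-- The commutation relation extends linearly to a vector all of whose basis components have the
same sign against `j`. It is applied to brackets of basis vectors. -/
lemma RelBelow.lin_swap (H : D.RelBelow F n) {u v : List ι} {z : L} {j : ι} {σ : ℚ}
    (hn : u.length + v.length + 2 < n) (hz : ∀ k, D.b.repr z k ≠ 0 → D.sgn k j = σ) (m : M) :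
    D.lin F u (j :: v) z m = σ * D.lin F (u ++ [j]) v z m + D.lin F u v (D.br z (D.b j)) m := by
  have h : D.lin F u (j :: v) z =
      (σ • D.lin F (u ++ [j]) v + D.lin F u v ∘ₗ D.br.flip (D.b j)) z := by
    rw [lin, eq_constr D (σ • D.lin F (u ++ [j]) v + D.lin F u v ∘ₗ D.br.flip (D.b j))]
    refine constr_congr D fun k hk => ?_
    ext m
    have h1 := H.1 u k j v m hn
    rw [res, hz k hk] at h1
    simp
    linarith
  rw [h]
  simp

lemma RelBelow.lin_end (H : D.RelBelow F n) {u : List ι} {z : L}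
    (hn : u.length + 1 < n) (hz : ∀ k, D.b.repr z k ≠ 0 → D.neg k) (m : M) :
    D.lin F u [] z m = 1 / 2 * F u (D.act z m) := by
  have h : D.lin F u [] z =
      ((1 / 2 : ℚ) • (LinearMap.compRight ℚ (F u) ∘ₗ D.act)) z := by
    rw [lin, eq_constr D ((1 / 2 : ℚ) • (LinearMap.compRight ℚ (F u) ∘ₗ D.act))]
    refine constr_congr D fun k hk => ?_
    ext m
    have h1 := H.2 u k m (hz k hk) hn
    rw [resEnd] at h1
    simp
    linarith
  rw [h]
  simp

lemma RelBelow.lin_end_right (H : D.RelBelow F n) {u v : List ι} {i : ι}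
    (hn : u.length + v.length + 2 < n) (hi : D.neg i) (z : L) (m : M) :
    D.lin F u (v ++ [i]) z m = 1 / 2 * D.lin F u v z (D.act (D.b i) m) := by
  have h : D.lin F u (v ++ [i]) z =
      ((1 / 2 : ℚ) • (LinearMap.lcomp ℚ ℚ (D.act (D.b i)) ∘ₗ D.lin F u v)) z := by
    rw [lin, eq_constr D ((1 / 2 : ℚ) • (LinearMap.lcomp ℚ ℚ (D.act (D.b i)) ∘ₗ D.lin F u v))]
    refine constr_congr D fun k _ => ?_
    ext m
    have h1 := H.2 (u ++ k :: v) i m hi (by simp; omega)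
    rw [resEnd] at h1
    simp at h1 ⊢
    linarith
  rw [h]
  simp

/-- The two sides are the two ways around the hexagon of orderings from xyz to zyx. The values of
`F` on the orderings themselves cancel. The terms with one bracket are commuted by the relations for
shorter words, and the remaining double brackets cancel by the Jacobi identity. -/
lemma RelBelow.hexagon {u v : List ι} (H : D.RelBelow F (u.length + v.length + 3)) (x y z : ι)
    (m : M) :
    D.res F u x y (z :: v) m + D.sgn x y * D.res F (u ++ [y]) x z v m +
        D.sgn x y * D.sgn x z * D.res F u y z (x :: v) m =
      D.res F (u ++ [x]) y z v m + D.sgn y z * D.res F u x z (y :: v) m +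
        D.sgn y z * D.sgn x z * D.res F (u ++ [z]) x y v m := by
  have hn : u.length + v.length + 2 < u.length + v.length + 3 := by omega
  have h1 := H.lin_swap hn (D.sgn_br x y · z) m
  have h2 := H.lin_swap hn (D.sgn_br x z · y) m
  have h3 := H.lin_swap hn (D.sgn_br y z · x) m
  have h4 := congrArg (fun a => D.lin F u v a m) (D.jacobi x y z)
  have e1 : D.br (D.br (D.b x) (D.b z)) (D.b y) =
      -(D.sgn x y * D.sgn z y) • D.br (D.b y) (D.br (D.b x) (D.b z)) := by
    have : D.br.flip (D.b y) (D.br (D.b x) (D.b z)) =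
        (-(D.sgn x y * D.sgn z y) • D.br (D.b y)) (D.br (D.b x) (D.b z)) := by
      rw [eq_constr D (D.br.flip (D.b y)), eq_constr D (-(D.sgn x y * D.sgn z y) • D.br (D.b y))]
      refine constr_congr D fun k hk => ?_
      rw [LinearMap.flip_apply, D.anti k y, D.sgn_br x z k y hk, LinearMap.smul_apply]
    exact this
  have e2 : D.br (D.br (D.b y) (D.b z)) (D.b x) =
      -(D.sgn y x * D.sgn z x) • D.br (D.b x) (D.br (D.b y) (D.b z)) := by
    have : D.br.flip (D.b x) (D.br (D.b y) (D.b z)) =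
        (-(D.sgn y x * D.sgn z x) • D.br (D.b x)) (D.br (D.b y) (D.b z)) := by
      rw [eq_constr D (D.br.flip (D.b x)), eq_constr D (-(D.sgn y x * D.sgn z x) • D.br (D.b x))]
      refine constr_congr D fun k hk => ?_
      rw [LinearMap.flip_apply, D.anti k x, D.sgn_br y z k x hk, LinearMap.smul_apply]
    exact this
  rw [e1] at h2
  rw [e2] at h3
  simp only [map_smul, map_sub, LinearMap.smul_apply, LinearMap.sub_apply, smul_eq_mul] at h2 h3 h4
  simp only [res, List.append_assoc, List.cons_append, List.nil_append]
  have s1 := D.sgn_mul_self x y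
  have s2 := D.sgn_mul_self x z
  have s3 := D.sgn_mul_self y z
  rw [D.sgn_symm z y] at h2
  rw [D.sgn_symm y x, D.sgn_symm z x] at h3
  set A := D.sgn x y
  set B := D.sgn x z
  set C := D.sgn y z
  rw [h1, h2, h3]
  generalize D.lin F u v (D.br (D.b y) (D.br (D.b x) (D.b z))) m = q1 at *
  generalize D.lin F u v (D.br (D.b x) (D.br (D.b y) (D.b z))) m = q2 at *
  generalize D.lin F u v (D.br (D.br (D.b x) (D.b y)) (D.b z)) m = q3 at *
  generalize D.lin F (u ++ [x]) v (D.br (D.b y) (D.b z)) m = r1 at *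
  generalize D.lin F (u ++ [y]) v (D.br (D.b x) (D.b z)) m = r2 at *
  generalize D.lin F (u ++ [z]) v (D.br (D.b x) (D.b y)) m = r3 at *
  linear_combination (-q1 * A + 0 * r1) * s3 + h4 + (q2 * B * B - r1 * B * B) * s1 + (q2 - r1) * s2
    + r2 * A * s3

/-- The two pairs do not interact, so both orders of treatment lead to the same expression with both
pairs replaced by their brackets. -/
lemma RelBelow.square {u w v : List ι} (H : D.RelBelow F (u.length + w.length + v.length + 4))
    (x y z t : ι) (m : M) :
    D.res F u x y (w ++ z :: t :: v) m - D.sgn z t * D.res F u x y (w ++ t :: z :: v) m =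
      D.res F (u ++ x :: y :: w) z t v m - D.sgn x y * D.res F (u ++ y :: x :: w) z t v m := by
  have h1 : D.lin F u (w ++ z :: t :: v) (D.br (D.b x) (D.b y)) -
      D.sgn z t • D.lin F u (w ++ t :: z :: v) (D.br (D.b x) (D.b y)) =
      D.b.constr ℚ (fun k => D.lin F (u ++ k :: w) v (D.br (D.b z) (D.b t)))
        (D.br (D.b x) (D.b y)) := by
    rw [← LinearMap.smul_apply, ← LinearMap.sub_apply, eq_constr D (_ - _)]
    refine constr_congr D fun k _ => ?_
    ext m
    have := H.1 (u ++ k :: w) z t v m (by simp; omega)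
    rw [res] at this
    simp at this ⊢
    linarith
  have h2 : D.lin F (u ++ x :: y :: w) v (D.br (D.b z) (D.b t)) -
      D.sgn x y • D.lin F (u ++ y :: x :: w) v (D.br (D.b z) (D.b t)) =
      D.b.constr ℚ (fun l => D.lin F u (w ++ l :: v) (D.br (D.b x) (D.b y)))
        (D.br (D.b z) (D.b t)) := by
    rw [← LinearMap.smul_apply, ← LinearMap.sub_apply, eq_constr D (_ - _)]
    refine constr_congr D fun k _ => ?_
    ext m
    have := H.1 u x y (w ++ k :: v) m (by simp; omega)
    rw [res] at this
    simp at this ⊢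
    linarith
  have h3 : D.b.constr ℚ (fun k => D.lin F (u ++ k :: w) v (D.br (D.b z) (D.b t)))
        (D.br (D.b x) (D.b y)) = D.b.constr ℚ (fun l => D.lin F u (w ++ l :: v)
          (D.br (D.b x) (D.b y))) (D.br (D.b z) (D.b t)) := by
    simp only [lin, List.append_assoc, List.cons_append]
    exact constr_comm D (fun k l => F (u ++ k :: (w ++ l :: v))) _ _
  have h4 := LinearMap.congr_fun (h1.trans (h3.trans h2.symm)) m
  simp only [LinearMap.sub_apply, LinearMap.smul_apply, smul_eq_mul] at h4
  simp only [res, List.append_assoc, List.cons_append]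
  linear_combination -h4

/-- Absorbing both letters into `M` produces ¼ of the graded commutator of their ♥-actions. By the
twisted Jacobi identity this is ½ of the action of [x, y], which is also what absorbing the bracket
gives. -/
lemma RelBelow.end_overlap {u : List ι} (H : D.RelBelow F (u.length + 2)) {x y : ι}
    (hx : D.neg x) (hy : D.neg y) (m : M) :
    D.resEnd F (u ++ [x]) y m - D.sgn x y * D.resEnd F (u ++ [y]) x m = D.res F u x y [] m := by
  have h1 := H.2 u x (D.act (D.b y) m) hx (by omega)
  have h2 := H.2 u y (D.act (D.b x) m) hy (by omega)
  have h3 := H.lin_end (u := u) (by omega) (fun k hk => D.neg_br x y k hx hy hk) m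
  have h4 := congrArg (F u) (D.act_jacobi x y m hx hy)
  simp only [map_sub, map_smul, smul_eq_mul] at h4
  simp only [res, resEnd, List.append_assoc, List.cons_append, List.nil_append] at *
  linear_combination h3 - h1 / 2 + D.sgn x y * h2 / 2 - h4 / 4

lemma RelBelow.end_square {u v : List ι} (H : D.RelBelow F (u.length + v.length + 3)) (x y : ι)
    {z : ι} (hz : D.neg z) (m : M) :
    D.resEnd F (u ++ x :: y :: v) z m - D.sgn x y * D.resEnd F (u ++ y :: x :: v) z m =
      D.res F u x y (v ++ [z]) m := by
  have h1 := H.1 u x y v (D.act (D.b z) m) (by omega)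
  have h2 := H.lin_end_right (u := u) (v := v) (by omega) hz (D.br (D.b x) (D.b y)) m
  simp only [res, resEnd, List.append_assoc, List.cons_append] at *
  linear_combination h2 - h1 / 2

variable (D F)

/-- The relations for words that can be straightened in more than one way are compatible. -/
structure Resolved (w : List ι) : Prop where
  swap : ∀ u x y v m, w = u ++ x :: y :: v → y ≤ x → D.res F u x y v m = 0
  last : ∀ u i m, w = u ++ [i] → D.neg i → D.resEnd F u i m = 0

/-- A pair of letters that can be straightened. -/
def Descent (x y : ι) : Prop := y < x ∨ (x = y ∧ D.sgn x y = -1)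

variable {D F} {w : List ι}

lemma Resolved.relBelow (h : ∀ w', WordLT w' w → D.Resolved F w') : D.RelBelow F w.length := by
  refine ⟨fun u i j v m hn => ?_, fun u i m hi hn => ?_⟩
  · rcases le_total j i with hij | hij
    · exact (h _ (Or.inl (by simp; omega))).swap u i j v m rfl hij
    · rw [res_symm, (h _ (Or.inl (by simp; omega))).swap u j i v m rfl hij, mul_zero]
  · exact (h _ (Or.inl (by simp; omega))).last u i m rfl hi

/-- The other defects in the hexagon belong to smaller words and vanish by hypothesis. If
neighbouring letters coincide, they are odd and some terms of the hexagon merge, but the two defects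
in question keep non-zero coefficients. -/
lemma overlap_iff {u v : List ι} {x y z : ι}
    (h : ∀ w', WordLT w' (u ++ x :: y :: z :: v) → D.Resolved F w') (hxy : D.Descent x y)
    (hyz : D.Descent y z) (m : M) :
    D.res F u x y (z :: v) m = 0 ↔ D.res F (u ++ [x]) y z v m = 0 := by
  have H := Resolved.relBelow h
  rw [show (u ++ x :: y :: z :: v).length = u.length + v.length + 3 by simp; omega] at H
  have hex := H.hexagon x y z m
  rcases hxy with hxy | ⟨rfl, hs⟩ <;> rcases hyz with hyz | ⟨rfl, hs'⟩
  · have l1 : WordLT (u ++ y :: x :: z :: v) (u ++ x :: y :: z :: v) := wordLT_swap u _ hxy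
    have l2 : WordLT (u ++ y :: z :: x :: v) (u ++ y :: x :: z :: v) := by
      simpa using wordLT_swap (u ++ [y]) v (hyz.trans hxy)
    have l3 : WordLT (u ++ x :: z :: y :: v) (u ++ x :: y :: z :: v) := by
      simpa using wordLT_swap (u ++ [x]) v hyz
    have l4 : WordLT (u ++ z :: x :: y :: v) (u ++ x :: z :: y :: v) :=
      wordLT_swap u _ (hyz.trans hxy)
    rw [(h _ l1).swap (u ++ [y]) x z v m (by simp) (hyz.trans hxy).le,
      (h _ (l2.trans l1)).swap u y z (x :: v) m rfl hyz.le,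
      (h _ l3).swap u x z (y :: v) m rfl (hyz.trans hxy).le,
      (h _ (l4.trans l3)).swap (u ++ [z]) x y v m (by simp) hxy.le] at hex
    constructor <;> intro h <;> linarith
  · have l1 : WordLT (u ++ y :: x :: y :: v) (u ++ x :: y :: y :: v) := wordLT_swap u _ hxy
    have l2 : WordLT (u ++ y :: y :: x :: v) (u ++ y :: x :: y :: v) := by
      simpa using wordLT_swap (u ++ [y]) v hxy
    rw [(h _ l1).swap (u ++ [y]) x y v m (by simp) hxy.le,
      (h _ (l2.trans l1)).swap u y y (x :: v) m rfl le_rfl, hs'] at hex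
    constructor <;> intro h <;> linarith
  · have l3 : WordLT (u ++ x :: z :: x :: v) (u ++ x :: x :: z :: v) := by
      simpa using wordLT_swap (u ++ [x]) v hyz
    have l4 : WordLT (u ++ z :: x :: x :: v) (u ++ x :: z :: x :: v) := wordLT_swap u _ hyz
    rw [(h _ l3).swap u x z (x :: v) m rfl hyz.le,
      (h _ (l4.trans l3)).swap (u ++ [z]) x x v m (by simp) le_rfl, hs] at hex
    constructor <;> intro h <;> linarith
  · rw [hs] at hex
    constructor <;> intro h <;> linarith

lemma disjoint_iff {u s v : List ι} {x y z t : ι}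
    (h : ∀ w', WordLT w' (u ++ x :: y :: (s ++ z :: t :: v)) → D.Resolved F w')
    (hxy : D.Descent x y) (hzt : D.Descent z t) (m : M) :
    D.res F u x y (s ++ z :: t :: v) m = 0 ↔ D.res F (u ++ x :: y :: s) z t v m = 0 := by
  have H := Resolved.relBelow h
  rw [show (u ++ x :: y :: (s ++ z :: t :: v)).length = u.length + s.length + v.length + 4 by
    simp; omega] at H
  have sq := H.square x y z t m
  have h1 : D.res F u x y (s ++ z :: t :: v) m - D.sgn z t * D.res F u x y (s ++ t :: z :: v) m = 0
      ↔ D.res F u x y (s ++ z :: t :: v) m = 0 := by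
    rcases hzt with hzt | ⟨rfl, hs⟩
    · have hle : y ≤ x := by
        rcases hxy with hxy | ⟨rfl, -⟩
        exacts [hxy.le, le_rfl]
      have l1 : WordLT (u ++ x :: y :: (s ++ t :: z :: v)) (u ++ x :: y :: (s ++ z :: t :: v)) := by
        simpa using wordLT_swap (u ++ x :: y :: s) v hzt
      rw [(h _ l1).swap u x y _ m rfl hle]
      simp
    · rw [hs]
      constructor <;> intro h <;> linarith
  have h2 : D.res F (u ++ x :: y :: s) z t v m - D.sgn x y * D.res F (u ++ y :: x :: s) z t v m = 0
      ↔ D.res F (u ++ x :: y :: s) z t v m = 0 := by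
    rcases hxy with hxy | ⟨rfl, hs⟩
    · have hle : t ≤ z := by
        rcases hzt with hzt | ⟨rfl, -⟩
        exacts [hzt.le, le_rfl]
      have l1 : WordLT (u ++ y :: x :: (s ++ z :: t :: v)) (u ++ x :: y :: (s ++ z :: t :: v)) :=
        wordLT_swap u _ hxy
      rw [(h _ l1).swap (u ++ y :: x :: s) z t v m (by simp) hle]
      simp
    · rw [hs]
      constructor <;> intro h <;> linarith
  rw [← h1, ← h2, sq]

lemma end_overlap_iff {u : List ι} {x y : ι}
    (h : ∀ w', WordLT w' (u ++ [x, y]) → D.Resolved F w') (hxy : D.Descent x y) (hy : D.neg y)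
    (m : M) : D.res F u x y [] m = 0 ↔ D.resEnd F (u ++ [x]) y m = 0 := by
  have H := Resolved.relBelow h
  rw [show (u ++ [x, y]).length = u.length + 2 by simp] at H
  have hle : y ≤ x := by
    rcases hxy with hxy | ⟨rfl, -⟩
    exacts [hxy.le, le_rfl]
  -- The letters with x^∨ = -x are an upper set of the order, so a descent that ends in one consists
  -- of two of them and the end relation is available for both.
  have hx := D.neg_of_le y x hy hle
  have e := H.end_overlap hx hy m
  rcases hxy with hxy | ⟨rfl, hs⟩
  · rw [(h _ (wordLT_swap u [] hxy)).last (u ++ [y]) x m (by simp) hx] at e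
    constructor <;> intro h <;> linarith
  · rw [hs] at e
    constructor <;> intro h <;> linarith

lemma end_disjoint_iff {u s : List ι} {x y z : ι}
    (h : ∀ w', WordLT w' (u ++ x :: y :: (s ++ [z])) → D.Resolved F w') (hxy : D.Descent x y)
    (hz : D.neg z) (m : M) :
    D.res F u x y (s ++ [z]) m = 0 ↔ D.resEnd F (u ++ x :: y :: s) z m = 0 := by
  have H := Resolved.relBelow h
  rw [show (u ++ x :: y :: (s ++ [z])).length = u.length + s.length + 3 by simp; omega] at H
  have e := H.end_square x y hz m
  rcases hxy with hxy | ⟨rfl, hs⟩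
  · rw [(h _ (wordLT_swap u _ hxy)).last (u ++ y :: x :: s) z m (by simp) hz] at e
    constructor <;> intro h <;> linarith
  · rw [hs] at e
    constructor <;> intro h <;> linarith

/-- The offset `a` between the two descents has length 0, 1 or at least 2: they are equal, overlap
in one letter, or are disjoint. -/
lemma swap_of_prefix {u u' v v' : List ι} {x y x' y' : ι} (a : List ι) (hu : u' = u ++ a)
    (ha : x :: y :: v = a ++ x' :: y' :: v')
    (h : ∀ w', WordLT w' (u ++ x :: y :: v) → D.Resolved F w') (hxy : D.Descent x y)
    (hxy' : D.Descent x' y') (m : M) : D.res F u x y v m = 0 ↔ D.res F u' x' y' v' m = 0 := by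
  subst hu
  match a, ha with
  | [], ha => simp at ha; obtain ⟨rfl, rfl, rfl⟩ := ha; simp
  | [c], ha =>
    simp at ha; obtain ⟨rfl, rfl, rfl⟩ := ha
    exact overlap_iff h hxy hxy' m
  | c :: d :: s, ha =>
    simp at ha; obtain ⟨rfl, rfl, rfl⟩ := ha
    exact disjoint_iff h hxy hxy' m

lemma swap_iff {u u' v v' : List ι} {x y x' y' : ι}
    (hw : u ++ x :: y :: v = u' ++ x' :: y' :: v')
    (h : ∀ w', WordLT w' (u ++ x :: y :: v) → D.Resolved F w') (hxy : D.Descent x y)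
    (hxy' : D.Descent x' y') (m : M) : D.res F u x y v m = 0 ↔ D.res F u' x' y' v' m = 0 := by
  rcases List.append_eq_append_iff.mp hw with ⟨a, hu, ha⟩ | ⟨a, hu, ha⟩
  · exact swap_of_prefix a hu ha h hxy hxy' m
  · exact (swap_of_prefix a hu ha (hw ▸ h) hxy' hxy m).symm

lemma end_iff {u u' v : List ι} {x y z : ι} (hw : u ++ x :: y :: v = u' ++ [z])
    (h : ∀ w', WordLT w' (u ++ x :: y :: v) → D.Resolved F w') (hxy : D.Descent x y)
    (hz : D.neg z) (m : M) : D.res F u x y v m = 0 ↔ D.resEnd F u' z m = 0 := by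
  rcases v.eq_nil_or_concat with rfl | ⟨s, c, rfl⟩
  · have : (u ++ [x]) ++ [y] = u' ++ [z] := by simpa using hw
    obtain ⟨rfl, hz'⟩ := List.append_inj' this rfl
    obtain rfl : y = z := by simpa using hz'
    exact end_overlap_iff h hxy hz m
  · have : (u ++ x :: y :: s) ++ [c] = u' ++ [z] := by simpa using hw
    obtain ⟨rfl, hz'⟩ := List.append_inj' this rfl
    obtain rfl : c = z := by simpa using hz'
    simp only [List.concat_eq_append] at h ⊢
    exact end_disjoint_iff h hxy hz m

variable (D)

/-- The ways to straighten a word. -/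
inductive Red : List ι → Type _
  | swap (u : List ι) (x y : ι) (v : List ι) (h : D.Descent x y) : Red (u ++ x :: y :: v)
  | last (u : List ι) (i : ι) (h : D.neg i) : Red (u ++ [i])

/-- The value on a word in terms of the values on smaller words. -/
noncomputable def Red.eval (F : List ι → M →ₗ[ℚ] ℚ) : ∀ {w : List ι}, D.Red w → M →ₗ[ℚ] ℚ
  -- For an odd letter the relation reads 2 x x = [x, x], and is solved by halving.
  | _, .swap u x y v _ => if x = y then (1 / 2 : ℚ) • D.lin F u v (D.br (D.b x) (D.b y)) else
      D.sgn x y • F (u ++ y :: x :: v) + D.lin F u v (D.br (D.b x) (D.b y))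
  | _, .last u i _ => (1 / 2 : ℚ) • F u ∘ₗ D.act (D.b i)

lemma Red.eval_congr {F F' : List ι → M →ₗ[ℚ] ℚ} {w : List ι} (r : D.Red w)
    (h : ∀ w', WordLT w' w → F w' = F' w') : r.eval D F = r.eval D F' := by
  cases r with
  | swap u x y v hxy =>
    have h1 : D.lin F u v = D.lin F' u v := by
      rw [lin, lin]
      congr 1
      funext k
      exact h _ (Or.inl (by simp))
    by_cases hne : x = y
    · simp only [eval, if_pos hne, h1]
    · simp only [eval, if_neg hne, h1]
      rw [h _ (wordLT_swap u v (hxy.resolve_right fun h => hne h.1))]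
  | last u i hi =>
    simp only [eval]
    rw [h u (Or.inl (by simp))]

/-- Straightening with prescribed values on the words that cannot be straightened. -/
lemma exists_straightening (val : List ι → M →ₗ[ℚ] ℚ) : ∃ F : List ι → M →ₗ[ℚ] ℚ,
    ∀ w, (IsEmpty (D.Red w) ∧ F w = val w) ∨ ∃ r : D.Red w, F w = r.eval D F := by
  classical
  let step (w : List ι) (F : List ι → M →ₗ[ℚ] ℚ) : M →ₗ[ℚ] ℚ :=
    if h : Nonempty (D.Red w) then (Classical.choice h).eval D F else val w
  have hstep : ∀ w F F', (∀ w', WordLT w' w → F w' = F' w') → step w F = step w F' := by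
    intro w F F' h
    by_cases hw : Nonempty (D.Red w)
    · simp only [step, dif_pos hw]
      exact Red.eval_congr D _ h
    · simp only [step, dif_neg hw]
  let F := wordLT_wf.fix (C := fun _ : List ι => M →ₗ[ℚ] ℚ) fun w rec =>
    step w fun w' => if h : WordLT w' w then rec w' h else 0
  have hF : ∀ w, F w = step w F := by
    intro w
    change wordLT_wf.fix _ w = _
    rw [WellFounded.fix_eq]
    refine hstep _ _ _ fun w' hw' => ?_
    rw [dif_pos hw']
  refine ⟨F, fun w => ?_⟩
  by_cases hw : Nonempty (D.Red w)
  · refine Or.inr ⟨Classical.choice hw, ?_⟩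
    conv_lhs => rw [hF]
    exact dif_pos hw
  · refine Or.inl ⟨not_nonempty_iff.mp hw, ?_⟩
    rw [hF]
    exact dif_neg hw

lemma descent_of_le {x y : ι} (h : y ≤ x) (u v : List ι) (m : M) :
    D.Descent x y ∨ ∀ F, D.res F u x y v m = 0 := by
  rcases h.lt_or_eq with h | rfl
  · exact Or.inl (Or.inl h)
  · rcases D.sgn_cases y y with h | h
    · exact Or.inr fun F => res_self D F h u v m
    · exact Or.inl (Or.inr ⟨rfl, h⟩)

/-- All relations hold for a form obtained by straightening. -/
lemma resolved_of_straightening {F val : List ι → M →ₗ[ℚ] ℚ}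
    (hF : ∀ w, (IsEmpty (D.Red w) ∧ F w = val w) ∨ ∃ r : D.Red w, F w = r.eval D F) (w : List ι) :
    D.Resolved F w := by
  induction w using wordLT_induction with
  | step w ih =>
    rcases hF w with ⟨he, -⟩ | ⟨r, hr⟩
    · refine ⟨fun u x y v m hw hxy => ?_, fun u i m hw hi => ?_⟩
      · subst hw
        rcases D.descent_of_le hxy u v m with h | h
        · exact he.elim (Red.swap u x y v h)
        · exact h F
      · subst hw
        exact he.elim (Red.last u i hi)
    · cases r with
      | swap u x y v h =>
        -- The straightening used to define the value of `F` on this word makes one defect vanish.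
        -- Every other defect of the word is equivalent to it by the resolved ambiguities.
        have h0 : ∀ m, D.res F u x y v m = 0 := by
          intro m
          rcases eq_or_ne x y with rfl | hne
          · have hs : D.sgn x x = -1 := by
              rcases h with h | h
              exacts [absurd h (lt_irrefl _), h.2]
            have := LinearMap.congr_fun hr m
            simp only [Red.eval, if_true, LinearMap.smul_apply, smul_eq_mul] at this
            rw [res, hs]
            linarith
          · have := LinearMap.congr_fun hr m
            simp only [Red.eval, if_neg hne, LinearMap.add_apply, LinearMap.smul_apply,
              smul_eq_mul] at this
            rw [res]
            linarith
        refine ⟨fun u' x' y' v' m hw hxy => ?_, fun u' i m hw hi => ?_⟩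
        · rcases D.descent_of_le hxy u' v' m with h' | h'
          · exact (swap_iff hw ih h h' m).mp (h0 m)
          · exact h' F
        · exact (end_iff hw ih h hi m).mp (h0 m)
      | last u i hi =>
        have h0 : ∀ m, D.resEnd F u i m = 0 := by
          intro m
          have := LinearMap.congr_fun hr m
          simp only [Red.eval, LinearMap.smul_apply, LinearMap.comp_apply, smul_eq_mul] at this
          rw [resEnd]
          linarith
        refine ⟨fun u' x' y' v' m hw hxy => ?_, fun u' i' m hw hi' => ?_⟩
        · rcases D.descent_of_le hxy u' v' m with h' | h'
          · exact (end_iff hw.symm (hw ▸ ih) h' hi m).mpr (h0 m)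
          · exact h' F
        · obtain ⟨rfl, hz'⟩ := List.append_inj' hw rfl
          obtain rfl : i = i' := by simpa using hz'
          exact h0 m

/-- There is a linear form on words in the basis that is compatible with all relations, vanishes on
words of length less than `n`, and is a product of linear forms on words of length `n`. -/
theorem exists_form (lam : L →ₗ[ℚ] ℚ) (mu : M →ₗ[ℚ] ℚ) (n : ℕ)
    (hsgn : ∀ i j, D.sgn i j = -1 → lam (D.b i) = 0) (hneg : ∀ i, D.neg i → lam (D.b i) = 0) :
    ∃ F : List ι → M →ₗ[ℚ] ℚ, (∀ u i j v m, D.res F u i j v m = 0) ∧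
      (∀ u i m, D.neg i → D.resEnd F u i m = 0) ∧
      (∀ w, w.length < n → F w = 0) ∧
      ∀ w, w.length = n → F w = (w.map fun i => lam (D.b i)).prod • mu := by
  obtain ⟨F, hF⟩ := D.exists_straightening fun w =>
    if w.length = n then (w.map fun i => lam (D.b i)).prod • mu else 0
  have hR := D.resolved_of_straightening hF
  -- Up to length `n` the prescribed values already respect straightening: bracket and end terms
  -- live on words of length below `n`, where `F` is zero, and swaps only permute commuting factors.
  have key : ∀ w, w.length ≤ n →
      F w = if w.length = n then (w.map fun i => lam (D.b i)).prod • mu else 0 := by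
    intro w
    induction w using wordLT_induction with
    | step w ih =>
      intro hw
      rcases hF w with ⟨-, h⟩ | ⟨r, hr⟩
      · exact h
      · rw [hr]
        cases r with
        | swap u x y v h =>
          have h0 : D.lin F u v = 0 := by
            refine D.b.ext fun k => ?_
            simp only [List.length_append, List.length_cons] at hw
            rw [lin_basis, ih (u ++ k :: v) (Or.inl (by simp)) (by simp; omega), if_neg (by simp; omega)]
            rfl
          simp only [Red.eval, h0, LinearMap.zero_apply, smul_zero, add_zero]
          rcases h with h | ⟨rfl, h⟩
          · rw [if_neg h.ne', ih _ (wordLT_swap u v h) (by simpa using hw)]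
            have hl : (u ++ y :: x :: v).length = (u ++ x :: y :: v).length := by simp
            have hp : ((u ++ y :: x :: v).map fun i => lam (D.b i)).prod =
                ((u ++ x :: y :: v).map fun i => lam (D.b i)).prod :=
              (((List.Perm.swap _ _ _).append_left u).map _).prod_eq
            rw [hl, hp]
            rcases D.sgn_cases x y with hs | hs
            · rw [hs, one_smul]
            -- A swap with sign -1 is harmless because `hsgn` makes a factor of the product zero.
            · have : ((u ++ x :: y :: v).map fun i => lam (D.b i)).prod = 0 := by
                simp [hsgn x y hs]
              rw [this]; simp
          · rw [if_pos rfl]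
            simp [hsgn x x h]
        | last u i hi =>
          have h0 : F u = 0 := by
            simp only [List.length_append, List.length_singleton] at hw
            rw [ih u (Or.inl (by simp)) (by omega), if_neg (by omega)]
          simp [Red.eval, h0, hneg i hi]
  refine ⟨F, fun u i j v m => ?_, fun u i m hi => (hR _).last u i m rfl hi, fun w hw => ?_,
    fun w hw => ?_⟩
  · rcases le_total j i with hij | hij
    · exact (hR _).swap u i j v m rfl hij
    · rw [res_symm, (hR _).swap u j i v m rfl hij, mul_zero]
  · rw [key w hw.le, if_neg hw.ne]
  · rw [key w hw.le, if_pos hw]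

end StraighteningData

end Straightening

/-! ### Homogeneous bases of involutive graded Lie algebras -/

section Homogeneous

open Module

variable {Γ : Type*} [AddCommMonoid Γ] [StarAddMonoid Γ] {L : Type*} [AddCommGroup L] [Module ℚ L]
  {Θ : Type*} [AddAction Γ Θ] {M : Type*} [AddCommGroup M] [Module ℚ M]

/-- The sign of interchanging elements of parities `p` and `q`. -/
def paritySign (p q : Bool) : ℚ := if p && q then -1 else 1

lemma negOnePow_mul_smul {V : Type*} [AddCommGroup V] [Module ℚ V] (a b : ℤ) (v : V) :
    ((a * b).negOnePow : ℤ) • v = paritySign (decide (Odd a)) (decide (Odd b)) • v := by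
  rcases Int.even_or_odd (a * b) with h | h
  · have : ¬(Odd a ∧ Odd b) := fun h' => Int.not_even_iff_odd.mpr (Int.odd_mul.mpr h') h
    rw [Int.negOnePow_even _ h]
    simp [paritySign, this]
  · rw [Int.negOnePow_odd _ h]
    simp [paritySign, Int.odd_mul.mp h]

lemma paritySign_symm (p q : Bool) : paritySign p q = paritySign q p := by
  simp [paritySign, Bool.and_comm]

lemma paritySign_mul_self (p q : Bool) : paritySign p q * paritySign p q = 1 := by
  cases p <;> cases q <;> simp [paritySign]

lemma paritySign_xor (p q r : Bool) :
    paritySign (xor p q) r = paritySign p r * paritySign q r := by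
  cases p <;> cases q <;> cases r <;> simp [paritySign]

namespace InvGradedLie

variable (𝓛 : InvGradedLie Γ L)

/-- The part of the given parity. -/
def parityPart (p : Bool) : Submodule ℚ L :=
  ⨆ q ∈ {q : Γ × ℤ | decide (Odd q.2) = p}, 𝓛.piece q.1 q.2

lemma piece_le_parityPart (α : Γ) (a : ℤ) : 𝓛.piece α a ≤ 𝓛.parityPart (decide (Odd a)) :=
  le_biSup (fun q : Γ × ℤ => 𝓛.piece q.1 q.2) (i := (α, a)) rfl

lemma parityPart_induction {p : Bool} {P : ∀ x, x ∈ 𝓛.parityPart p → Prop}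
    (piece : ∀ α a x (ha : decide (Odd a) = p) (hx : x ∈ 𝓛.piece α a),
      P x (ha ▸ 𝓛.piece_le_parityPart α a hx))
    (zero : P 0 (zero_mem _))
    (add : ∀ x y hx hy, P x hx → P y hy → P (x + y) (add_mem hx hy)) {x : L}
    (hx : x ∈ 𝓛.parityPart p) : P x hx := by
  suffices h : ∀ x ∈ 𝓛.parityPart p, ∃ h : x ∈ 𝓛.parityPart p, P x h from (h x hx).2
  intro x hx
  rw [parityPart, iSup_subtype'] at hx
  induction hx using Submodule.iSup_induction' with
  | mem i x hx => exact ⟨_, piece i.1.1 i.1.2 x i.2 hx⟩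
  | zero => exact ⟨_, zero⟩
  | add x y _ _ hx hy => exact ⟨_, add x y _ _ hx.2 hy.2⟩

lemma parityPart_disjoint (p : Bool) : Disjoint (𝓛.parityPart p) (𝓛.parityPart !p) := by
  refine 𝓛.indep.disjoint_biSup_biSup ?_
  rw [Set.disjoint_left]
  intro q hq hq'
  simp only [Set.mem_ofPred_eq] at hq hq'
  rw [hq] at hq'
  cases p <;> simp at hq'

lemma dual_mem_parityPart {p : Bool} {x : L} (hx : x ∈ 𝓛.parityPart p) :
    𝓛.dual x ∈ 𝓛.parityPart p := by
  induction hx using 𝓛.parityPart_induction with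
  | piece α a x ha hx =>
    subst ha
    exact 𝓛.piece_le_parityPart _ _ (𝓛.dual_mem hx)
  | zero => rw [map_zero]; exact zero_mem _
  | add x y _ _ hx hy => rw [map_add]; exact add_mem hx hy

lemma bracket_mem_parityPart {p q : Bool} {x y : L} (hx : x ∈ 𝓛.parityPart p)
    (hy : y ∈ 𝓛.parityPart q) : 𝓛.bracket x y ∈ 𝓛.parityPart (xor p q) := by
  induction hx using 𝓛.parityPart_induction with
  | piece α a x ha hx =>
    induction hy using 𝓛.parityPart_induction with
    | piece β b y hb hy =>
      subst ha hb
      have h := 𝓛.piece_le_parityPart _ _ (𝓛.bracket_mem hx hy)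
      have e : decide (Odd (a + b)) = xor (decide (Odd a)) (decide (Odd b)) := by
        by_cases h1 : Odd a <;> by_cases h2 : Odd b <;>
          simp [Int.odd_add, h1, h2, Int.not_even_iff_odd];
          simpa using h2
      rwa [e] at h
    | zero => rw [map_zero]; exact zero_mem _
    | add x y _ _ hx hy => rw [map_add]; exact add_mem hx hy
  | zero => rw [map_zero, LinearMap.zero_apply]; exact zero_mem _
  | add x y _ _ hx hy => rw [map_add, LinearMap.add_apply]; exact add_mem hx hy

lemma bracket_symm {p q : Bool} {x y : L} (hx : x ∈ 𝓛.parityPart p)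
    (hy : y ∈ 𝓛.parityPart q) :
    𝓛.bracket x y = -paritySign p q • 𝓛.bracket y x := by
  induction hx using 𝓛.parityPart_induction with
  | piece α a x ha hx =>
    induction hy using 𝓛.parityPart_induction with
    | piece β b y hb hy =>
      subst ha hb
      have h := 𝓛.bracket_antisymm hx hy
      rw [negOnePow_mul_smul] at h
      rw [neg_smul]
      exact eq_neg_of_add_eq_zero_left h
    | zero => simp
    | add x y _ _ hx hy => simp only [map_add, LinearMap.add_apply, smul_add, hx, hy]
  | zero => simp
  | add x y _ _ hx hy => simp only [map_add, LinearMap.add_apply, smul_add, hx, hy]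

lemma jacobi_parityPart {p q : Bool} {x y : L} (hx : x ∈ 𝓛.parityPart p)
    (hy : y ∈ 𝓛.parityPart q) (z : L) :
    𝓛.bracket x (𝓛.bracket y z) - paritySign p q • 𝓛.bracket y (𝓛.bracket x z) =
      𝓛.bracket (𝓛.bracket x y) z := by
  induction hx using 𝓛.parityPart_induction with
  | piece α a x ha hx =>
    induction hy using 𝓛.parityPart_induction with
    | piece β b y hb hy =>
      subst ha hb
      have h := 𝓛.jacobi hx hy z
      rwa [negOnePow_mul_smul] at h
    | zero => simp
    | add x y _ _ hx hy =>
      simp only [map_add, LinearMap.add_apply, smul_add, ← hx, ← hy]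
      abel
  | zero => simp
  | add x y _ _ hx hy =>
    simp only [map_add, LinearMap.add_apply, smul_add, ← hx, ← hy]
    abel

lemma _root_.SDWallCrossing.TwistedModule.jacobi_parityPart {𝓛 : InvGradedLie Γ L}
    (𝓜 : TwistedModule 𝓛 Θ M) {p q : Bool} {x y : L} (hx : x ∈ 𝓛.parityPart p)
    (hy : y ∈ 𝓛.parityPart q) (m : M) :
    𝓜.act x (𝓜.act y m) - paritySign p q • 𝓜.act y (𝓜.act x m) =
      𝓜.act (𝓛.bracket x y) m - 𝓜.act (𝓛.bracket x (𝓛.dual y)) m := by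
  induction hx using 𝓛.parityPart_induction with
  | piece α a x ha hx =>
    induction hy using 𝓛.parityPart_induction with
    | piece β b y hb hy =>
      subst ha hb
      have h := 𝓜.jacobi hx hy m
      rwa [negOnePow_mul_smul] at h
    | zero => simp
    | add x y _ _ hx hy =>
      have h := congrArg₂ (· + ·) hx hy
      simp only [map_add, LinearMap.add_apply, smul_add] at h ⊢
      convert h using 1 <;> abel
  | zero => simp
  | add x y _ _ hx hy =>
    have h := congrArg₂ (· + ·) hx hy
    simp only [map_add, LinearMap.add_apply, smul_add] at h ⊢
    convert h using 1 <;> abel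

/-- Vectors of pure parity with `x^∨ = ± x`. -/
def eigenvectors : Set L :=
  {x | (∃ p, x ∈ 𝓛.parityPart p) ∧ (𝓛.dual x = x ∨ 𝓛.dual x = -x)}

lemma span_eigenvectors : ⊤ ≤ Submodule.span ℚ 𝓛.eigenvectors := by
  rw [← 𝓛.iSup_eq_top]
  refine iSup_le fun q x hx => ?_
  have hx' := 𝓛.piece_le_parityPart _ _ hx
  have hd := 𝓛.dual_mem_parityPart hx'
  have e : x = (1 / 2 : ℚ) • (x + 𝓛.dual x) + (1 / 2 : ℚ) • (x - 𝓛.dual x) := by module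
  rw [e]
  refine add_mem (Submodule.smul_mem _ _ (Submodule.subset_span ⟨⟨_, add_mem hx' hd⟩, Or.inl ?_⟩))
    (Submodule.smul_mem _ _ (Submodule.subset_span ⟨⟨_, sub_mem hx' hd⟩, Or.inr ?_⟩))
  · rw [map_add, 𝓛.dual_dual, add_comm]
  · rw [map_sub, 𝓛.dual_dual, neg_sub]

/-- A basis of vectors of pure parity with `x^∨ = ± x`. -/
structure EigenBasis (ι : Type*) where
  b : Basis ι ℚ L
  par : ι → Bool
  par_mem : ∀ i, b i ∈ 𝓛.parityPart (par i)
  dual_eq : ∀ i, 𝓛.dual (b i) = b i ∨ 𝓛.dual (b i) = -b i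

lemma exists_eigenBasis : ∃ s : Set L, Nonempty (𝓛.EigenBasis s) := by
  have h : ∀ i, Basis.ofSpan 𝓛.span_eigenvectors i ∈ 𝓛.eigenvectors := fun i =>
    Basis.ofSpan_subset 𝓛.span_eigenvectors (Set.mem_range_self i)
  choose par hpar using fun i => (h i).1
  exact ⟨_, ⟨⟨Basis.ofSpan 𝓛.span_eigenvectors, par, hpar, fun i => (h i).2⟩⟩⟩

variable {𝓛} {ι : Type*} (B : 𝓛.EigenBasis ι)

/-- The basis projections `P p` and `P !p` add up to the identity. So `P (!p) x = x - P p x` lies in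
both parity parts and is zero. -/
lemma EigenBasis.par_of_repr_ne_zero {p : Bool} {x : L} (hx : x ∈ 𝓛.parityPart p) {k : ι}
    (hk : B.b.repr x k ≠ 0) : B.par k = p := by
  let P (q : Bool) : L →ₗ[ℚ] L := B.b.constr ℚ fun k => if B.par k = q then B.b k else 0
  have hP : ∀ q x, P q x ∈ 𝓛.parityPart q := by
    intro q x
    have h : LinearMap.range (P q) ≤ 𝓛.parityPart q := by
      rw [Basis.constr_range, Submodule.span_le]
      rintro _ ⟨k, rfl⟩
      by_cases h : B.par k = q
      · simpa [h] using h ▸ B.par_mem k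
      · simp [h]
    exact h (LinearMap.mem_range_self _ x)
  have hsum : P p + P (!p) = LinearMap.id := by
    refine B.b.ext fun k => ?_
    simp only [P, LinearMap.add_apply, Basis.constr_basis, LinearMap.id_apply]
    cases B.par k <;> cases p <;> simp
  have h0 : P (!p) x = 0 := by
    have e : P (!p) x = x - P p x := by
      rw [eq_sub_iff_add_eq', ← LinearMap.add_apply, hsum, LinearMap.id_apply]
    have := (𝓛.parityPart_disjoint p).le_bot ⟨e ▸ sub_mem hx (hP p x), hP _ x⟩
    simpa using this
  have hc : B.b.coord k ∘ₗ P (!p) = (if B.par k = !p then 1 else 0 : ℚ) • B.b.coord k := by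
    refine B.b.ext fun j => ?_
    by_cases h : j = k
    · subst h
      by_cases h' : B.par j = !p <;> simp [P, h']
    · rw [LinearMap.smul_apply]
      by_cases h' : B.par j = !p <;> simp [P, h', h]
  have := LinearMap.congr_fun hc x
  rw [LinearMap.comp_apply, h0, map_zero, LinearMap.smul_apply, Basis.coord_apply] at this
  by_contra hne
  have hne' : B.par k = !p := by
    rw [Bool.eq_not]; exact hne
  rw [if_pos hne', one_smul] at this
  exact hk this.symm

/-- The coordinate at a self-dual basis vector is invariant under the involution, and hence vanishes
on anti-invariant vectors. -/
lemma EigenBasis.dual_eq_neg_of_repr_ne_zero {x : L} (hx : 𝓛.dual x = -x) {k : ι}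
    (hk : B.b.repr x k ≠ 0) : 𝓛.dual (B.b k) = -B.b k := by
  by_contra h
  have hk' := (B.dual_eq k).resolve_right h
  have hc : B.b.coord k ∘ₗ 𝓛.dual = B.b.coord k := by
    refine B.b.ext fun j => ?_
    by_cases hj : j = k
    · subst hj; simp [hk']
    · rcases B.dual_eq j with h1 | h1 <;> simp [h1, hj]
  have := LinearMap.congr_fun hc x
  rw [LinearMap.comp_apply, hx, map_neg, Basis.coord_apply] at this
  exact hk (by linarith)

lemma EigenBasis.mem_span {p : Bool} {x : L} (hx : x ∈ 𝓛.parityPart p) :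
    x ∈ Submodule.span ℚ (B.b '' {k | B.par k = p}) := by
  rw [B.b.mem_span_image]
  intro k hk
  exact B.par_of_repr_ne_zero hx (Finsupp.mem_support_iff.mp hk)

end InvGradedLie

lemma exists_linearOrder_mono {ι : Type*} (neg : ι → Prop) :
    ∃ o : LinearOrder ι, ∀ i j, neg i → o.le i j → neg j := by
  classical
  let o : LinearOrder ι := linearOrderOfSTO WellOrderingRel
  -- Lexicographic order with the truth value of `neg` first; since false < true, the indices
  -- satisfying `neg` come last.
  refine ⟨LinearOrder.lift' (fun i => toLex (decide (neg i), i)) fun i j h => ?_, fun i j hi hij => ?_⟩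
  · exact (Prod.ext_iff.mp (toLex.injective h)).2
  · have : toLex (decide (neg i), i) ≤ toLex (decide (neg j), j) := hij
    rw [Prod.Lex.toLex_le_toLex] at this
    simp only [hi, decide_true] at this
    by_contra hj
    rcases this with h | h
    · simp [hj] at h; exact absurd h (by decide)
    · simp [hj] at h

open InvGradedLie in
/-- The data for straightening given by a homogeneous basis. -/
noncomputable def TwistedModule.straighteningData {𝓛 : InvGradedLie Γ L} (𝓜 : TwistedModule 𝓛 Θ M)
    {ι : Type*} [o : LinearOrder ι] (B : 𝓛.EigenBasis ι)
    (ho : ∀ i j, 𝓛.dual (B.b i) = -B.b i → o.le i j → 𝓛.dual (B.b j) = -B.b j) :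
    StraighteningData ι L M where
  b := B.b
  br := 𝓛.bracket
  act := 𝓜.act
  sgn i j := paritySign (B.par i) (B.par j)
  neg i := 𝓛.dual (B.b i) = -B.b i
  sgn_mul_self i j := paritySign_mul_self _ _
  sgn_symm i j := paritySign_symm _ _
  anti i j := 𝓛.bracket_symm (B.par_mem i) (B.par_mem j)
  jacobi i j k := 𝓛.jacobi_parityPart (B.par_mem i) (B.par_mem j) _
  sgn_br i j k l h := by
    rw [B.par_of_repr_ne_zero (𝓛.bracket_mem_parityPart (B.par_mem i) (B.par_mem j)) h,
      paritySign_xor]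
  neg_of_le := ho
  neg_br i j k hi hj h := by
    refine B.dual_eq_neg_of_repr_ne_zero ?_ h
    rw [← neg_neg (𝓛.dual _), ← 𝓛.bracket_dual, hi, hj]
    simp
  act_jacobi i j m hi hj := by
    -- As the second vector is anti-invariant, the two terms on the right of the twisted Jacobi
    -- identity coincide; hence the factor 2.
    rw [𝓜.jacobi_parityPart (B.par_mem i) (B.par_mem j), hj]
    simp [two_smul]

end Homogeneous

/-! ### Linear forms on twisted enveloping modules -/

section LinearForms

open Module TensorProduct

lemma exists_factor {V W U : Type*} [AddCommGroup V] [Module ℚ V] [AddCommGroup W] [Module ℚ W]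
    [AddCommGroup U] [Module ℚ U] (π : V →ₗ[ℚ] W) (hπ : Function.Surjective π) (f : V →ₗ[ℚ] U)
    (h : ∀ v, π v = 0 → f v = 0) : ∃ g : W →ₗ[ℚ] U, ∀ v, g (π v) = f v := by
  obtain ⟨s, hs⟩ := LinearMap.exists_rightInverse_of_surjective π (LinearMap.range_eq_top.mpr hπ)
  refine ⟨f ∘ₗ s, fun v => ?_⟩
  have h1 : f (s (π v) - v) = 0 := h _ (by
    rw [map_sub, ← LinearMap.comp_apply, hs, LinearMap.id_apply, sub_self])
  rw [map_sub] at h1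
  exact sub_eq_zero.mp h1

variable {Γ : Type*} [AddCommMonoid Γ] [StarAddMonoid Γ] {L : Type*} [AddCommGroup L] [Module ℚ L]
  {Θ : Type*} [AddAction Γ Θ] {M : Type*} [AddCommGroup M] [Module ℚ M] {𝓛 : InvGradedLie Γ L}

lemma Env.mk_surjective : Function.Surjective (Env.mk 𝓛) :=
  RingQuot.mkAlgHom_surjective ℚ (EnvRel 𝓛)

/-- Linear maps on the tensor algebra that respect the relations vanish on the kernel of the
projection to the enveloping algebra. -/
lemma eq_zero_of_envMk_eq_zero {V : Type*} [AddCommGroup V] [Module ℚ V]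
    (f : TensorAlgebra ℚ L →ₗ[ℚ] V)
    (hf : ∀ u v x y, EnvRel 𝓛 x y → f (u * x * v) = f (u * y * v)) {t : TensorAlgebra ℚ L}
    (ht : Env.mk 𝓛 t = 0) : f t = 0 := by
  -- Elements that `f` cannot distinguish inside any product form a ring congruence containing the
  -- relations, so the quotient by it receives a map from the enveloping algebra.
  let c : RingCon (TensorAlgebra ℚ L) :=
    { r := fun x y => ∀ u v, f (u * x * v) = f (u * y * v)
      iseqv := ⟨fun _ _ _ => rfl, fun h u v => (h u v).symm, fun h h' u v => (h u v).trans (h' u v)⟩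
      add' := by
        intro w x y z h h' u v
        simp only [mul_add, add_mul, map_add, h u v, h' u v]
      mul' := by
        intro w x y z h h' u v
        have h1 := h u (y * v)
        have h2 := h' (u * x) v
        simp only [mul_assoc] at h1 h2 ⊢
        rw [h1, h2] }
  let g : RingQuot (EnvRel 𝓛) →+* c.Quotient :=
    RingQuot.lift ⟨c.mk', fun x y h => (RingCon.eq c).mpr fun u v => hf u v x y h⟩
  have hg : g (Env.mk 𝓛 t) = c.mk' t := by
    have : Env.mk 𝓛 t = RingQuot.mkRingHom (EnvRel 𝓛) t := by
      rw [← RingQuot.mkAlgHom_coe ℚ]; rfl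
    rw [this]
    exact RingQuot.lift_mkRingHom_apply _ _ _
  have h0 : c.mk' t = c.mk' 0 :=
    hg.symm.trans ((congrArg g ht).trans ((map_zero g).trans (map_zero c.mk').symm))
  have := (RingCon.eq c).mp h0 1 1
  simpa using this

variable (𝓜 : TwistedModule 𝓛 Θ M)

/-- The projection to the twisted enveloping module as a rational linear map. -/
noncomputable def twMk : Env 𝓛 ⊗[ℚ] M →ₗ[ℚ] Utw 𝓜 where
  toFun := (twRel 𝓜).mkQ
  map_add' := map_add _
  map_smul' c z := by
    rw [← algebraMap_smul (Env 𝓛) c z, map_smul, algebraMap_smul, RingHom.id_apply]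

lemma twMk_apply (z : Env 𝓛 ⊗[ℚ] M) : twMk 𝓜 z = (twRel 𝓜).mkQ z := rfl

lemma twMk_surjective (y : Utw 𝓜) : ∃ z, twMk 𝓜 z = y := by
  obtain ⟨z, hz⟩ := (twRel 𝓜).mkQ_surjective y
  exact ⟨z, (twMk_apply 𝓜 z).trans hz⟩

lemma twMk_eq_zero_iff (z : Env 𝓛 ⊗[ℚ] M) : twMk 𝓜 z = 0 ↔ z ∈ twRel 𝓜 := by
  rw [twMk_apply, Submodule.mkQ_apply, Submodule.Quotient.mk_eq_zero]

lemma twMk_tmul (u : Env 𝓛) (m : M) : twMk 𝓜 (u ⊗ₜ[ℚ] m) = u • Utw.of 𝓜 m := by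
  rw [Utw.of, ← map_smul, TensorProduct.smul_tmul', smul_eq_mul, mul_one]
  rfl

/-- A linear form on the tensor algebra with values in forms on `M` that respects all relations
induces a form on the twisted enveloping module. -/
lemma exists_form_of_relations (f : TensorAlgebra ℚ L →ₗ[ℚ] M →ₗ[ℚ] ℚ)
    (hf : ∀ u v x y, EnvRel 𝓛 x y → f (u * x * v) = f (u * y * v))
    (hf' : ∀ u x m, f (u * TensorAlgebra.ι ℚ x) m - f (u * TensorAlgebra.ι ℚ (𝓛.dual x)) m =
      f u (𝓜.act x m)) :
    ∃ Φ : Utw 𝓜 →ₗ[ℚ] ℚ, ∀ (xs : List L) (m : M),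
      Φ ((xs.map (Env.of 𝓛)).prod • Utw.of 𝓜 m) =
        f ((xs.map (TensorAlgebra.ι ℚ)).prod) m := by
  obtain ⟨g, hg⟩ := exists_factor (Env.mk 𝓛).toLinearMap Env.mk_surjective f
    fun t ht => eq_zero_of_envMk_eq_zero f hf ht
  simp only [AlgHom.toLinearMap_apply] at hg
  let Λ : Env 𝓛 ⊗[ℚ] M →ₗ[ℚ] ℚ := TensorProduct.lift g
  have hΛ : ∀ z ∈ twRel 𝓜, ∀ e : Env 𝓛, Λ (e • z) = 0 := by
    intro z hz
    induction hz using Submodule.span_induction with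
    | mem z hz =>
      obtain ⟨x, m, rfl⟩ := hz
      intro e
      obtain ⟨t, rfl⟩ := Env.mk_surjective e
      have h1 : ∀ x, Env.mk 𝓛 t * Env.of 𝓛 x = Env.mk 𝓛 (t * TensorAlgebra.ι ℚ x) := by
        intro x; rw [map_mul]; rfl
      simp only [smul_sub, TensorProduct.smul_tmul', smul_eq_mul, map_sub, h1, mul_one, Λ,
        TensorProduct.lift.tmul, hg]
      rw [hf', sub_self]
    | zero => simp
    | add x y _ _ hx hy =>
      intro e
      rw [smul_add, map_add, hx, hy, add_zero]
    | smul c x _ hx =>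
      intro e
      rw [smul_smul]
      exact hx _
  obtain ⟨Φ, hΦ⟩ := exists_factor (twMk 𝓜) (twMk_surjective 𝓜) Λ (fun z hz => by
      simpa using hΛ z ((twMk_eq_zero_iff 𝓜 z).mp hz) 1)
  refine ⟨Φ, fun xs m => ?_⟩
  have h1 : (xs.map (Env.of 𝓛)).prod = Env.mk 𝓛 ((xs.map (TensorAlgebra.ι ℚ)).prod) := by
    rw [map_list_prod, List.map_map]; rfl
  rw [← twMk_tmul, hΦ, h1]
  simp only [Λ, TensorProduct.lift.tmul, hg]

/-- A consequence of the Poincaré–Birkhoff–Witt theorem: there are linear forms on the twisted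
enveloping module that are products of linear forms on words of length `n` and vanish on shorter
words. -/
theorem exists_leading_form (lam : L →ₗ[ℚ] ℚ) (mu : M →ₗ[ℚ] ℚ)
    (hodd : ∀ α a x, Odd a → x ∈ 𝓛.piece α a → lam x = 0)
    (hdual : ∀ x, lam (𝓛.dual x) = lam x) (n : ℕ) :
    ∃ Φ : Utw 𝓜 →ₗ[ℚ] ℚ, ∀ (xs : List L) (m : M),
      (xs.length < n → Φ ((xs.map (Env.of 𝓛)).prod • Utw.of 𝓜 m) = 0) ∧
      (xs.length = n → Φ ((xs.map (Env.of 𝓛)).prod • Utw.of 𝓜 m) = (xs.map lam).prod * mu m) := by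
  obtain ⟨s, ⟨B⟩⟩ := 𝓛.exists_eigenBasis
  obtain ⟨o, ho⟩ := exists_linearOrder_mono fun i => 𝓛.dual (B.b i) = -B.b i
  let D := 𝓜.straighteningData B ho
  have hodd' : ∀ x ∈ 𝓛.parityPart true, lam x = 0 := by
    intro x hx
    induction hx using 𝓛.parityPart_induction with
    | piece α a x ha hx => exact hodd α a x (by simpa using ha) hx
    | zero => simp
    | add x y _ _ hx hy => rw [map_add, hx, hy, add_zero]
  obtain ⟨F, hres, hend, hlt, hn⟩ := D.exists_form lam mu n (fun i j hij => by
      refine hodd' _ ?_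
      have : B.par i = true := by
        change paritySign (B.par i) (B.par j) = -1 at hij
        by_contra h
        simp [paritySign, h] at hij
        norm_num at hij
      exact this ▸ B.par_mem i) (fun i hi => by
      have h1 := hdual (B.b i)
      have h2 : 𝓛.dual (B.b i) = -B.b i := hi
      rw [h2, map_neg] at h1
      change lam (B.b i) = 0
      linarith)
  -- Words in the basis of `L` form a basis of the tensor algebra, so the values of `F` on words
  -- extend uniquely.
  let f : TensorAlgebra ℚ L →ₗ[ℚ] M →ₗ[ℚ] ℚ :=
    B.b.tensorAlgebra.constr ℚ fun w => F (FreeMonoid.toList w)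
  have hbas : ∀ w : List s, B.b.tensorAlgebra (FreeMonoid.ofList w) =
      (w.map fun i => TensorAlgebra.ι ℚ (B.b i)).prod := by
    intro w
    rw [Module.Basis.tensorAlgebra, Basis.map_apply, AlgEquiv.toLinearEquiv_apply]
    have : FreeAlgebra.basisFreeMonoid ℚ s (FreeMonoid.ofList w) =
        (w.map (FreeAlgebra.ι ℚ)).prod := by
      have : FreeAlgebra.equivMonoidAlgebraFreeMonoid (R := ℚ) (w.map (FreeAlgebra.ι ℚ)).prod =
          MonoidAlgebra.single (FreeMonoid.ofList w) 1 := by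
        rw [map_list_prod, List.map_map]
        induction w with
        | nil => rfl
        | cons a w ih =>
          rw [List.map_cons, List.prod_cons, ih, FreeMonoid.ofList_cons]
          simp [FreeAlgebra.equivMonoidAlgebraFreeMonoid, MonoidAlgebra.single_mul_single]
      rw [← AlgEquiv.symm_apply_apply FreeAlgebra.equivMonoidAlgebraFreeMonoid
        (w.map (FreeAlgebra.ι ℚ)).prod, this]
      rfl
    rw [this, map_list_prod, List.map_map]
    congr 2
    funext i
    simp
  have hf : ∀ w : List s, f (w.map fun i => TensorAlgebra.ι ℚ (B.b i)).prod = F w := by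
    intro w
    rw [← hbas, Basis.constr_basis, FreeMonoid.toList_ofList]
  have hlin : ∀ (u v : List s) (x : L), f ((u.map fun i => TensorAlgebra.ι ℚ (B.b i)).prod *
      TensorAlgebra.ι ℚ x * (v.map fun i => TensorAlgebra.ι ℚ (B.b i)).prod) = D.lin F u v x := by
    intro u v x
    have : f ∘ₗ LinearMap.mulRight ℚ (v.map fun i => TensorAlgebra.ι ℚ (B.b i)).prod ∘ₗ
        LinearMap.mulLeft ℚ (u.map fun i => TensorAlgebra.ι ℚ (B.b i)).prod ∘ₗ
        TensorAlgebra.ι ℚ = D.lin F u v := by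
      refine B.b.ext fun k => ?_
      have h1 : D.lin F u v (B.b k) = F (u ++ k :: v) := D.lin_basis F u v k
      rw [h1, ← hf]
      simp [mul_assoc]
    exact LinearMap.congr_fun this x
  have hrel : ∀ (u v : List s) (p q : Bool) (x y : L), x ∈ 𝓛.parityPart p → y ∈ 𝓛.parityPart q →
      f ((u.map fun i => TensorAlgebra.ι ℚ (B.b i)).prod * (TensorAlgebra.ι ℚ x *
        TensorAlgebra.ι ℚ y - paritySign p q • (TensorAlgebra.ι ℚ y * TensorAlgebra.ι ℚ x)) *
        (v.map fun i => TensorAlgebra.ι ℚ (B.b i)).prod) = D.lin F u v (𝓛.bracket x y) := by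
    intro u v p q x y hx hy
    replace hx := B.mem_span hx
    replace hy := B.mem_span hy
    induction hx using Submodule.span_induction with
    | mem x hx =>
      obtain ⟨i, rfl, rfl⟩ := hx
      induction hy using Submodule.span_induction with
      | mem y hy =>
        obtain ⟨j, rfl, rfl⟩ := hy
        ext m
        have h1 := hres u i j v m
        rw [StraighteningData.res] at h1
        have e1 : F (u ++ i :: j :: v) = f ((u.map fun i => TensorAlgebra.ι ℚ (B.b i)).prod *
            (TensorAlgebra.ι ℚ (B.b i) * TensorAlgebra.ι ℚ (B.b j)) *
            (v.map fun i => TensorAlgebra.ι ℚ (B.b i)).prod) := by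
          rw [← hf]; simp [mul_assoc]
        have e2 : F (u ++ j :: i :: v) = f ((u.map fun i => TensorAlgebra.ι ℚ (B.b i)).prod *
            (TensorAlgebra.ι ℚ (B.b j) * TensorAlgebra.ι ℚ (B.b i)) *
            (v.map fun i => TensorAlgebra.ι ℚ (B.b i)).prod) := by
          rw [← hf]; simp [mul_assoc]
        rw [e1, e2] at h1
        rw [mul_sub, sub_mul, map_sub, mul_smul_comm, smul_mul_assoc, map_smul,
          LinearMap.sub_apply, LinearMap.smul_apply, smul_eq_mul]
        exact sub_eq_zero.mp h1
      | zero => simp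
      | add y y' _ _ h h' =>
        simp only [map_add, ← h, ← h']
        simp only [mul_add, add_mul, mul_sub, sub_mul, mul_smul_comm, smul_mul_assoc, smul_add,
          map_add, map_sub, map_smul]
        module
      | smul c y _ h =>
        simp only [map_smul, ← h]
        simp only [mul_sub, sub_mul, mul_smul_comm, smul_mul_assoc, smul_sub, map_sub, map_smul]
        module
    | zero => simp
    | add x x' _ _ h h' =>
      simp only [map_add, LinearMap.add_apply, ← h, ← h']
      simp only [mul_add, add_mul, mul_sub, sub_mul, mul_smul_comm, smul_mul_assoc, smul_add,
          map_add, map_sub, map_smul]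
      module
    | smul c x _ h =>
      simp only [map_smul, LinearMap.smul_apply, ← h]
      simp only [mul_sub, sub_mul, mul_smul_comm, smul_mul_assoc, smul_sub, map_sub, map_smul]
      module
  obtain ⟨Φ, hΦ⟩ := exists_form_of_relations 𝓜 f (by
      intro u v _ _ h
      obtain ⟨hx, hy⟩ := h
      rename_i α β a b x y
      rw [← sub_eq_zero, ← map_sub, ← sub_mul, ← mul_sub, negOnePow_mul_smul]
      have key := fun u v => hrel u v _ _ x y (𝓛.piece_le_parityPart _ _ hx)
        (𝓛.piece_le_parityPart _ _ hy)
      simp only [← hlin] at key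
      set z := TensorAlgebra.ι ℚ x * TensorAlgebra.ι ℚ y -
        paritySign (decide (Odd a)) (decide (Odd b)) • (TensorAlgebra.ι ℚ y * TensorAlgebra.ι ℚ x) -
        TensorAlgebra.ι ℚ (𝓛.bracket x y) with hz
      have h1 : ∀ u : List s, f ∘ₗ LinearMap.mulLeft ℚ
          ((u.map fun i => TensorAlgebra.ι ℚ (B.b i)).prod * z) = 0 := by
        intro u
        refine B.b.tensorAlgebra.ext fun v => ?_
        obtain ⟨v, rfl⟩ := FreeMonoid.ofList.surjective v
        rw [hbas, LinearMap.comp_apply, LinearMap.mulLeft_apply, hz, mul_sub, sub_mul, map_sub, key,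
          sub_self, LinearMap.zero_apply]
      have h2 : f ∘ₗ LinearMap.mulRight ℚ v ∘ₗ LinearMap.mulRight ℚ z = 0 := by
        refine B.b.tensorAlgebra.ext fun u => ?_
        obtain ⟨u, rfl⟩ := FreeMonoid.ofList.surjective u
        rw [hbas]
        exact LinearMap.congr_fun (h1 u) v
      exact LinearMap.congr_fun h2 u)
    (by
      intro u x m
      have h1 : f ∘ₗ LinearMap.mulRight ℚ (TensorAlgebra.ι ℚ (x - 𝓛.dual x)) =
          LinearMap.lcomp ℚ ℚ (𝓜.act x) ∘ₗ f := by
        refine B.b.tensorAlgebra.ext fun u => ?_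
        obtain ⟨u, rfl⟩ := FreeMonoid.ofList.surjective u
        rw [hbas]
        have h2 : f ∘ₗ LinearMap.mulLeft ℚ (u.map fun i => TensorAlgebra.ι ℚ (B.b i)).prod ∘ₗ
            TensorAlgebra.ι ℚ ∘ₗ (LinearMap.id - 𝓛.dual) =
            LinearMap.compRight ℚ (f (u.map fun i => TensorAlgebra.ι ℚ (B.b i)).prod) ∘ₗ
              𝓜.act := by
          refine B.b.ext fun k => ?_
          rcases B.dual_eq k with hk | hk
          -- For a self-dual vector the rule x ♥ m = -x^∨ ♥ m forces x ♥ m = 0, and both sides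
          -- vanish.
          · have h3 : 𝓜.act (B.b k) = 0 := by
              ext m
              have := 𝓜.act_dual (B.b k) m
              rw [hk] at this
              have h2 : (2 : ℚ) • 𝓜.act (B.b k) m = 0 := by
                rw [two_smul]; nth_rw 1 [this]; exact neg_add_cancel _
              simpa using h2
            simp [hk, h3]
          · have e1 : F (u ++ [k]) = f ((u.map fun i => TensorAlgebra.ι ℚ (B.b i)).prod *
                TensorAlgebra.ι ℚ (B.b k)) := by
              rw [← hf]; simp
            ext m
            have h3 := hend u k m hk
            rw [StraighteningData.resEnd, e1, ← hf u] at h3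
            change _ - 1 / 2 * f _ (𝓜.act (B.b k) m) = 0 at h3
            simp only [LinearMap.comp_apply, LinearMap.sub_apply, LinearMap.id_apply, hk,
              sub_neg_eq_add, map_add, LinearMap.mulLeft_apply, LinearMap.add_apply,
              LinearMap.compRight_apply]
            linarith
        exact LinearMap.congr_fun h2 x
      have h2 := LinearMap.congr_fun (LinearMap.congr_fun h1 u) m
      simp only [map_sub, LinearMap.comp_apply, LinearMap.mulRight_apply, mul_sub,
        LinearMap.sub_apply, LinearMap.lcomp_apply] at h2
      exact h2)
  -- Arbitrary factors are reduced to basis vectors one at a time from the left; `u` collects the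
  -- letters already reduced.
  have hlead : ∀ (xs : List L) (u : List s),
      (u.length + xs.length < n → f ((u.map fun i => TensorAlgebra.ι ℚ (B.b i)).prod *
        (xs.map (TensorAlgebra.ι ℚ)).prod) = 0) ∧
      (u.length + xs.length = n → f ((u.map fun i => TensorAlgebra.ι ℚ (B.b i)).prod *
        (xs.map (TensorAlgebra.ι ℚ)).prod) =
          ((u.map fun i => lam (B.b i)).prod * (xs.map lam).prod) • mu) := by
    intro xs
    induction xs with
    | nil =>
      intro u
      simp only [List.map_nil, List.prod_nil, mul_one, List.length_nil, add_zero, hf]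
      exact ⟨hlt u, hn u⟩
    | cons x xs ih =>
      intro u
      simp only [List.map_cons, List.prod_cons, List.length_cons]
      constructor
      · intro hu
        have h1 : f ∘ₗ LinearMap.mulLeft ℚ (u.map fun i => TensorAlgebra.ι ℚ (B.b i)).prod ∘ₗ
            LinearMap.mulRight ℚ (xs.map (TensorAlgebra.ι ℚ)).prod ∘ₗ TensorAlgebra.ι ℚ = 0 := by
          refine B.b.ext fun k => ?_
          have := (ih (u ++ [k])).1 (by simp; omega)
          simpa [mul_assoc] using this
        exact LinearMap.congr_fun h1 x
      · intro hu
        have h1 : f ∘ₗ LinearMap.mulLeft ℚ (u.map fun i => TensorAlgebra.ι ℚ (B.b i)).prod ∘ₗ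
            LinearMap.mulRight ℚ (xs.map (TensorAlgebra.ι ℚ)).prod ∘ₗ TensorAlgebra.ι ℚ =
            LinearMap.toSpanSingleton ℚ _
              (((u.map fun i => lam (B.b i)).prod * (xs.map lam).prod) • mu) ∘ₗ lam := by
          refine B.b.ext fun k => ?_
          have := (ih (u ++ [k])).2 (by simp; omega)
          simp only [List.map_append, List.map_cons, List.map_nil, List.prod_append, List.prod_cons,
            List.prod_nil, mul_one, mul_assoc] at this
          simp only [LinearMap.comp_apply, LinearMap.mulLeft_apply, LinearMap.mulRight_apply, this,
            LinearMap.toSpanSingleton_apply, smul_smul]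
          congr 1
          ring
        have h2 := LinearMap.congr_fun h1 x
        simp only [LinearMap.comp_apply, LinearMap.mulLeft_apply, LinearMap.mulRight_apply,
          LinearMap.toSpanSingleton_apply, smul_smul] at h2
        rw [h2]
        congr 1
        ring
  refine ⟨Φ, fun xs m => ⟨fun hx => ?_, fun hx => ?_⟩⟩
  · have := (hlead xs []).1 (by simpa using hx)
    simp only [List.map_nil, List.prod_nil, one_mul] at this
    rw [hΦ, this, LinearMap.zero_apply]
  · have := (hlead xs []).2 (by simpa using hx)
    simp only [List.map_nil, List.prod_nil, one_mul] at this
    rw [hΦ, this, LinearMap.smul_apply, smul_eq_mul]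

end LinearForms

/-! ### The coefficients as series on words -/

lemma val_tot {Γ X : Type*} [AddCommMonoid Γ] [AddCommSemigroup X] (val : AddHom X Γ) (a : X)
    (w : List X) : val (tot a w) = ((a :: w).map val).sum := by
  induction w generalizing a with
  | nil => simp
  | cons b w ih => rw [tot_cons, ih]; simp [add_assoc]

section Bridge

variable {Γ : Type*} [AddCommMonoid Γ] [StarAddMonoid Γ]
  {T T' : Type*} [LinearOrder T] [LinearOrder T'] {X : Type*} [AddCommSemigroup X]

/-- The sum over all compositions of `n`, in terms of the sequence of blocks. -/
def compSum (G : List ℕ → ℚ) (n : ℕ) : ℚ := ∑ c : Composition n, G c.blocks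

lemma compSum_zero (G : List ℕ → ℚ) : compSum G 0 = G [] := by
  have h : ∀ c : Composition 0, c.blocks = [] := fun c => by
    refine List.eq_nil_iff_forall_not_mem.mpr fun b hb => ?_
    have h1 := c.blocks_pos hb
    have h2 := List.single_le_sum (fun _ _ => Nat.zero_le _) b hb
    rw [c.blocks_sum] at h2
    omega
  simp [compSum, h, composition_card]

lemma compSum_succ (G : List ℕ → ℚ) (n : ℕ) :
    compSum G (n + 1) =
      ∑ i ∈ Finset.range (n + 1), compSum (fun bs => G ((i + 1) :: bs)) (n - i) := by
  rw [Finset.sum_range]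
  simp only [compSum]
  rw [← Fintype.sum_sigma']
  symm
  refine Fintype.sum_bijective (fun p : Σ i : Fin (n + 1), Composition (n - i) =>
    (⟨(p.1 + 1) :: p.2.blocks, ?_, ?_⟩ : Composition (n + 1))) ⟨?_, ?_⟩ _ _ fun p => rfl
  · intro j hj
    rcases List.mem_cons.mp hj with h | h
    · omega
    · exact p.2.blocks_pos h
  · rw [List.sum_cons, p.2.blocks_sum]
    omega
  · rintro ⟨i, c⟩ ⟨j, d⟩ h
    have h' := congrArg Composition.blocks h
    simp only [List.cons.injEq, Nat.add_right_cancel_iff] at h'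
    obtain rfl := Fin.ext h'.1
    obtain rfl := Composition.ext h'.2
    rfl
  · rintro ⟨_ | ⟨b, bs⟩, h1, h2⟩
    · simp at h2
    · have hb : 0 < b := h1 (by simp)
      rw [List.sum_cons] at h2
      refine ⟨⟨⟨b - 1, by omega⟩, ⟨bs, fun h => h1 (by simp [h]), ?_⟩⟩, ?_⟩
      · simp only; omega
      · refine Composition.ext ?_
        simp only [List.cons.injEq, and_true]
        omega

lemma compSum_congr {G G' : List ℕ → ℚ} {n : ℕ} (h : ∀ bs : List ℕ, bs.sum = n → G bs = G' bs) :
    compSum G n = compSum G' n :=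
  Finset.sum_congr rfl fun c _ => h _ c.blocks_sum

lemma compSum_mul_left (c : ℚ) (G : List ℕ → ℚ) (n : ℕ) :
    compSum (fun bs => c * G bs) n = c * compSum G n := by
  rw [compSum, compSum, Finset.mul_sum]

lemma tv_list_prod {ι : Type*} (P : ι → Prop) (l : List ι) :
    (l.map fun a => tv (P a)).prod = tv (∀ a ∈ l, P a) := by
  induction l with
  | nil => simp [tv]
  | cons a l ih => rw [List.map_cons, List.prod_cons, ih, List.forall_mem_cons, tv_and]

variable (val : AddHom X Γ)

/-- Sums over compositions are block substitutions. -/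
lemma compSum_split (φ G : List Γ → ℚ) (f F : List X → ℚ)
    (hf : ∀ a u, f (a :: u) = φ ((a :: u).map val)) (hF : ∀ u, F u = G (u.map val)) (w : List X) :
    compSum (fun bs => (((w.map val).splitWrtCompositionAux bs).map φ).prod *
      G (((w.map val).splitWrtCompositionAux bs).map List.sum)) w.length = subst f F w := by
  induction w using suffix_induction generalizing F G with
  | nil => simp [compSum_zero, List.splitWrtCompositionAux, hF]
  | cons a w ih =>
    rw [List.length_cons, compSum_succ, subst_cons, splitSum_eq_sum]
    refine Finset.sum_congr rfl fun i hi => ?_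
    have h1 := ih _ _ (List.take_append_drop i w)
      (fun t => G (((a :: w.take i).map val).sum :: t)) (fun t => F (tot a (w.take i) :: t))
      (fun u => by rw [hF, List.map_cons, val_tot])
    rw [hf, ← h1, List.length_drop, ← compSum_mul_left]
    refine compSum_congr fun bs _ => ?_
    simp only [List.splitWrtCompositionAux_cons, List.map_cons, List.prod_cons, List.take_succ_cons,
      List.drop_succ_cons, List.map_take, List.map_drop]
    ring

variable (τ : SDStability Γ T) (τ' : SDStability Γ T')

/-- The slopes of the letters. -/
def slopeOn (x : X) : T := τ.slope (val x)

lemma slopeOn_seeSaw (hne : ∀ x, val x ≠ 0) : SeeSaw (slopeOn val τ) := by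
  intro a b
  have := τ.seesaw (val a) (val b) (hne a) (hne b) (by rw [← map_add]; exact hne _)
  simpa only [slopeOn, map_add] using this

/-- The three cases in the factors of S and S^sd amount to a difference of two indicators. This form
makes their products expandable. -/
lemma ite_eq_tv_sub (p q : Prop) [Decidable p] [Decidable q] (p' q' : Prop) [Decidable p']
    [Decidable q'] (hp : p' ↔ ¬p) (hq : q' ↔ ¬q) :
    (if p ∧ q' then (1 : ℚ) else if p' ∧ q then -1 else 0) = tv p - tv q := by
  by_cases h : p <;> by_cases h' : q <;> simp [tv, hp, hq, h, h']

lemma coeffS_map (hne : ∀ x, val x ≠ 0) (a : X) (w : List X) :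
    coeffS τ τ' ((a :: w).map val) = wordS (slopeOn val τ) (slopeOn val τ') (a :: w) := by
  have key : ∀ (l x : X) (w : List X),
      gapS (slopeOn val τ) (slopeOn val τ') (slopeOn val τ' (tot l w)) l x w =
        ∏ i ∈ Finset.range w.length,
          if τ.slope (((x :: w).map val).getD i 0) > τ.slope ((w.map val).getD i 0) ∧
            τ'.slope (val l + ((w.map val).take i).sum) ≤ τ'.slope ((w.map val).drop i).sum then 1
          else if τ.slope (((x :: w).map val).getD i 0) ≤ τ.slope ((w.map val).getD i 0) ∧
            τ'.slope (val l + ((w.map val).take i).sum) > τ'.slope ((w.map val).drop i).sum then -1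
          else 0 := by
    intro l x w
    induction w generalizing l x with
    | nil => simp [gapS]
    | cons y w ih =>
      rw [gapS, tot_cons, ih, List.length_cons, Finset.prod_range_succ', mul_comm]
      congr 1
      · refine Finset.prod_congr rfl fun i _ => ?_
        simp [add_assoc]
      · rw [ite_eq_tv_sub _ _ _ _ not_lt.symm not_lt.symm]
        -- S compares a prefix with the complementary suffix; the seesaw property turns this into a
        -- comparison with the whole word.
        have := (slopeOn_seeSaw val τ' hne).lt_iff l (tot y w)
        rw [← tot_add] at this
        rw [← this]
        simp [slopeOn, val_tot]
  rw [wordS, key, coeffS]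
  simp

lemma coeffSsd_map (w : List X) :
    coeffSsd τ τ' (w.map val) =
      wordSsd (slopeOn val τ) τ.zero (slopeOn val τ') τ'.zero w := by
  have key : ∀ (l x : X) (w : List X),
      gapSsd (slopeOn val τ) τ.zero (slopeOn val τ') τ'.zero l x w =
        ∏ i ∈ Finset.range (w.length + 1),
          if slopeAt τ ((x :: w).map val) i > slopeAt τ (w.map val) i ∧
            τ'.slope (val l + ((w.map val).take i).sum) ≤ τ'.zero then 1
          else if slopeAt τ ((x :: w).map val) i ≤ slopeAt τ (w.map val) i ∧
            τ'.slope (val l + ((w.map val).take i).sum) > τ'.zero then -1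
          else 0 := by
    intro l x w
    induction w generalizing l x with
    | nil =>
      simp only [gapSsd, List.length_nil, Finset.prod_range_succ, Finset.range_zero,
        Finset.prod_empty, one_mul]
      rw [ite_eq_tv_sub _ _ _ _ not_lt.symm not_lt.symm]
      simp [slopeAt, slopeOn]
    | cons y w ih =>
      rw [gapSsd, ih, List.length_cons, Finset.prod_range_succ' _ (w.length + 1), mul_comm]
      congr 1
      · refine Finset.prod_congr rfl fun i _ => ?_
        simp [slopeAt, add_assoc]
      · rw [ite_eq_tv_sub _ _ _ _ not_lt.symm not_lt.symm]
        simp [slopeOn, slopeAt]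
  cases w with
  | nil => simp [coeffSsd, wordSsd]
  | cons a w =>
    rw [wordSsd, key, coeffSsd, List.length_map, List.length_cons]
    refine Finset.prod_congr rfl fun i _ => ?_
    simp [slopeAt]

/-- The contribution of a block `A` of letters of equal slope. -/
noncomputable def blockWeight (A : List Γ) : ℚ :=
  tv (∀ b ∈ A, τ.slope b = τ.slope A.sum) * (1 / (A.length.factorial : ℚ))

/-- The contribution of a block `B` of sums. -/
noncomputable def blockS (s : T') (B : List Γ) : ℚ := tv (τ'.slope B.sum = s) * coeffS τ τ' B

lemma prod_blockWeight {V : List Γ} {bs : List ℕ} (h : bs.sum = V.length) :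
    ((V.splitWrtCompositionAux bs).map (blockWeight τ)).prod =
      tv (∀ A ∈ V.splitWrtCompositionAux bs, ∀ a ∈ A, τ.slope a = τ.slope A.sum) *
        (bs.map fun k => 1 / (k.factorial : ℚ)).prod := by
  nth_rw 3 [← List.map_length_splitWrtCompositionAux h.le]
  rw [List.map_map, ← tv_list_prod, ← List.prod_map_mul]
  rfl

lemma prod_blockS (s : T') (l : List (List Γ)) :
    (l.map (blockS τ τ' s)).prod =
      tv (∀ B ∈ l, τ'.slope B.sum = s) * (l.map (coeffS τ τ')).prod := by
  rw [← tv_list_prod, ← List.prod_map_mul]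
  rfl

lemma sameSlope_eq_blockWeight (a : X) (u : List X) :
    sameSlope (slopeOn val τ) (a :: u) = blockWeight τ ((a :: u).map val) := by
  simp only [sameSlope, blockWeight, List.forall_mem_map, ← val_tot]
  simp [expCoeff, slopeOn]

lemma restrict_eq_blockS (hne : ∀ x, val x ≠ 0) (s : T') (a : X) (u : List X) :
    restrict (slopeOn val τ') s (wordS (slopeOn val τ) (slopeOn val τ')) (a :: u) =
      blockS τ τ' s ((a :: u).map val) := by
  rw [restrict, blockS, coeffS_map val τ τ' hne, ← val_tot]
  rfl

lemma coeffU_map (hne : ∀ x, val x ≠ 0) (a : X) (w : List X) :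
    coeffU τ τ' ((a :: w).map val) = wordU (slopeOn val τ) (slopeOn val τ') (a :: w) := by
  set s := slopeOn val τ' (tot a w) with hs
  have h1 : wordU (slopeOn val τ) (slopeOn val τ') (a :: w) = subst (sameSlope (slopeOn val τ))
      (subst (restrict (slopeOn val τ') s (wordS (slopeOn val τ) (slopeOn val τ')))
        (lenSeries X logCoeff)) (a :: w) := by
    rw [wordU, subst_of_tot (H := fun x => subst (restrict (slopeOn val τ') (slopeOn val τ' x)
      (wordS (slopeOn val τ) (slopeOn val τ'))) (lenSeries X logCoeff)) (fun b v => rfl)]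
  have h2 := compSum_split val (blockS τ τ' s) (lenSeries Γ logCoeff) _ (lenSeries X logCoeff)
    (restrict_eq_blockS val τ τ' hne s) (fun u => by simp [lenSeries])
  rw [h1, ← compSum_split val _ (fun b => compSum (fun ds => ((b.splitWrtCompositionAux ds).map
    (blockS τ τ' s)).prod * lenSeries Γ logCoeff ((b.splitWrtCompositionAux ds).map List.sum))
    b.length) _ _ (sameSlope_eq_blockWeight val τ) (fun u => by rw [← h2, List.length_map])]
  set V := (a :: w).map val with hV
  have hs' : s = τ'.slope V.sum := by rw [hs, slopeOn, val_tot]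
  have hlen : (a :: w).length = V.length := (List.length_map _).symm
  rw [hlen]
  change compSum (fun bs => compSum (fun ds =>
    if (∀ A ∈ V.splitWrtCompositionAux bs, ∀ a ∈ A, τ.slope a = τ.slope A.sum) ∧
        (∀ B ∈ ((V.splitWrtCompositionAux bs).map List.sum).splitWrtCompositionAux ds,
          τ'.slope B.sum = τ'.slope V.sum) then
      logCoeff ds.length *
        ((((V.splitWrtCompositionAux bs).map List.sum).splitWrtCompositionAux ds).map
          (coeffS τ τ')).prod *
        (bs.map fun k => 1 / (k.factorial : ℚ)).prod
    else 0) bs.length) V.length = _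
  refine compSum_congr fun bs hbs => ?_
  rw [List.length_map, List.length_splitWrtCompositionAux, ← compSum_mul_left]
  refine compSum_congr fun ds _ => ?_
  rw [prod_blockWeight τ hbs, prod_blockS, ← hs', lenSeries, List.length_map,
    List.length_splitWrtCompositionAux]
  split_ifs with h
  · rw [tv_true h.1, tv_true h.2]; ring
  · rcases not_and_or.mp h with h | h <;> rw [tv_false h] <;> ring

lemma binomNegHalf_eq (l : ℕ) : binomNegHalf l = genBinom (-1 / 2) l := rfl

lemma zeroSlope_map (w : List X) : zeroSlope (slopeOn val τ) τ.zero w =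
    tv (∀ a ∈ w.map val, τ.slope a = τ.zero) * (1 / (2 ^ w.length * (w.length.factorial : ℚ))) := by
  simp only [zeroSlope, List.forall_mem_map, expCoeff, slopeOn]
  congr 1
  rw [div_pow, one_pow, div_div]

lemma coeffUsd_map (hne : ∀ x, val x ≠ 0) (w : List X) :
    coeffUsd τ τ' (w.map val) =
      wordUsd (slopeOn val τ) τ.zero (slopeOn val τ') τ'.zero w := by
  have h2 := compSum_split val (blockS τ τ' τ'.zero) (lenSeries Γ binomNegHalf) _
    (lenSeries X (genBinom (-1 / 2)))
    (restrict_eq_blockS val τ τ' hne τ'.zero) (fun u => by simp [lenSeries, binomNegHalf_eq])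
  have h3 : ∀ u : List X, conv (subst (restrict (slopeOn val τ') τ'.zero
        (wordS (slopeOn val τ) (slopeOn val τ'))) (lenSeries X (genBinom (-1 / 2))))
        (wordSsd (slopeOn val τ) τ.zero (slopeOn val τ') τ'.zero) u =
      splitSum (fun b c => compSum (fun ds => ((b.splitWrtCompositionAux ds).map
        (blockS τ τ' τ'.zero)).prod * lenSeries Γ binomNegHalf
          ((b.splitWrtCompositionAux ds).map List.sum)) b.length * coeffSsd τ τ' c)
        (u.map val) := by
    intro u
    rw [conv, splitSum_eq_sum, splitSum_eq_sum, List.length_map]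
    refine Finset.sum_congr rfl fun i _ => ?_
    rw [← h2, ← coeffSsd_map, List.map_take, List.map_drop, List.length_take, List.length_take,
      List.length_map]
  rw [wordUsd, conv, splitSum_eq_sum]
  set V := w.map val with hV
  have hlen : w.length = V.length := (List.length_map _).symm
  rw [hlen]
  change (∑ p ∈ Finset.range (V.length + 1), compSum (fun bs =>
    ∑ q ∈ Finset.range (bs.length + 1), compSum (fun ds =>
      if (∀ A ∈ (V.take p).splitWrtCompositionAux bs, ∀ a ∈ A, τ.slope a = τ.slope A.sum) ∧
          (∀ a ∈ V.drop p, τ.slope a = τ.zero) ∧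
          (∀ B ∈ ((((V.take p).splitWrtCompositionAux bs).map List.sum).take
            q).splitWrtCompositionAux ds, τ'.slope B.sum = τ'.zero) then
        binomNegHalf ds.length *
          ((((((V.take p).splitWrtCompositionAux bs).map List.sum).take
            q).splitWrtCompositionAux ds).map (coeffS τ τ')).prod *
          coeffSsd τ τ' ((((V.take p).splitWrtCompositionAux bs).map List.sum).drop q) *
          (bs.map fun k => 1 / (k.factorial : ℚ)).prod *
          (1 / (2 ^ (V.length - p) * ((V.length - p).factorial : ℚ)))
      else 0) q) p) = _
  refine Finset.sum_congr rfl fun p hp => ?_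
  have hp' : p ≤ w.length := by rw [hlen]; exact Nat.lt_succ_iff.mp (Finset.mem_range.mp hp)
  rw [← compSum_split val _ _ _ _ (sameSlope_eq_blockWeight val τ) h3, zeroSlope_map,
    List.map_take, List.map_drop, ← hV, List.length_take_of_le hp', mul_comm (compSum _ _),
    ← compSum_mul_left]
  refine compSum_congr fun bs hbs => ?_
  have hbl : (((V.take p).splitWrtCompositionAux bs).map List.sum).length = bs.length := by
    rw [List.length_map, List.length_splitWrtCompositionAux]
  rw [splitSum_eq_sum, hbl, Finset.mul_sum, Finset.mul_sum]
  refine Finset.sum_congr rfl fun q hq => ?_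
  have hq' := Nat.lt_succ_iff.mp (Finset.mem_range.mp hq)
  rw [List.length_take_of_le (hbl ▸ hq'), mul_comm (compSum _ _), ← compSum_mul_left,
    ← compSum_mul_left, ← compSum_mul_left]
  refine compSum_congr fun ds _ => ?_
  rw [prod_blockWeight τ (by rw [hbs, List.length_take_of_le (hlen ▸ hp')]), prod_blockS, lenSeries,
    List.length_map (f := List.sum), List.length_splitWrtCompositionAux, List.length_drop, hlen]
  split_ifs with h
  · rw [tv_true h.1, tv_true h.2.1, tv_true h.2.2]; ring
  · rcases not_and_or.mp h with h | h
    · rw [tv_false h]; ring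
    · rcases not_and_or.mp h with h | h <;> rw [tv_false h] <;> ring

end Bridge

/-! ### Expansion of products of sums over words -/

section FiniteSums

variable {ι κ V : Type*} [AddCommMonoid V]

lemma finsum_eq_finsum_fiber (g : ι → κ) (t : ι → V) (h : (Function.support t).Finite) :
    ∑ᶠ i, t i = ∑ᶠ k, ∑ᶠ i ∈ {i | g i = k}, t i := by
  classical
  have h1 : ∀ k, ∑ᶠ i ∈ {i | g i = k}, t i = ∑ i ∈ h.toFinset with g i = k, t i := fun k =>
    finsum_mem_eq_sum_filter t {i | g i = k} h
  simp only [h1]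
  rw [finsum_eq_sum t h, finsum_eq_sum_of_support_subset (s := h.toFinset.image g),
    Finset.sum_fiberwise_of_maps_to fun i hi => Finset.mem_image_of_mem g hi]
  intro k hk
  obtain ⟨i, hi, -⟩ := Finset.exists_ne_zero_of_sum_ne_zero hk
  rw [Finset.mem_filter] at hi
  exact Finset.mem_coe.mpr (Finset.mem_image.mpr ⟨i, hi⟩)

lemma finsum_smul_finsum {R W : Type*} [Semiring R] [AddCommMonoid W] [Module R W] (a : ι → R)
    (b : κ → W) (ha : (Function.support a).Finite) (hb : (Function.support b).Finite) :
    (∑ᶠ i, a i) • ∑ᶠ k, b k = ∑ᶠ p : ι × κ, a p.1 • b p.2 := by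
  rw [finsum_eq_sum a ha, finsum_eq_sum b hb, Finset.sum_smul_sum,
    finsum_eq_sum_of_support_subset (s := ha.toFinset ×ˢ hb.toFinset), Finset.sum_product]
  intro p hp
  simp only [Finset.coe_product, Set.Finite.coe_toFinset, Set.mem_prod, Function.mem_support]
  exact ⟨fun h => hp (by simp [h]), fun h => hp (by simp [h])⟩

lemma finsum_append {X : Type*} (B : List X → List X → V) (w : List X) :
    ∑ᶠ q ∈ {q : List X × List X | q.1 ++ q.2 = w}, B q.1 q.2 = splitSum B w := by
  have h : {q : List X × List X | q.1 ++ q.2 = w} =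
      (fun i => (w.take i, w.drop i)) '' (Finset.range (w.length + 1) : Set ℕ) := by
    ext ⟨u, v⟩
    simp only [Set.mem_ofPred_eq, Set.mem_image, Finset.coe_range, Set.mem_Iio, Prod.mk.injEq]
    constructor
    · rintro rfl
      exact ⟨u.length, by simp⟩
    · rintro ⟨i, -, rfl, rfl⟩
      exact List.take_append_drop i w
  rw [h, finsum_mem_image, finsum_mem_coe_finset, splitSum_eq_sum]
  intro i hi j hj hij
  simp only [Finset.coe_range, Set.mem_Iio] at hi hj
  have := congrArg (fun q : List X × List X => q.1.length) hij
  simp only [List.length_take] at this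
  omega

lemma splitSum_smul_const {X W : Type*} [AddCommGroup W] [Module ℚ W] (B : List X → List X → ℚ)
    (z : W) (w : List X) : splitSum (fun u v => B u v • z) w = splitSum B w • z := by
  simp only [splitSum_eq_sum, Finset.sum_smul]

end FiniteSums

section Words

variable {X Θ R V : Type*} [Ring R] [AddCommGroup V] [Module R V] (x : X → R) (m : Θ → V)

/-- The element `x_{α₁} ⋯ x_{αₙ} m_ρ`. -/
def mon (p : List X × Θ) : V := (p.1.map x).prod • m p.2

lemma mon_append (u v : List X) (ρ : Θ) : mon x m (u ++ v, ρ) = (u.map x).prod • mon x m (v, ρ) := by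
  simp [mon, mul_smul]

lemma forall_ne_zero_of_prod_ne_zero {w : List X} (h : (w.map x).prod ≠ 0) : ∀ a ∈ w, x a ≠ 0 :=
  fun a ha h0 => h (List.prod_eq_zero (List.mem_map.mpr ⟨a, ha, h0⟩))

end Words

/-! ### Words in letters that are themselves sums of words -/

section Expansion

variable {X : Type*} [AddCommSemigroup X]

open Classical in
/-- The series consisting of a single word. -/
noncomputable def single (v w : List X) : ℚ := if w = v then 1 else 0

open Classical in
lemma subst_finset_sum {ι : Type*} (f : List X → ℚ) (s : Finset ι) (F : ι → List X → ℚ)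
    (w : List X) : subst f (fun t => ∑ i ∈ s, F i t) w = ∑ i ∈ s, subst f (F i) w := by
  induction s using Finset.induction_on with
  | empty => simp [subst_zero]
  | insert i s hi ih => simp only [Finset.sum_insert hi, subst_add, ih]

variable {Γ : Type*} [AddCommMonoid Γ] (val : AddHom X Γ)

/-- Only finitely many words arise by block sums from a given word. -/
lemma exists_finset_subst (w : List X) : ∃ D : Finset (List X),
    (∀ v ∈ D, (v.map val).sum = (w.map val).sum) ∧
    ∀ (f F G : List X → ℚ), (∀ v ∈ D, F v = G v) → subst f F w = subst f G w := by
  classical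
  induction w using suffix_induction with
  | nil => exact ⟨{[]}, by simp, fun f F G h => by simpa using h⟩
  | cons a w ih =>
    choose D hD hD' using fun i => ih _ _ (List.take_append_drop i w)
    refine ⟨(Finset.range (w.length + 1)).biUnion fun i =>
      (D i).image fun v => tot a (w.take i) :: v, fun v hv => ?_, fun f F G h => ?_⟩
    · simp only [Finset.mem_biUnion, Finset.mem_image] at hv
      obtain ⟨i, -, v, hv, rfl⟩ := hv
      rw [List.map_cons, List.sum_cons, hD i v hv, val_tot, List.map_cons, List.sum_cons, add_assoc,
        ← List.sum_append, ← List.map_append, List.take_append_drop, ← List.sum_cons,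
        ← List.map_cons]
    · rw [subst_cons, subst_cons, splitSum_eq_sum, splitSum_eq_sum]
      refine Finset.sum_congr rfl fun i hi => ?_
      rw [hD' i f _ (fun t => G (tot a (w.take i) :: t)) fun v hv => h _ ?_]
      exact Finset.mem_biUnion.mpr ⟨i, hi, Finset.mem_image_of_mem _ hv⟩

/-- Substitution as a finite sum over the words for block sums. -/
lemma exists_finset_subst_eq_sum (w : List X) : ∃ D : Finset (List X),
    (∀ v ∈ D, (v.map val).sum = (w.map val).sum) ∧
    ∀ f : List X → ℚ, (∀ v ∉ D, subst f (single v) w = 0) ∧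
      ∀ F : List X → ℚ, subst f F w = ∑ v ∈ D, F v * subst f (single v) w := by
  classical
  obtain ⟨D, hD, hD'⟩ := exists_finset_subst val w
  refine ⟨D, hD, fun f => ⟨fun v hv => ?_, fun F => ?_⟩⟩
  · rw [hD' f (single v) (fun _ => 0), subst_zero]
    intro u hu
    rw [single, if_neg]
    rintro rfl
    exact hv hu
  · simp only [← subst_mul_left, ← subst_finset_sum]
    refine hD' f _ _ fun v hv => ?_
    rw [Finset.sum_eq_single v (fun u _ hu => by rw [single, if_neg hu.symm, mul_zero])
      (fun h => absurd hv h), single, if_pos rfl, mul_one]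

lemma subst_single_eq_zero (f : List X → ℚ) {v w : List X}
    (h : (v.map val).sum ≠ (w.map val).sum) : subst f (single v) w = 0 := by
  obtain ⟨D, hD, hD'⟩ := exists_finset_subst_eq_sum val w
  exact (hD' f).1 v fun hv => h (hD v hv)

lemma subst_single_nil (f : List X → ℚ) : subst f (single []) = oneSeries :=
  subst_oneSeries f

open Classical in
/-- The part of a series consisting of the non-empty words with sum `α`. -/
noncomputable def partOf (f : List X → ℚ) (α : X) : List X → ℚ
  | [] => 0
  | a :: u => if tot a u = α then f (a :: u) else 0

/-- The first block is exactly one whose sum is α, so prepending the letter α multiplies the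
expansion by the part of `f` of sum α. -/
lemma subst_single_cons (f : List X → ℚ) (α : X) (v w : List X) :
    subst f (single (α :: v)) w =
      splitSum (fun u w' => partOf f α u * subst f (single v) w') w := by
  classical
  cases w with
  | nil => simp [splitSum, partOf, single]
  | cons a w =>
    rw [subst_cons, splitSum_cons, partOf, zero_mul, zero_add]
    refine splitSum_congr fun u w' _ => ?_
    rw [partOf]
    split_ifs with h
    · congr 2
      funext t
      simp [single, h]
    · rw [zero_mul, show (fun t => single (α :: v) (tot a u :: t)) = fun _ => 0 from
        funext fun t => by simp [single, h], subst_zero, mul_zero]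

variable {Θ : Type*} [AddAction Γ Θ] {R : Type*} [Ring R] [Algebra ℚ R] {V : Type*}
  [AddCommGroup V] [Module ℚ V] [Module R V] [IsScalarTower ℚ R V] (x : X → R) (m : Θ → V)

/-- The sum of all words of class `θ` with coefficients `c`. -/
noncomputable def ev (c : List X → ℚ) (θ : Θ) : V :=
  ∑ᶠ p ∈ {p : List X × Θ | (p.1.map val).sum +ᵥ p.2 = θ}, c p.1 • mon x m p

/-- For each class there are only finitely many words with non-zero letters. -/
def FinitelyManyWords : Prop :=
  ∀ θ : Θ, {p : List X × Θ | (∀ a ∈ p.1, x a ≠ 0) ∧ m p.2 ≠ 0 ∧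
    (p.1.map val).sum +ᵥ p.2 = θ}.Finite

/-- Multiplication of sums of words. -/
lemma finsum_smul_finsum_mon (g : List X → ℚ) (c : List X × Θ → ℚ)
    (hg : (Function.support fun u => g u • (u.map x).prod).Finite)
    (hc : (Function.support fun p => c p • mon x m p).Finite) :
    (∑ᶠ u, g u • (u.map x).prod) • ∑ᶠ p, c p • mon x m p =
      ∑ᶠ p : List X × Θ, splitSum (fun u v => g u * c (v, p.2)) p.1 • mon x m p := by
  rw [finsum_smul_finsum _ _ hg hc, finsum_eq_finsum_fiber
    (fun q : List X × List X × Θ => (q.1 ++ q.2.1, q.2.2))]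
  · refine finsum_congr fun ⟨w, ρ⟩ => ?_
    have h : {q : List X × List X × Θ | (q.1 ++ q.2.1, q.2.2) = (w, ρ)} =
        (fun q : List X × List X => (q.1, q.2, ρ)) '' {q | q.1 ++ q.2 = w} := by
      ext ⟨u, v, ρ'⟩
      simp only [Set.mem_ofPred_eq, Prod.mk.injEq, Set.mem_image, Prod.exists]
      constructor
      · rintro ⟨h, rfl⟩
        exact ⟨u, v, h, rfl, rfl, rfl⟩
      · rintro ⟨u, v, h, rfl, rfl, rfl⟩
        exact ⟨h, rfl⟩
    rw [h, finsum_mem_image (by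
      intro q _ q' _ hq
      simp only [Prod.mk.injEq] at hq
      exact Prod.ext hq.1 hq.2.1), ← splitSum_smul_const, ← finsum_append]
    refine finsum_mem_congr rfl fun q hq => ?_
    obtain ⟨u, v⟩ := q
    obtain rfl : u ++ v = w := hq
    simp only
    rw [mon_append, smul_assoc, ← smul_algebra_smul_comm, smul_smul, smul_algebra_smul_comm]
  · refine (hg.prod hc).subset fun q hq => ⟨fun h => hq ?_, fun h => hq ?_⟩
    · simp only at h
      simp only [h, zero_smul]
    · simp only at h
      simp only [h, smul_zero]

variable {x m}

lemma FinitelyManyWords.finite_support_mon (h : FinitelyManyWords val x m) {c : List X × Θ → ℚ}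
    {θ : Θ} (hc : ∀ p, c p ≠ 0 → (p.1.map val).sum +ᵥ p.2 = θ) :
    (Function.support fun p => c p • mon x m p).Finite := by
  refine (h θ).subset fun p hp => ⟨?_, ?_, hc p fun h0 => hp (by simp [h0])⟩
  · refine forall_ne_zero_of_prod_ne_zero x fun h0 => hp ?_
    simp [mon, h0]
  · intro h0
    exact hp (by simp [mon, h0])

/-- Finiteness is known for words together with an element `m ρ`. One fixed non-zero `m ρ` transfers
it to words in the ring. -/
lemma FinitelyManyWords.finite_support_prod (h : FinitelyManyWords val x m) {ρ : Θ} (hρ : m ρ ≠ 0)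
    {g : List X → ℚ} {α : Γ} (hg : ∀ w, g w ≠ 0 → (w.map val).sum = α) :
    (Function.support fun w => g w • (w.map x).prod).Finite := by
  refine ((h (α +ᵥ ρ)).preimage (f := fun w => (w, ρ)) fun _ _ _ _ h => congrArg Prod.fst h).subset
    fun w hw => ⟨forall_ne_zero_of_prod_ne_zero x fun h0 => hw (by simp [h0]), hρ, ?_⟩
  simp only
  rw [hg w fun h0 => hw (by simp [h0])]

lemma partOf_ne_zero {f : List X → ℚ} {α : X} {w : List X} (h : partOf f α w ≠ 0) :
    (w.map val).sum = val α := by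
  classical
  cases w with
  | nil => exact absurd rfl h
  | cons a u =>
    rw [partOf] at h
    rw [← val_tot, (ite_ne_right_iff.mp h).1]

open Classical in
/-- The coefficients of the expansion of a word. -/
noncomputable def expandCoeff (f f₀ : List X → ℚ) (q p : List X × Θ) : ℚ :=
  splitSum (fun u w => subst f (single q.1) u *
    if (w.map val).sum +ᵥ p.2 = q.2 then f₀ w else 0) p.1

lemma expandCoeff_ne_zero {f f₀ : List X → ℚ} {q p : List X × Θ}
    (h : expandCoeff val f f₀ q p ≠ 0) :
    (p.1.map val).sum +ᵥ p.2 = (q.1.map val).sum +ᵥ q.2 := by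
  by_contra hne
  refine h ((splitSum_congr fun u v huv => ?_).trans (splitSum_zero p.1))
  by_cases h1 : (q.1.map val).sum = (u.map val).sum
  · rw [if_neg, mul_zero]
    intro h2
    exact hne (by rw [← huv, List.map_append, List.sum_append, add_vadd, h2, h1])
  · rw [subst_single_eq_zero val f h1, zero_mul]

/-- For a fixed target word `p` only finitely many words `q` contribute, since `q` consists of block
sums of a prefix of `p` together with the class of the remaining part. -/
lemma exists_finset_expandCoeff (f f₀ : List X → ℚ) (p : List X × Θ) :
    ∃ K : Finset (List X × Θ), (∀ q ∉ K, expandCoeff val f f₀ q p = 0) ∧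
      ∀ F : List X → ℚ, ∑ q ∈ K, F q.1 * expandCoeff val f f₀ q p = conv (subst f F) f₀ p.1 := by
  classical
  choose D hD hD' using fun i => exists_finset_subst_eq_sum val (p.1.take i)
  let ρ (i : ℕ) : Θ := ((p.1.drop i).map val).sum +ᵥ p.2
  let K := (Finset.range (p.1.length + 1)).biUnion fun i => D i ×ˢ {ρ i}
  have h0 : ∀ i, ∀ q ∉ D i ×ˢ {ρ i}, subst f (single q.1) (p.1.take i) *
      (if ρ i = q.2 then f₀ (p.1.drop i) else 0) = 0 := by
    intro i q hq
    by_cases h1 : q.1 ∈ D i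
    · rw [if_neg, mul_zero]
      rintro h2
      exact hq (Finset.mem_product.mpr ⟨h1, Finset.mem_singleton.mpr h2.symm⟩)
    · rw [(hD' i f).1 _ h1, zero_mul]
  refine ⟨K, fun q hq => ?_, fun F => ?_⟩
  · rw [expandCoeff, splitSum_eq_sum]
    exact Finset.sum_eq_zero fun i hi => h0 i q fun h => hq (Finset.mem_biUnion.mpr ⟨i, hi, h⟩)
  · simp only [expandCoeff, splitSum_eq_sum, Finset.mul_sum, conv]
    rw [Finset.sum_comm]
    refine Finset.sum_congr rfl fun i hi => ?_
    rw [← Finset.sum_subset (s₁ := D i ×ˢ {ρ i})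
      (fun q hq => Finset.mem_biUnion.mpr ⟨i, hi, hq⟩)
      (fun q _ hq => by rw [h0 i q hq, mul_zero]), Finset.sum_product, (hD' i f).2 F,
      Finset.sum_mul]
    refine Finset.sum_congr rfl fun v _ => ?_
    rw [Finset.sum_singleton, if_pos rfl, mul_assoc]

lemma ev_eq_finsum_ite [DecidableEq Θ] (c : List X → ℚ) (θ : Θ) : ev val x m c θ =
    ∑ᶠ p : List X × Θ, (if (p.1.map val).sum +ᵥ p.2 = θ then c p.1 else 0) • mon x m p := by
  rw [ev, finsum_mem_def]
  refine finsum_congr fun p => ?_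
  by_cases h : (p.1.map val).sum +ᵥ p.2 = θ <;> simp [Set.indicator, h]

lemma ev_of_forall_eq_zero (hm : ∀ ρ, m ρ = 0) (c : List X → ℚ) (θ : Θ) : ev val x m c θ = 0 := by
  rw [ev, finsum_mem_eq_zero_of_forall_eq_zero]
  intro p _
  simp [mon, hm]

variable {f f₀ : List X → ℚ} {A : X → R} {B : Θ → V}

lemma mon_expand (h : FinitelyManyWords val x m) {ρ : Θ} (hρ : m ρ ≠ 0)
    (hA : ∀ α, A α = ∑ᶠ w, partOf f α w • (w.map x).prod) (hB : ∀ ρ, B ρ = ev val x m f₀ ρ)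
    (q : List X × Θ) : mon A B q = ∑ᶠ p, expandCoeff val f f₀ q p • mon x m p := by
  classical
  obtain ⟨v, ρ'⟩ := q
  induction v with
  | nil =>
    rw [mon, List.map_nil, List.prod_nil, one_smul, hB, ev_eq_finsum_ite]
    refine finsum_congr fun p => ?_
    rw [expandCoeff]
    simp only [subst_single_nil]
    rw [splitSum_nil_left]
    · simp [oneSeries]
    · intro a u v
      simp [oneSeries]
  | cons α v ih =>
    have h1 : mon A B (α :: v, ρ') = A α • mon A B (v, ρ') := by simp [mon, mul_smul]
    rw [h1, ih, hA, finsum_smul_finsum_mon _ _ _ _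
      (h.finite_support_prod val hρ fun w => partOf_ne_zero val)
      (h.finite_support_mon val fun p => expandCoeff_ne_zero val)]
    refine finsum_congr fun p => ?_
    congr 1
    simp only [expandCoeff, subst_single_cons, ← splitSum_mul_left, ← splitSum_mul_right, mul_assoc]
    rw [splitSum_assoc (fun a b c => partOf f α a * (subst f (single v) b *
      if (c.map val).sum +ᵥ p.2 = ρ' then f₀ c else 0))]

/-- Sums of words in letters that are themselves sums of words. -/
theorem ev_expand (h : FinitelyManyWords val x m)
    (hA : ∀ ρ, m ρ ≠ 0 → ∀ α, A α = ∑ᶠ w, partOf f α w • (w.map x).prod)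
    (hB : ∀ ρ, B ρ = ev val x m f₀ ρ)
    (F : List X → ℚ) (θ : Θ) : ev val A B F θ = ev val x m (conv (subst f F) f₀) θ := by
  classical
  -- If all `m ρ` vanish, both sides are zero; otherwise some `m ρ` is non-zero and `hA` can be
  -- used.
  by_cases hm : ∀ ρ, m ρ = 0
  · have hB0 : ∀ ρ, B ρ = 0 := fun ρ => (hB ρ).trans (ev_of_forall_eq_zero val hm _ _)
    rw [ev_of_forall_eq_zero val hm, ev_of_forall_eq_zero val hB0]
  push Not at hm
  obtain ⟨ρ, hρ⟩ := hm
  set S := (h θ).toFinset with hS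
  have hsum : ∀ c : List X × Θ → ℚ, (∀ p, c p ≠ 0 → (p.1.map val).sum +ᵥ p.2 = θ) →
      ∑ᶠ p, c p • mon x m p = ∑ p ∈ S, c p • mon x m p := by
    intro c hc
    refine finsum_eq_sum_of_support_subset _ fun p hp => ?_
    rw [hS, Set.Finite.coe_toFinset]
    refine ⟨?_, ?_, hc p fun h0 => hp (by simp [h0])⟩
    · refine forall_ne_zero_of_prod_ne_zero x fun h0 => hp ?_
      simp [mon, h0]
    · intro h0
      exact hp (by simp [mon, h0])
  rw [ev_eq_finsum_ite val (m := m), hsum _ (fun p hp => (ite_ne_right_iff.mp hp).1),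
    ev_eq_finsum_ite]
  choose K hK hK' using fun p : List X × Θ => exists_finset_expandCoeff val f f₀ p
  have h1 : ∀ q : List X × Θ,
      (if (q.1.map val).sum +ᵥ q.2 = θ then F q.1 else 0) • mon A B q =
      ∑ p ∈ S, ((if (q.1.map val).sum +ᵥ q.2 = θ then F q.1 else 0) *
        expandCoeff val f f₀ q p) • mon x m p := by
    intro q
    split_ifs with hq
    · rw [mon_expand val h hρ (hA ρ hρ) hB, hsum _ fun p hp => (expandCoeff_ne_zero val hp).trans hq,
        Finset.smul_sum]
      simp only [smul_smul]
    · simp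
  simp only [h1]
  -- The interchange is legitimate because `S` is finite and each `p` in it is reached from the
  -- finite set `K p` only.
  rw [finsum_sum_comm]
  · refine Finset.sum_congr rfl fun p hp => ?_
    have hpθ : (p.1.map val).sum +ᵥ p.2 = θ := by
      rw [hS, Set.Finite.mem_toFinset] at hp
      exact hp.2.2
    rw [if_pos hpθ, ← hK' p F, Finset.sum_smul, finsum_eq_sum_of_support_subset (s := K p)]
    · refine Finset.sum_congr rfl fun q _ => ?_
      by_cases h0 : expandCoeff val f f₀ q p = 0
      · rw [h0]; simp
      · rw [if_pos ((expandCoeff_ne_zero val h0).symm.trans hpθ)]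
    · intro q hq
      by_contra h0
      exact hq (by simp [hK p q h0])
  · intro p _
    refine (K p).finite_toSet.subset fun q hq => ?_
    by_contra h0
    exact hq (by simp [hK p q h0])

end Expansion

/-! ### Finiteness of the set of words -/

section Finiteness

open Module

lemma exists_linearMap_of_iSupIndep {ι W U : Type*} [AddCommGroup W] [Module ℚ W] [AddCommGroup U]
    [Module ℚ U] (p : ι → Submodule ℚ W) (hp : iSupIndep p) (htop : ⨆ i, p i = ⊤)
    (φ : ∀ i, p i →ₗ[ℚ] U) : ∃ f : W →ₗ[ℚ] U, ∀ i (x : p i), f x = φ i x := by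
  classical
  have h := DirectSum.isInternal_submodule_of_iSupIndep_of_iSup_eq_top hp htop
  let E := LinearEquiv.ofBijective (DirectSum.coeLinearMap p) h
  refine ⟨DirectSum.toModule ℚ ι U φ ∘ₗ E.symm.toLinearMap, fun i x => ?_⟩
  have h1 : E (DirectSum.lof ℚ ι (fun i => p i) i x) = x := DirectSum.coeLinearMap_lof p i x
  rw [LinearMap.comp_apply, LinearEquiv.coe_coe, ← h1, LinearEquiv.symm_apply_apply,
    DirectSum.toModule_lof]

lemma exists_dual_eq_one {W : Type*} [AddCommGroup W] [Module ℚ W] {x : W} (hx : x ≠ 0) :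
    ∃ φ : W →ₗ[ℚ] ℚ, φ x = 1 := by
  have h := mt (Module.forall_dual_apply_eq_zero_iff ℚ x).mp hx
  push Not at h
  obtain ⟨φ, hφ⟩ := h
  exact ⟨(φ x)⁻¹ • φ, by simp [hφ]⟩

variable {Γ : Type*} [AddCommMonoid Γ] [StarAddMonoid Γ] {L : Type*} [AddCommGroup L] [Module ℚ L]
  {Θ : Type*} [AddAction Γ Θ] {M : Type*} [AddCommGroup M] [Module ℚ M] {𝓛 : InvGradedLie Γ L}
  {𝓜 : TwistedModule 𝓛 Θ M} {T : Type*} [LinearOrder T] (τ : SDStability Γ T) (e : Invariants 𝓜)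

lemma Invariants.ord_dual_ne_zero {α : NZ Γ} (h : e.ord α ≠ 0) : e.ord α.dual ≠ 0 := by
  rw [e.ord_dual]
  intro h0
  apply h
  rw [← 𝓛.dual_dual (e.ord α), h0, map_zero]

/-- The non-zero invariants lie in different summands of degree 0, so one form can take the value 1
on all of them and vanish in other degrees. On L its dual is added to make it invariant. As the
invariants are permuted by duality, the value on each non-zero one becomes 2. -/
lemma Invariants.exists_positive_forms : ∃ (lam : L →ₗ[ℚ] ℚ) (mu : M →ₗ[ℚ] ℚ),
    (∀ α a x, Odd a → x ∈ 𝓛.piece α a → lam x = 0) ∧ (∀ x, lam (𝓛.dual x) = lam x) ∧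
    (∀ α, e.ord α ≠ 0 → 0 < lam (e.ord α)) ∧ (∀ θ, e.sd θ ≠ 0 → 0 < mu (e.sd θ)) := by
  classical
  have h1 : ∀ p : Γ × ℤ, ∃ φ : 𝓛.piece p.1 p.2 →ₗ[ℚ] ℚ, (p.2 ≠ 0 → φ = 0) ∧
      ∀ α : NZ Γ, e.ord α ≠ 0 → ∀ h : e.ord α ∈ 𝓛.piece p.1 p.2, α.1 = p.1 → p.2 = 0 →
        φ ⟨e.ord α, h⟩ = 1 := by
    rintro ⟨α, a⟩
    by_cases h : a = 0 ∧ ∃ h : α ≠ 0, e.ord ⟨α, h⟩ ≠ 0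
    · obtain ⟨rfl, hα, hne⟩ := h
      obtain ⟨φ, hφ⟩ := exists_dual_eq_one
        (x := (⟨e.ord ⟨α, hα⟩, e.ord_mem ⟨α, hα⟩⟩ : 𝓛.piece α 0))
        fun h0 => hne (congrArg Subtype.val h0)
      refine ⟨φ, fun h => absurd rfl h, ?_⟩
      rintro ⟨β, hβ⟩ _ _ h _
      simp only at h
      subst h
      exact hφ
    · refine ⟨0, fun _ => rfl, fun β hβ h' hβα ha => ?_⟩
      simp only at hβα ha
      subst hβα ha
      exact absurd ⟨rfl, β.2, hβ⟩ h
  have h2 : ∀ p : Θ × ℤ, ∃ φ : 𝓜.piece p.1 p.2 →ₗ[ℚ] ℚ,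
      ∀ h : e.sd p.1 ∈ 𝓜.piece p.1 p.2, e.sd p.1 ≠ 0 → φ ⟨e.sd p.1, h⟩ = 1 := by
    rintro ⟨θ, k⟩
    by_cases h : e.sd θ ∈ 𝓜.piece θ k ∧ e.sd θ ≠ 0
    · obtain ⟨φ, hφ⟩ := exists_dual_eq_one (x := (⟨e.sd θ, h.1⟩ : 𝓜.piece θ k))
        fun h0 => h.2 (congrArg Subtype.val h0)
      exact ⟨φ, fun _ _ => hφ⟩
    · exact ⟨0, fun h' h'' => absurd ⟨h', h''⟩ h⟩
  choose φ hφ hφ' using h1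
  choose ψ hψ using h2
  obtain ⟨l, hl⟩ := exists_linearMap_of_iSupIndep _ 𝓛.indep 𝓛.iSup_eq_top φ
  obtain ⟨mu, hmu⟩ := exists_linearMap_of_iSupIndep _ 𝓜.indep 𝓜.iSup_eq_top ψ
  have hl0 : ∀ α a x, Odd a → x ∈ 𝓛.piece α a → l x = 0 := by
    intro α a x ha hx
    have := hl (α, a) ⟨x, hx⟩
    rwa [hφ (α, a) (by rintro rfl; simp at ha)] at this
  have hl1 : ∀ α, e.ord α ≠ 0 → l (e.ord α) = 1 := fun α hα =>
    (hl (α.1, 0) ⟨e.ord α, e.ord_mem α⟩).trans (hφ' (α.1, 0) α hα _ rfl rfl)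
  refine ⟨l + l ∘ₗ 𝓛.dual, mu, ?_, ?_, ?_, ?_⟩
  · intro α a x ha hx
    simp [hl0 α a x ha hx, hl0 _ a _ ha (𝓛.dual_mem hx)]
  · intro x
    simp [𝓛.dual_dual, add_comm]
  · intro α hα
    rw [LinearMap.add_apply, LinearMap.comp_apply, ← e.ord_dual, hl1 α hα,
      hl1 _ (e.ord_dual_ne_zero hα)]
    norm_num
  · intro θ hθ
    rw [hmu (θ, 0) ⟨e.sd θ, e.sd_mem θ⟩, hψ (θ, 0) (e.sd_mem θ) hθ]
    norm_num

/-- The products of the non-zero invariants. -/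
noncomputable abbrev Invariants.word (p : List (NZ Γ) × Θ) : Utw 𝓜 :=
  mon (fun α => Env.of 𝓛 (e.ord α)) (fun ρ => Utw.of 𝓜 (e.sd ρ)) p

/-- Words in non-zero invariants. -/
def Invariants.Good (p : List (NZ Γ) × Θ) : Prop := (∀ α ∈ p.1, e.ord α ≠ 0) ∧ e.sd p.2 ≠ 0

/-- Positive combinations of words. -/
inductive Invariants.Positive : Utw 𝓜 → Prop
  | word (p) (hp : e.Good p) : Positive (e.word p)
  | add (y z) (hy : Positive y) (hz : Positive z) : Positive (y + z)
  | smul (c : ℚ) (z) (hc : 0 < c) (hz : Positive z) : Positive (c • z)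

variable {e}

/-- Let n be the largest length of a word in the combination. The leading form for n vanishes on the
shorter words and is positive on those of length n, so no cancellation is possible. -/
lemma Invariants.Positive.ne_zero {z : Utw 𝓜} (hz : e.Positive z) : z ≠ 0 := by
  obtain ⟨lam, mu, hodd, hdual, hlam, hmu⟩ := e.exists_positive_forms
  choose Φ hΦ using exists_leading_form 𝓜 lam mu hodd hdual
  have key : ∃ n, 0 < Φ n z ∧ ∀ k, n < k → Φ k z = 0 := by
    induction hz with
    | word p hp =>
      have h1 : e.word p = ((p.1.map e.ord).map (Env.of 𝓛)).prod • Utw.of 𝓜 (e.sd p.2) := by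
        rw [List.map_map]; rfl
      refine ⟨p.1.length, ?_, fun k hk => ?_⟩
      · rw [h1, (hΦ p.1.length _ _).2 (by simp)]
        refine mul_pos (List.prod_pos ?_) (hmu _ hp.2)
        intro a ha
        simp only [List.map_map, List.mem_map, Function.comp_apply] at ha
        obtain ⟨α, hα, rfl⟩ := ha
        exact hlam _ (hp.1 α hα)
      · rw [h1, (hΦ k _ _).1 (by simpa using hk)]
    | add y z _ _ hy hz =>
      obtain ⟨n, hn, hn'⟩ := hy
      obtain ⟨k, hk, hk'⟩ := hz
      rcases lt_trichotomy n k with h | rfl | h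
      · exact ⟨k, by rw [map_add, hn' k h, zero_add]; exact hk,
          fun j hj => by rw [map_add, hn' j (h.trans hj), hk' j hj, add_zero]⟩
      · exact ⟨n, by rw [map_add]; exact add_pos hn hk,
          fun j hj => by rw [map_add, hn' j hj, hk' j hj, add_zero]⟩
      · exact ⟨n, by rw [map_add, hk' n h, add_zero]; exact hn,
          fun j hj => by rw [map_add, hn' j hj, hk' j (h.trans hj), add_zero]⟩
    | smul c z hc _ hz =>
      obtain ⟨n, hn, hn'⟩ := hz
      exact ⟨n, by rw [map_smul, smul_eq_mul]; exact mul_pos hc hn,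
        fun j hj => by rw [map_smul, hn' j hj, smul_zero]⟩
  obtain ⟨n, hn, -⟩ := key
  rintro rfl
  simp at hn

lemma Invariants.Positive.prod_smul {z : Utw 𝓜} (hz : e.Positive z) {w : List (NZ Γ)}
    (hw : ∀ α ∈ w, e.ord α ≠ 0) :
    e.Positive ((w.map fun α => Env.of 𝓛 (e.ord α)).prod • z) := by
  induction hz with
  | word p hp =>
    rw [Invariants.word, ← mon_append]
    refine .word _ ⟨fun α hα => ?_, hp.2⟩
    rcases List.mem_append.mp hα with h | h
    · exact hw α h
    · exact hp.1 α h
  | add y z _ _ hy hz => rw [smul_add]; exact .add _ _ hy hz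
  | smul c z hc _ hz => rw [smul_comm]; exact .smul _ _ hc hz

lemma Invariants.Positive.finsum {ι : Type*} {s : Set ι} {t : ι → Utw 𝓜}
    (hfin : {i ∈ s | t i ≠ 0}.Finite) (h : ∀ i ∈ s, t i ≠ 0 → e.Positive (t i)) {i : ι} (hi : i ∈ s)
    (hne : t i ≠ 0) : e.Positive (∑ᶠ i ∈ s, t i) := by
  classical
  have h1 : ∑ᶠ i ∈ s, t i = ∑ i ∈ hfin.toFinset, t i := by
    refine finsum_mem_eq_sum_of_inter_support_eq t ?_
    ext j
    simp
  have h2 : ∀ F : Finset ι, F.Nonempty → (∀ i ∈ F, e.Positive (t i)) → e.Positive (∑ i ∈ F, t i) := by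
    intro F hF
    induction hF using Finset.Nonempty.cons_induction with
    | singleton a => intro h; simpa using h a (by simp)
    | cons a s ha hs ih =>
      intro h
      rw [Finset.sum_cons]
      exact .add _ _ (h a (by simp)) (ih fun i hi => h i (by simp [hi]))
  rw [h1]
  refine h2 _ ⟨i, by simp [hi, hne]⟩ fun j hj => ?_
  rw [Set.Finite.mem_toFinset] at hj
  exact h j hj.1 hj.2

end Finiteness

/-! ### From words in non-zero invariants to non-zero products of δ's -/

section Finiteness

/-- Collect all letters of the largest slope into one block and repeat with the others, until only
slope `z` is left. By the seesaw property the sum of a block has the slope of its letters. That each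
slope of `v` occurs in `w` is recorded so that the next slopes are seen to be smaller. -/
lemma exists_blocks {X Γ T : Type*} [AddCommSemigroup X] [AddCommMonoid Γ] [LinearOrder T]
    (val : AddHom X Γ) {t : X → T} (ht : SeeSaw t) (z : T) (w : List X) (hz : ∀ a ∈ w, z ≤ t a) :
    ∃ (ww : List (List X)) (v w₀ : List X), (ww.flatten ++ w₀).Perm w ∧
      List.Forall₂ (fun u α => (u.map val).sum = val α ∧ ∀ a ∈ u, t a = t α) ww v ∧
      v.Pairwise (fun α β => t α > t β) ∧ (∀ α ∈ v, z < t α ∧ ∃ a ∈ w, t α = t a) ∧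
      ∀ a ∈ w₀, t a = z := by
  classical
  induction h : w.length using Nat.strong_induction_on generalizing w with
  | _ n ih =>
    by_cases h0 : ∀ a ∈ w, t a = z
    · exact ⟨[], [], w, by simp, .nil, .nil, by simp, h0⟩
    push Not at h0
    obtain ⟨a₁, ha₁, hne⟩ := h0
    obtain ⟨a, ha, hmax⟩ := Finset.exists_max_image w.toFinset t ⟨a₁, List.mem_toFinset.mpr ha₁⟩
    rw [List.mem_toFinset] at ha
    have hza : z < t a := ((hz a₁ ha₁).lt_of_ne' hne).trans_le (hmax a₁ (List.mem_toFinset.mpr ha₁))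
    have hperm := List.filter_append_perm (fun b => decide (t b = t a)) w
    have hmem : ∀ b, b ∈ w.filter (fun b => decide (t b = t a)) ↔ b ∈ w ∧ t b = t a := by simp
    have hmem' : ∀ b, b ∈ w.filter (fun b => !decide (t b = t a)) ↔ b ∈ w ∧ t b ≠ t a := by simp
    generalize w.filter (fun b => decide (t b = t a)) = u at hperm hmem
    generalize w.filter (fun b => !decide (t b = t a)) = r at hperm hmem'
    have hau : a ∈ u := (hmem a).mpr ⟨ha, rfl⟩
    have hlen : r.length < n := by
      have h1 := hperm.length_eq
      have h2 := List.length_pos_of_mem hau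
      rw [List.length_append] at h1
      omega
    obtain ⟨ww, v, w₀, h1, h2, h3, h4, h5⟩ := ih _ hlen r (fun b hb => hz b ((hmem' b).mp hb).1) rfl
    obtain ⟨b, u', rfl⟩ := List.exists_cons_of_ne_nil (List.ne_nil_of_mem hau)
    have hslope : t (tot b u') = t a := ht.tot_eq ((hmem b).mp (by simp)).2
      fun c hc => ((hmem c).mp (by simp [hc])).2
    refine ⟨(b :: u') :: ww, tot b u' :: v, w₀, ?_, .cons ⟨(val_tot val b u').symm, ?_⟩ h2,
      .cons ?_ h3, ?_, h5⟩
    · rw [List.flatten_cons, List.append_assoc]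
      exact (h1.append_left _).trans hperm
    · intro c hc
      rw [hslope, ((hmem c).mp hc).2]
    · intro β hβ
      obtain ⟨-, c, hc, hβc⟩ := h4 β hβ
      rw [hslope, hβc]
      exact (hmax c (List.mem_toFinset.mpr ((hmem' c).mp hc).1)).lt_of_ne ((hmem' c).mp hc).2
    · intro α hα
      rcases List.mem_cons.mp hα with rfl | hα
      · exact ⟨by rw [hslope]; exact hza, a, ha, hslope⟩
      · obtain ⟨hα1, c, hc, hc'⟩ := h4 α hα
        exact ⟨hα1, c, ((hmem' c).mp hc).1, hc'⟩

lemma finite_lists_of_finite {X : Type*} {s : Set X} (hs : s.Finite) (n : ℕ) :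
    {w : List X | w.length = n ∧ ∀ a ∈ w, a ∈ s}.Finite := by
  have := hs.to_subtype
  refine ((List.finite_length_eq s n).image (List.map Subtype.val)).subset fun w hw => ?_
  exact ⟨w.attachWith _ hw.2, by simpa using hw.1, by simp⟩

lemma finite_forall₂ {X Y : Type*} (R : X → Y → Prop) (h : ∀ y, {x | R x y}.Finite) (v : List Y) :
    {u : List X | List.Forall₂ R u v}.Finite := by
  induction v with
  | nil => simp
  | cons y v ih =>
    refine (Set.Finite.image2 List.cons (h y) ih).subset fun u hu => ?_
    obtain ⟨a, w, h1, h2, rfl⟩ := List.forall₂_cons_right_iff.mp hu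
    exact ⟨a, h1, w, h2, rfl⟩

variable {Γ : Type*} [AddCommMonoid Γ] [StarAddMonoid Γ] {L : Type*} [AddCommGroup L] [Module ℚ L]
  {Θ : Type*} [AddAction Γ Θ] {M : Type*} [AddCommGroup M] [Module ℚ M] {𝓛 : InvGradedLie Γ L}
  {𝓜 : TwistedModule 𝓛 Θ M} {T : Type*} [LinearOrder T] {τ : SDStability Γ T} {e : Invariants 𝓜}

lemma forall_ord_ne_zero {w : List (NZ Γ)} (h : (w.map fun α => Env.of 𝓛 (e.ord α)).prod ≠ 0) :
    ∀ α ∈ w, e.ord α ≠ 0 := fun α hα h0 =>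
  forall_ne_zero_of_prod_ne_zero (fun α => Env.of 𝓛 (e.ord α)) h α hα (by simp only [h0, map_zero])

lemma Utw.of_zero : Utw.of 𝓜 0 = 0 := by
  rw [Utw.of, TensorProduct.tmul_zero, map_zero]

lemma good_of_word_ne_zero {p : List (NZ Γ) × Θ} (h : e.word p ≠ 0) : e.Good p := by
  refine ⟨forall_ord_ne_zero fun h0 => h ?_, fun h0 => h ?_⟩
  · rw [Invariants.word, mon, h0, zero_smul]
  · rw [Invariants.word, mon, h0, Utw.of_zero, smul_zero]

lemma delta_smul_positive (hδ : DeltaFinite τ e) {z : Utw 𝓜} (hz : e.Positive z) {α : NZ Γ}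
    {u : List (NZ Γ)} (hu : u ∈ deltaIndex τ α) (hu' : ∀ β ∈ u, e.ord β ≠ 0) :
    e.Positive (delta τ e α • z) := by
  have h1 : delta τ e α • z = ∑ᶠ w ∈ deltaIndex τ α, deltaTerm e w • z :=
    ((smulAddHom (Env 𝓛) (Utw 𝓜)).flip z).map_finsum_mem' (hδ.1 α)
  have h2 : ∀ w : List (NZ Γ), (∀ β ∈ w, e.ord β ≠ 0) → e.Positive (deltaTerm e w • z) := by
    intro w hw
    rw [deltaTerm, smul_assoc]
    exact .smul _ _ (by positivity) (hz.prod_smul hw)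
  rw [h1]
  refine Invariants.Positive.finsum ((hδ.1 α).subset fun w hw => ⟨hw.1, fun h0 => hw.2 ?_⟩)
    (fun w _ hw => h2 w (forall_ord_ne_zero fun h0 => hw ?_)) hu (h2 u hu').ne_zero
  · rw [h0, zero_smul]
  · rw [deltaTerm, h0, smul_zero, zero_smul]

lemma deltaSdTerm_positive {p : List (NZ Γ) × Θ} (hp : e.Good p) :
    e.Positive (deltaSdTerm e p) :=
  .smul _ _ (by positivity) (.word p hp)

lemma good_of_deltaSdTerm_ne_zero {p : List (NZ Γ) × Θ} (h : deltaSdTerm e p ≠ 0) : e.Good p := by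
  refine good_of_word_ne_zero fun h0 => h ?_
  have h1 : (p.1.map fun β => Env.of 𝓛 (e.ord β)).prod • Utw.of 𝓜 (e.sd p.2) = 0 := h0
  rw [deltaSdTerm, h1, smul_zero]

lemma deltaSd_positive (hδ : DeltaFinite τ e) {θ : Θ} {p : List (NZ Γ) × Θ}
    (hp : p ∈ deltaSdIndex τ θ) (hp' : e.Good p) : e.Positive (deltaSd τ e θ) :=
  Invariants.Positive.finsum (hδ.2 θ)
    (fun _ _ hq => deltaSdTerm_positive (good_of_deltaSdTerm_ne_zero hq)) hp
    (deltaSdTerm_positive hp').ne_zero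

lemma mem_ksIndex {θ : Θ} {p : List (NZ Γ) × Θ} : p ∈ ksIndex τ θ ↔
    p.1.Pairwise (fun α β : NZ Γ => τ.slope α.1 > τ.slope β.1) ∧
      (∀ α ∈ p.1, τ.slope α.1 > τ.zero) ∧ total p.1 +ᵥ p.2 = θ := by
  -- In `ksIndex` the descending condition is imposed on the word coerced letterwise to `Γ`; here
  -- that word is identified as a map.
  have h : (do let a ← p.1; pure a.1 : List Γ) = p.1.map Subtype.val := by
    simp [List.map_eq_flatMap]
  rw [ksIndex, Set.mem_ofPred_eq, h, List.pairwise_map]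

lemma ksTerm_positive (hδ : DeltaFinite τ e) {ww : List (List (NZ Γ))} {v : List (NZ Γ)}
    (hw : List.Forall₂ (fun u α => u ∈ deltaIndex τ α ∧ ∀ β ∈ u, e.ord β ≠ 0) ww v) {θ : Θ}
    {p : List (NZ Γ) × Θ} (hp : p ∈ deltaSdIndex τ θ) (hp' : e.Good p) :
    e.Positive (ksTerm τ e (v, θ)) := by
  induction hw with
  | nil => simpa [ksTerm] using deltaSd_positive hδ hp hp'
  | cons h _ ih =>
    have := delta_smul_positive hδ ih h.1 h.2
    simpa [ksTerm, mul_smul] using this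

/-- Applied to a non-zero ε^sd_ρ, each such term of δ_α is a positive multiple of a word in non-zero
invariants. It is therefore non-zero, and `hδ` allows only finitely many. -/
lemma finite_deltaIndex (hδ : DeltaFinite τ e) {ρ : Θ} (hρ : e.sd ρ ≠ 0) (α : NZ Γ) :
    {u | u ∈ deltaIndex τ α ∧ ∀ β ∈ u, e.ord β ≠ 0}.Finite := by
  refine (hδ.1 α).subset fun u hu => ⟨hu.1, fun h0 => ?_⟩
  have h1 : e.Positive (deltaTerm e u • Utw.of 𝓜 (e.sd ρ)) := by
    rw [deltaTerm, smul_assoc]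
    exact .smul _ _ (by positivity) (.word (u, ρ) ⟨hu.2, hρ⟩)
  exact h1.ne_zero (by rw [h0, zero_smul])

/-- For each class there are only finitely many words in non-zero invariants. -/
theorem finitelyManyWords [AddCommSemigroup (NZ Γ)] (val : AddHom (NZ Γ) Γ)
    (hval : ∀ α, val α = α.1) (hbar : ∀ (α : Γ) (θ : Θ), star α +ᵥ θ = α +ᵥ θ)
    (hδ : DeltaFinite τ e) (hfin : KSFinite τ e) :
    FinitelyManyWords val (fun α => Env.of 𝓛 (e.ord α)) (fun ρ => Utw.of 𝓜 (e.sd ρ)) := by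
  classical
  have hval' : ∀ w : List (NZ Γ), (w.map val).sum = total w := fun w => by
    rw [total]; congr 1; exact List.map_congr_left fun α _ => hval α
  have hne : ∀ α, val α ≠ 0 := fun α => by rw [hval]; exact α.2
  have hdual : ∀ α : NZ Γ, α.dual.dual = α := fun α => Subtype.ext (star_star α.1)
  intro θ
  by_cases hsd : ∀ ρ, e.sd ρ = 0
  · refine Set.finite_empty.subset fun p hp => hp.2.1 ?_
    simp only [hsd, Utw.of_zero]
  push Not at hsd
  obtain ⟨ρ₀, hρ₀⟩ := hsd
  -- The words with non-zero letters that occur when the finitely many non-zero products of δ's of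
  -- class θ are expanded.
  have hR : (⋃ p ∈ {p ∈ ksIndex τ θ | ksTerm τ e p ≠ 0}, Set.image2
      (fun (ww : List (List (NZ Γ))) (q : List (NZ Γ) × Θ) => (ww.flatten ++ q.1, q.2))
      {ww | List.Forall₂ (fun u α => u ∈ deltaIndex τ α ∧ ∀ β ∈ u, e.ord β ≠ 0) ww p.1}
      {q | q ∈ deltaSdIndex τ p.2 ∧ e.Good q}).Finite := by
    refine (hfin θ).biUnion fun p _ => Set.Finite.image2 _
      (finite_forall₂ _ (finite_deltaIndex hδ hρ₀) _) ((hδ.2 p.2).subset fun q hq => ⟨hq.1, ?_⟩)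
    exact (deltaSdTerm_positive hq.2).ne_zero
  -- Every word in question becomes one of these by dualising some letters and permuting. So it has
  -- the same length and ρ, and each of its letters or its dual occurs there.
  refine (hR.biUnion fun r _ => (finite_lists_of_finite
    (s := {a | a ∈ r.1 ∨ a.dual ∈ r.1}) ?_ r.1.length).prod (Set.finite_singleton r.2)).subset ?_
  · refine (r.1.finite_toSet.union (r.1.finite_toSet.preimage (f := NZ.dual) ?_)).subset
      fun a ha => ha
    intro a _ b _ h
    rw [← hdual a, h, hdual]
  rintro ⟨w, ρ⟩ ⟨hw, hρ, hθ⟩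
  simp only at hw hρ hθ
  have hw' : ∀ α ∈ w, e.ord α ≠ 0 := fun α hα h0 => hw α hα (by rw [h0, map_zero])
  have hρ' : e.sd ρ ≠ 0 := fun h0 => hρ (by rw [h0, Utw.of_zero])
  -- Letters of negative slope are replaced by their duals, so that all slopes are at least 0; the
  -- class of the word does not change by `hbar`.
  let n (α : NZ Γ) : NZ Γ := if τ.zero ≤ τ.slope α.1 then α else α.dual
  have hn : ∀ α, n α = α ∨ n α = α.dual := fun α => by
    by_cases h : τ.zero ≤ τ.slope α.1 <;> simp [n, h]
  have hn0 : ∀ α, τ.zero ≤ τ.slope (n α).1 := by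
    intro α
    by_cases h : τ.zero ≤ τ.slope α.1
    · simp [n, h]
    · have h1 := τ.neg_le_neg _ _ (not_le.mp h).le
      rw [(τ.neg_eq_self_iff _).mpr rfl] at h1
      have h2 := τ.slope_star (star α.1) (star_ne_zero.mpr α.2)
      rw [star_star] at h2
      simp only [n, h, if_false]
      exact h1.trans_eq h2.symm
  have hnsum : ∀ (w : List (NZ Γ)) (ρ : Θ), total (w.map n) +ᵥ ρ = total w +ᵥ ρ := by
    intro w ρ
    induction w with
    | nil => rfl
    | cons a w ih =>
      simp only [total, List.map_cons, List.sum_cons, add_vadd] at ih ⊢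
      rw [ih]
      rcases hn a with h | h <;> rw [h]
      exact hbar _ _
  obtain ⟨ww, v, w₀, h1, h2, h3, h4, h5⟩ := exists_blocks val (slopeOn_seeSaw val τ hne) τ.zero
    (w.map n) (fun a ha => by
      obtain ⟨b, -, rfl⟩ := List.mem_map.mp ha
      rw [slopeOn, hval]
      exact hn0 b)
  simp only [slopeOn, hval, hval'] at h2 h3 h4 h5
  have hgood : ∀ α ∈ ww.flatten ++ w₀, e.ord α ≠ 0 := by
    intro α hα
    obtain ⟨b, hb, rfl⟩ := List.mem_map.mp (h1.mem_iff.mp hα)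
    rcases hn b with h | h <;> rw [h]
    · exact hw' b hb
    · exact e.ord_dual_ne_zero (hw' b hb)
  have h6 : List.Forall₂ (fun u α => u ∈ deltaIndex τ α ∧ ∀ β ∈ u, e.ord β ≠ 0) ww v := by
    have h7 : ∀ u ∈ ww, ∀ β ∈ u, e.ord β ≠ 0 := fun u hu β hβ =>
      hgood β (List.mem_append_left _ (List.mem_flatten.mpr ⟨u, hu, hβ⟩))
    clear h1 h3 h4 hgood
    induction h2 with
    | nil => exact .nil
    | cons h _ ih =>
      refine .cons ⟨⟨h.1, fun β hβ γ hγ => ?_⟩, h7 _ (by simp)⟩ (ih fun u hu => h7 u (by simp [hu]))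
      rw [h.2 β hβ, h.2 γ hγ]
  have h8 : total v = total ww.flatten := by
    clear h1 h3 h4 hgood h6
    induction h2 with
    | nil => rfl
    | cons h _ ih =>
      simp only [total, List.map_cons, List.sum_cons, List.flatten_cons, List.map_append,
        List.sum_append] at ih h ⊢
      rw [ih, h.1]
  have h9 : e.Good (w₀, ρ) := ⟨fun α hα => hgood α (List.mem_append_right _ hα), hρ'⟩
  have h10 : (w₀, ρ) ∈ deltaSdIndex τ (total w₀ +ᵥ ρ) := ⟨rfl, h5⟩
  have htot : total ww.flatten +ᵥ (total w₀ +ᵥ ρ) = θ := by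
    have h11 : total (ww.flatten ++ w₀) = total (w.map n) := (h1.map _).sum_eq
    rw [← add_vadd, ← hθ, hval', ← hnsum, ← h11]
    simp [total]
  refine Set.mem_biUnion (x := (ww.flatten ++ w₀, ρ)) (Set.mem_biUnion
    (x := (v, total w₀ +ᵥ ρ)) ⟨mem_ksIndex.mpr ⟨h3, fun α hα => (h4 α hα).1, by rw [h8, htot]⟩,
      (ksTerm_positive hδ h6 h10 h9).ne_zero⟩ ⟨ww, h6, (w₀, ρ), ⟨h10, h9⟩, rfl⟩) ⟨⟨?_, ?_⟩, rfl⟩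
  · rw [h1.length_eq, List.length_map]
  · intro a ha
    have h12 := h1.mem_iff.mpr (List.mem_map_of_mem (f := n) ha)
    rcases hn a with h | h <;> rw [h] at h12
    · exact Or.inl h12
    · exact Or.inr h12

end Finiteness

/-! ### Wall-crossing in enveloping algebras -/

section WallCrossing

lemma finsum_eq_of_fiber_eq {ι ι' κ V : Type*} [AddCommMonoid V] {t : ι → V} {t' : ι' → V}
    (g : ι → κ) (g' : ι' → κ) (ht : (Function.support t).Finite)
    (ht' : (Function.support t').Finite)
    (h : ∀ k, ∑ᶠ i ∈ {i | g i = k}, t i = ∑ᶠ i ∈ {i | g' i = k}, t' i) :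
    ∑ᶠ i, t i = ∑ᶠ i, t' i := by
  rw [finsum_eq_finsum_fiber g t ht, finsum_eq_finsum_fiber g' t' ht']
  exact finsum_congr h

variable {Γ : Type*} [AddCommMonoid Γ] [StarAddMonoid Γ] {L : Type*} [AddCommGroup L] [Module ℚ L]
  {Θ : Type*} [AddAction Γ Θ] {M : Type*} [AddCommGroup M] [Module ℚ M] {𝓛 : InvGradedLie Γ L}
  {𝓜 : TwistedModule 𝓛 Θ M} {e : Invariants 𝓜}

lemma Env.of_bracket {α β : Γ} {x y : L} (hx : x ∈ 𝓛.piece α 0) (hy : y ∈ 𝓛.piece β 0) :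
    Env.of 𝓛 (𝓛.bracket x y) = Env.of 𝓛 x * Env.of 𝓛 y - Env.of 𝓛 y * Env.of 𝓛 x := by
  have h : Env.mk 𝓛 _ = Env.mk 𝓛 _ := RingQuot.mkAlgHom_rel ℚ (EnvRel.mk hx hy)
  rw [map_sub, map_mul, map_zsmul, map_mul, mul_zero, Int.negOnePow_zero, Units.val_one,
    one_smul] at h
  exact h.symm

lemma Utw.of_act (x : L) (m : M) :
    (Env.of 𝓛 x - Env.of 𝓛 (𝓛.dual x)) • Utw.of 𝓜 m = Utw.of 𝓜 (𝓜.act x m) := by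
  have h : Env.of 𝓛 x ⊗ₜ[ℚ] m - Env.of 𝓛 (𝓛.dual x) ⊗ₜ[ℚ] m - (1 : Env 𝓛) ⊗ₜ[ℚ] 𝓜.act x m ∈
      twRel 𝓜 := Submodule.subset_span ⟨x, m, rfl⟩
  rw [← twMk_eq_zero_iff, map_sub, map_sub, twMk_tmul, twMk_tmul, twMk_tmul, one_smul,
    sub_eq_zero] at h
  rw [sub_smul, h]

variable (e) in
/-- The homomorphism from the free algebra given by a family of invariants. -/
noncomputable def Invariants.eval : FreeAlgebra ℚ (NZ Γ) →ₐ[ℚ] Env 𝓛 :=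
  FreeAlgebra.lift ℚ fun α => Env.of 𝓛 (e.ord α)

lemma Invariants.eval_prod (w : List (NZ Γ)) :
    e.eval (w.map (FreeAlgebra.ι ℚ)).prod = (w.map fun α => Env.of 𝓛 (e.ord α)).prod := by
  rw [map_list_prod, List.map_map]
  congr 2
  funext α
  simp [Invariants.eval]

lemma freeDual_mul (x y : FreeAlgebra ℚ (NZ Γ)) : freeDual (x * y) = freeDual y * freeDual x := by
  simp [freeDual]

lemma freeDual_sub (x y : FreeAlgebra ℚ (NZ Γ)) : freeDual (x - y) = freeDual x - freeDual y := by
  simp [freeDual]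

/-- All letters have degree 0, so graded brackets are plain commutators. The anti-automorphism
reverses products, which agrees with [x^∨, y^∨] = -[x, y]^∨ by antisymmetry. -/
lemma Invariants.eval_bracket {w : List (NZ Γ)} (hw : w ≠ []) :
    e.eval (freeBracket w) = Env.of 𝓛 (nested (fun x y => 𝓛.bracket x y) (w.map e.ord)) ∧
    e.eval (freeDual (freeBracket w)) =
      Env.of 𝓛 (𝓛.dual (nested (fun x y => 𝓛.bracket x y) (w.map e.ord))) := by
  obtain ⟨α, w, rfl⟩ := List.exists_cons_of_ne_nil hw
  have key : ∀ (w : List (NZ Γ)) (u : FreeAlgebra ℚ (NZ Γ)) (x : L),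
      (∃ β, x ∈ 𝓛.piece β 0) → e.eval u = Env.of 𝓛 x → e.eval (freeDual u) = Env.of 𝓛 (𝓛.dual x) →
      e.eval ((w.map (FreeAlgebra.ι ℚ)).foldl (fun x y => x * y - y * x) u) =
        Env.of 𝓛 ((w.map e.ord).foldl (fun x y => 𝓛.bracket x y) x) ∧
      e.eval (freeDual ((w.map (FreeAlgebra.ι ℚ)).foldl (fun x y => x * y - y * x) u)) =
        Env.of 𝓛 (𝓛.dual ((w.map e.ord).foldl (fun x y => 𝓛.bracket x y) x)) := by
    intro w
    induction w with
    | nil => intro u x _ h1 h2; exact ⟨h1, h2⟩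
    | cons γ w ih =>
      rintro u x ⟨β, hx⟩ h1 h2
      have h3 : e.eval (FreeAlgebra.ι ℚ γ) = Env.of 𝓛 (e.ord γ) := by simp [Invariants.eval]
      have h4 : e.eval (freeDual (FreeAlgebra.ι ℚ γ)) = Env.of 𝓛 (𝓛.dual (e.ord γ)) := by
        simp [Invariants.eval, freeDual, e.ord_dual]
      refine ih _ _ ⟨β + γ.1, ?_⟩ ?_ ?_
      · simpa using 𝓛.bracket_mem hx (e.ord_mem γ)
      · rw [map_sub, map_mul, map_mul, h1, h3, Env.of_bracket hx (e.ord_mem γ)]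
      · rw [freeDual_sub, freeDual_mul, freeDual_mul, map_sub, map_mul, map_mul, h2, h4,
          ← Env.of_bracket (𝓛.dual_mem (e.ord_mem γ)) (𝓛.dual_mem hx), 𝓛.bracket_dual]
        have h5 := 𝓛.bracket_antisymm (e.ord_mem γ) hx
        rw [mul_zero, Int.negOnePow_zero, Units.val_one, one_smul] at h5
        simp only [eq_neg_of_add_eq_zero_left h5, map_neg, neg_neg]
  exact key w (FreeAlgebra.ι ℚ α) (e.ord α) ⟨_, e.ord_mem α⟩ (by simp [Invariants.eval])
    (by simp [Invariants.eval, freeDual, e.ord_dual])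

lemma Invariants.eval_bracket_smul {ww : List (List (NZ Γ))} (hw : ∀ w ∈ ww, w ≠ []) (m : M) :
    e.eval (ww.map fun w => freeBracket w - freeDual (freeBracket w)).prod • Utw.of 𝓜 m =
      Utw.of 𝓜 (ww.foldr (fun w m => 𝓜.act (nested (fun x y => 𝓛.bracket x y) (w.map e.ord)) m) m)
    := by
  induction ww with
  | nil => simp
  | cons w ww ih =>
    have h := Invariants.eval_bracket (e := e) (hw w (by simp))
    rw [List.map_cons, List.prod_cons, map_mul, mul_smul, ih fun u hu => hw u (by simp [hu]),
      map_sub, h.1, h.2, Utw.of_act, List.foldr_cons]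

lemma finite_lists_le_of_finite {X : Type*} {s : Set X} (hs : s.Finite) (n : ℕ) :
    {w : List X | w.length ≤ n ∧ ∀ a ∈ w, a ∈ s}.Finite := by
  refine ((Finset.range (n + 1)).finite_toSet.biUnion fun k _ =>
    finite_lists_of_finite hs k).subset fun w hw => ?_
  exact Set.mem_biUnion (x := w.length) (by simpa [Nat.lt_succ_iff] using hw.1) ⟨rfl, hw.2⟩

lemma finite_lists_of_coe_eq {X : Type*} (s : Multiset X) :
    {w : List X | (w : Multiset X) = s}.Finite := by
  refine (finite_lists_of_finite (s := {a | a ∈ s}) ?_ (Multiset.card s)).subset ?_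
  · induction s using Quotient.inductionOn with
    | _ l => exact l.finite_toSet
  · rintro w rfl
    exact ⟨by simp, by simp⟩

lemma finite_letters_of_orbits (s : Multiset (Sym2 (NZ Γ))) : {a : NZ Γ | a.orbit ∈ s}.Finite := by
  have h : {z | z ∈ s}.Finite := by
    induction s using Quotient.inductionOn with
    | _ l => exact l.finite_toSet
  refine h.preimage' fun z _ => ?_
  induction z using Sym2.inductionOn with
  | _ p q =>
    refine (Set.toFinite {p, q}).subset fun a ha => ?_
    have h1 : a ∈ s(p, q) := by
      rw [← (show a.orbit = s(p, q) from ha)]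
      exact Sym2.mem_mk_left _ _
    simpa using h1

lemma finite_words_of_orbits (s : Multiset (Sym2 (NZ Γ))) :
    {w : List (NZ Γ) | (w.map NZ.orbit : Multiset (Sym2 (NZ Γ))) = s}.Finite := by
  refine (finite_lists_of_finite (finite_letters_of_orbits s) (Multiset.card s)).subset ?_
  rintro w rfl
  refine ⟨by simp, fun a ha => ?_⟩
  simp only [Set.mem_ofPred_eq, Multiset.mem_coe]
  exact List.mem_map_of_mem ha

lemma finite_nested_words_of_orbits (s : Multiset (Sym2 (NZ Γ))) :
    {ww : List (List (NZ Γ)) | (∀ w ∈ ww, w ≠ []) ∧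
      (ww.flatten.map NZ.orbit : Multiset (Sym2 (NZ Γ))) = s}.Finite := by
  refine (finite_lists_le_of_finite (finite_lists_le_of_finite (finite_letters_of_orbits s)
    (Multiset.card s)) (Multiset.card s)).subset ?_
  rintro ww ⟨hw, rfl⟩
  rw [Multiset.coe_card, List.length_map]
  have h1 : ∀ w ∈ ww, w.length ≤ ww.flatten.length := fun w hw =>
    (List.sublist_flatten_of_mem hw).length_le
  refine ⟨?_, fun w hw => ⟨h1 w hw, fun a ha => ?_⟩⟩
  · clear h1
    induction ww with
    | nil => simp
    | cons w ww ih =>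
      have := ih fun u hu => hw u (by simp [hu])
      have := List.length_pos_of_ne_nil (hw w (by simp))
      simp only [List.flatten_cons, List.length_append, List.length_cons]
      omega
  · simp only [Set.mem_ofPred_eq, Multiset.mem_coe]
    exact List.mem_map_of_mem (List.mem_flatten.mpr ⟨w, hw, ha⟩)

/-- The class of a word only depends on the orbits of its letters, up to the action. -/
lemma total_vadd_congr (hbar : ∀ (α : Γ) (θ : Θ), star α +ᵥ θ = α +ᵥ θ) :
    ∃ r : Multiset (Sym2 (NZ Γ)) → Γ, ∀ (w : List (NZ Γ)) (ρ : Θ),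
      total w +ᵥ ρ = r (w.map NZ.orbit) +ᵥ ρ := by
  refine ⟨fun s => (s.map fun z => (Quot.out z).1.1).sum, fun w ρ => ?_⟩
  induction w with
  | nil => rfl
  | cons a w ih =>
    simp only [total, List.map_cons, List.sum_cons, add_vadd, ← Multiset.cons_coe,
      Multiset.map_cons, Multiset.sum_cons] at ih ⊢
    rw [ih]
    have h : (Quot.out a.orbit).1 ∈ a.orbit := by
      have := Sym2.mem_mk_left (Quot.out a.orbit).1 (Quot.out a.orbit).2
      rwa [show s((Quot.out a.orbit).1, (Quot.out a.orbit).2) = a.orbit from Quot.out_eq _] at this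
    rcases Sym2.mem_iff.mp h with h | h <;> rw [h]
    exact (hbar _ _).symm

/-- The canonical map `M → U^tw(L; M)` as a linear map. -/
noncomputable def Utw.ofLinear (𝓜 : TwistedModule 𝓛 Θ M) : M →ₗ[ℚ] Utw 𝓜 :=
  twMk 𝓜 ∘ₗ TensorProduct.mk ℚ (Env 𝓛) M 1

lemma Utw.ofLinear_apply (m : M) : Utw.ofLinear 𝓜 m = Utw.of 𝓜 m := rfl

variable (e) in
/-- The map from the free algebra to the twisted enveloping module given by a family of invariants
and an element. -/
noncomputable def Invariants.evalSmul (z : Utw 𝓜) : FreeAlgebra ℚ (NZ Γ) →ₗ[ℚ] Utw 𝓜 where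
  toFun a := e.eval a • z
  map_add' a b := by rw [map_add, add_smul]
  map_smul' c a := by rw [map_smul, smul_assoc, RingHom.id_apply]

lemma Invariants.evalSmul_apply (z : Utw 𝓜) (a : FreeAlgebra ℚ (NZ Γ)) :
    e.evalSmul z a = e.eval a • z := rfl

end WallCrossing

/-! ### The wall-crossing formulae and the δ-sums as series of words -/

section WallCrossing

lemma map_finsum_mem_of_finite {ι V W : Type*} [AddCommGroup V] [Module ℚ V] [AddCommGroup W]
    [Module ℚ W] (f : V →ₗ[ℚ] W) {s : Set ι} {t : ι → V} (h : {i ∈ s | t i ≠ 0}.Finite) :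
    f (∑ᶠ i ∈ s, t i) = ∑ᶠ i ∈ s, f (t i) :=
  f.toAddMonoidHom.map_finsum_mem' h

lemma finsum_mem_indicator {ι V : Type*} [AddCommMonoid V] (s u : Set ι) (t : ι → V) :
    ∑ᶠ i ∈ s, u.indicator t i = ∑ᶠ i ∈ s ∩ u, t i := by
  rw [finsum_mem_def, Set.indicator_indicator, ← finsum_mem_def]

variable {Γ : Type*} [AddCommMonoid Γ] [StarAddMonoid Γ] {L : Type*} [AddCommGroup L] [Module ℚ L]
  {Θ : Type*} [AddAction Γ Θ] {M : Type*} [AddCommGroup M] [Module ℚ M] {𝓛 : InvGradedLie Γ L}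
  {𝓜 : TwistedModule 𝓛 Θ M} {T T' : Type*} [LinearOrder T] [LinearOrder T']
  {τ : SDStability Γ T} {τ' : SDStability Γ T'} {e e' : Invariants 𝓜}
  [AddCommSemigroup (NZ Γ)] (val : AddHom (NZ Γ) Γ)

/-- A multidegree determines the class of its words. So the free identity defining Ũ can be
evaluated on each multidegree of class α, and the results added up; both sums have finite support.
-/
lemma Env.of_wallCrossing (hval : ∀ α, val α = α.1) {Ut : List (NZ Γ) → ℚ}
    (hUt : IsLieCoeff τ τ' Ut) (hwcf : WallCrossing e e' Ut)
    (hfin : FinitelyManyWords val (fun α => Env.of 𝓛 (e.ord α)) (fun ρ => Utw.of 𝓜 (e.sd ρ)))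
    {ρ : Θ} (hρ : Utw.of 𝓜 (e.sd ρ) ≠ 0) (α : NZ Γ) :
    Env.of 𝓛 (e'.ord α) = ∑ᶠ w, partOf (wordU (slopeOn val τ) (slopeOn val τ')) α w •
      (w.map fun α => Env.of 𝓛 (e.ord α)).prod := by
  have hval' : ⇑val = Subtype.val := funext hval
  have hne : ∀ α, val α ≠ 0 := fun α => by rw [hval]; exact α.2
  rw [(hwcf α).2, map_finsum_mem_of_finite _ ((hwcf α).1.subset fun w hw => ⟨hw.1.1, hw.1.2, hw.2⟩),
    finsum_mem_def]
  refine finsum_eq_of_fiber_eq (fun w => (w : Multiset (NZ Γ))) (fun w => (w : Multiset (NZ Γ)))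
    ((hwcf α).1.subset fun w hw => ?_)
    (hfin.finite_support_prod val hρ fun w => partOf_ne_zero val) fun s => ?_
  · rw [Function.mem_support, Set.indicator_apply_ne_zero] at hw
    exact ⟨hw.1.1, hw.1.2, fun h0 => hw.2 (by simp only [h0, map_zero])⟩
  rw [finsum_mem_indicator]
  have htot : ∀ w : List (NZ Γ), (w : Multiset (NZ Γ)) = s →
      total w = (s.map Subtype.val).sum := by
    rintro w rfl
    simp [total]
  by_cases hs : s ≠ 0 ∧ (s.map Subtype.val).sum = α.1
  · have h1 : {w : List (NZ Γ) | (w : Multiset (NZ Γ)) = s} ∩ {w | w ≠ [] ∧ total w = α} =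
        {w : List (NZ Γ) | (w : Multiset (NZ Γ)) = s} := by
      refine Set.inter_eq_left.mpr fun w hw => ⟨?_, (htot w hw).trans hs.2⟩
      rintro rfl
      exact hs.1 (Eq.symm hw)
    have h2 := congrArg e.eval.toLinearMap (hUt s hs.1)
    rw [map_finsum_mem_of_finite _ ((finite_lists_of_coe_eq s).subset fun w hw => hw.1),
      map_finsum_mem_of_finite _ ((finite_lists_of_coe_eq s).subset fun w hw => hw.1)] at h2
    rw [h1]
    refine Eq.trans (finsum_mem_congr rfl fun w hw => ?_)
      (h2.trans (finsum_mem_congr rfl fun w hw => ?_))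
    · have hw0 : w ≠ [] := by
        rintro rfl
        exact hs.1 (Eq.symm hw)
      rw [wcfTerm, map_smul, map_smul, AlgHom.toLinearMap_apply, (Invariants.eval_bracket hw0).1]
    · obtain ⟨a, u, rfl⟩ : ∃ a u, w = a :: u := List.exists_cons_of_ne_nil (by
        rintro rfl
        exact hs.1 (Eq.symm hw))
      have h3 : tot a u = α := Subtype.ext (by
        rw [← hval, val_tot, hval']
        exact (htot _ hw).trans hs.2)
      rw [map_smul, AlgHom.toLinearMap_apply, Invariants.eval_prod, partOf, if_pos h3,
        ← coeffU_map val τ τ' hne, hval']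
  · rw [finsum_mem_eq_zero_of_forall_eq_zero, finsum_mem_eq_zero_of_forall_eq_zero]
    · intro w hw
      by_contra h0
      have h1 : partOf (wordU (slopeOn val τ) (slopeOn val τ')) α w ≠ 0 :=
        fun h => h0 (by rw [h, zero_smul])
      refine hs ⟨?_, ?_⟩
      · rintro rfl
        rw [Set.mem_ofPred_eq, Multiset.coe_eq_zero] at hw
        subst hw
        exact h1 rfl
      · rw [← htot w hw, ← hval, ← partOf_ne_zero val h1, hval', total]
    · rintro w ⟨hw, hw0, hwα⟩
      refine absurd ⟨?_, (htot w hw).symm.trans hwα⟩ hs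
      rintro rfl
      exact hw0 ((Multiset.coe_eq_zero w).mp hw)

/-- As for `Env.of_wallCrossing`, with words grouped by the orbits of their letters and by ρ. The
orbits determine how a word acts on classes (`total_vadd_congr`), so each group lies in a single
class. -/
lemma Utw.of_wallCrossing (hval : ∀ α, val α = α.1)
    (hbar : ∀ (α : Γ) (θ : Θ), star α +ᵥ θ = α +ᵥ θ) {Ut : List (List (NZ Γ)) → ℚ}
    (hUt : IsTwistedLieCoeff τ τ' Ut) (hwcf : WallCrossingSd e e' Ut)
    (hfin : FinitelyManyWords val (fun α => Env.of 𝓛 (e.ord α)) (fun ρ => Utw.of 𝓜 (e.sd ρ)))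
    (θ : Θ) :
    Utw.of 𝓜 (e'.sd θ) = ev val (fun α => Env.of 𝓛 (e.ord α)) (fun ρ => Utw.of 𝓜 (e.sd ρ))
      (wordUsd (slopeOn val τ) τ.zero (slopeOn val τ') τ'.zero) θ := by
  have hval' : ⇑val = Subtype.val := funext hval
  have hne : ∀ α, val α ≠ 0 := fun α => by rw [hval]; exact α.2
  obtain ⟨r, hr⟩ := total_vadd_congr hbar
  rw [(hwcf θ).2, ← Utw.ofLinear_apply, map_finsum_mem_of_finite _
    ((hwcf θ).1.subset fun w hw => ⟨hw.1.1, hw.1.2, hw.2⟩), finsum_mem_def, ev, finsum_mem_def]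
  refine finsum_eq_of_fiber_eq
    (fun p => ((p.1.flatten.map NZ.orbit : Multiset (Sym2 (NZ Γ))), p.2))
    (fun p => ((p.1.map NZ.orbit : Multiset (Sym2 (NZ Γ))), p.2))
    ((hwcf θ).1.subset fun w hw => ?_)
    ((hfin θ).subset fun p hp => ?_) fun ⟨s, ρ⟩ => ?_
  · rw [Function.mem_support, Set.indicator_apply_ne_zero] at hw
    exact ⟨hw.1.1, hw.1.2, fun h0 => hw.2 (by simp only [h0, map_zero])⟩
  · rw [Function.mem_support, Set.indicator_apply_ne_zero] at hp
    refine ⟨forall_ne_zero_of_prod_ne_zero _ fun h0 => hp.2 ?_, fun h0 => hp.2 ?_, hp.1⟩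
    · simp only [mon, h0, zero_smul, smul_zero]
    · simp only [mon, h0, smul_zero]
  rw [finsum_mem_indicator, finsum_mem_indicator]
  by_cases hs : r s +ᵥ ρ = θ
  · have h1 : {p : List (List (NZ Γ)) × Θ |
          ((p.1.flatten.map NZ.orbit : Multiset (Sym2 (NZ Γ))), p.2) = (s, ρ)} ∩
        {p | (∀ w ∈ p.1, w ≠ []) ∧ total p.1.flatten +ᵥ p.2 = θ} = (fun ww => (ww, ρ)) ''
        {ww | (∀ w ∈ ww, w ≠ []) ∧ (ww.flatten.map NZ.orbit : Multiset (Sym2 (NZ Γ))) = s} := by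
      ext ⟨ww, ρ'⟩
      simp only [Set.mem_inter_iff, Set.mem_ofPred_eq, Prod.mk.injEq, Set.mem_image]
      constructor
      · rintro ⟨⟨h1, rfl⟩, h2, -⟩
        exact ⟨ww, ⟨h2, h1⟩, rfl, rfl⟩
      · rintro ⟨_, ⟨h2, h1⟩, rfl, rfl⟩
        exact ⟨⟨h1, rfl⟩, h2, by rw [hr, h1, hs]⟩
    have h2 : {p : List (NZ Γ) × Θ |
          ((p.1.map NZ.orbit : Multiset (Sym2 (NZ Γ))), p.2) = (s, ρ)} ∩
        {p | (p.1.map val).sum +ᵥ p.2 = θ} = (fun w => (w, ρ)) ''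
        {w | (w.map NZ.orbit : Multiset (Sym2 (NZ Γ))) = s} := by
      ext ⟨w, ρ'⟩
      simp only [Set.mem_inter_iff, Set.mem_ofPred_eq, Prod.mk.injEq, Set.mem_image]
      constructor
      · rintro ⟨⟨h3, rfl⟩, -⟩
        exact ⟨w, h3, rfl, rfl⟩
      · rintro ⟨_, h3, rfl, rfl⟩
        refine ⟨⟨h3, rfl⟩, ?_⟩
        rw [hval', ← hs, ← h3, ← hr]
        rfl
    rw [h1, h2, finsum_mem_image (fun _ _ _ _ h => congrArg Prod.fst h),
      finsum_mem_image (fun _ _ _ _ h => congrArg Prod.fst h)]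
    have h3 := congrArg (e.evalSmul (Utw.of 𝓜 (e.sd ρ))) (hUt s)
    rw [map_finsum_mem_of_finite _ ((finite_nested_words_of_orbits s).subset fun w hw => hw.1),
      map_finsum_mem_of_finite _ ((finite_words_of_orbits s).subset fun w hw => hw.1)] at h3
    refine Eq.trans (finsum_mem_congr rfl fun ww hw => ?_)
      (h3.trans (finsum_mem_congr rfl fun w hw => ?_))
    · rw [wcfSdTerm, map_smul, map_smul, Invariants.evalSmul_apply,
        Invariants.eval_bracket_smul hw.1, Utw.ofLinear_apply]
    · rw [map_smul, Invariants.evalSmul_apply, Invariants.eval_prod, ← coeffUsd_map val τ τ' hne,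
        hval']
      rfl
  · rw [finsum_mem_eq_zero_of_forall_eq_zero, finsum_mem_eq_zero_of_forall_eq_zero]
    · rintro ⟨w, ρ'⟩ ⟨h1, h2⟩
      simp only [Set.mem_ofPred_eq, Prod.mk.injEq] at h1 h2
      refine absurd ?_ hs
      rw [← h1.1, ← h1.2, ← hr, ← h2, hval', total]
    · rintro ⟨ww, ρ'⟩ ⟨h1, -, h2⟩
      simp only [Set.mem_ofPred_eq, Prod.mk.injEq] at h1 h2
      refine absurd ?_ hs
      rw [← h1.1, ← h1.2, ← hr, ← h2]

lemma decBelow_eq {X : Type*} (t : X → T) (z s : T) (w : List X) : decBelow t z s w =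
    tv (w.Pairwise (fun a b => t a > t b) ∧ ∀ a ∈ w, t a > z ∧ s > t a) := by
  induction w generalizing s with
  | nil => simp [decBelow, tv]
  | cons a w ih =>
    rw [decBelow, ih, ← tv_and]
    congr 1
    rw [List.pairwise_cons, List.forall_mem_cons]
    refine propext ⟨fun ⟨⟨h1, h2⟩, h3, h4⟩ => ⟨⟨fun b hb => (h4 b hb).2, h3⟩, ⟨h1, h2⟩,
      fun b hb => ⟨(h4 b hb).1, (h4 b hb).2.trans h2⟩⟩, fun ⟨⟨h1, h2⟩, h3, h4⟩ =>
      ⟨h3, h2, fun b hb => ⟨(h4 b hb).1, h1 b hb⟩⟩⟩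

lemma dec_eq {X : Type*} (t : X → T) (z : T) (w : List X) :
    dec t z w = tv (w.Pairwise (fun a b => t a > t b) ∧ ∀ a ∈ w, t a > z) := by
  cases w with
  | nil => simp [dec, tv]
  | cons a w =>
    rw [dec, decBelow_eq, ← tv_and]
    congr 1
    rw [List.pairwise_cons, List.forall_mem_cons]
    exact propext ⟨fun ⟨h1, h3, h4⟩ => ⟨⟨fun b hb => (h4 b hb).2, h3⟩, h1,
      fun b hb => (h4 b hb).1⟩, fun ⟨⟨h1, h2⟩, h3, h4⟩ => ⟨h3, h2, fun b hb => ⟨h4 b hb, h1 b hb⟩⟩⟩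

lemma delta_eq (hval : ∀ α, val α = α.1) (α : NZ Γ) : delta τ e α =
    ∑ᶠ w, partOf (sameSlope (slopeOn val τ)) α w •
      (w.map fun α => Env.of 𝓛 (e.ord α)).prod := by
  classical
  have hval' : ⇑val = Subtype.val := funext hval
  have hne : ∀ α, val α ≠ 0 := fun α => by rw [hval]; exact α.2
  rw [delta, finsum_mem_def]
  refine finsum_congr fun w => ?_
  cases w with
  | nil =>
    rw [partOf, zero_smul, Set.indicator_of_notMem]
    rintro ⟨h, -⟩
    exact α.2 h.symm
  | cons a u =>
    have h1 : total (a :: u) = (tot a u).1 := by rw [← hval, val_tot, hval', total]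
    have h2 : (∀ b ∈ a :: u, slopeOn val τ b = slopeOn val τ (tot a u)) ↔
        ∀ β ∈ a :: u, ∀ γ ∈ a :: u, τ.slope β = τ.slope γ := by
      constructor
      · intro h β hβ γ hγ
        have := (h β hβ).trans (h γ hγ).symm
        rwa [slopeOn, slopeOn, hval, hval] at this
      -- If all letters have equal slope, the seesaw property gives the same slope to their sum,
      -- which is the slope used in `sameSlope`.
      · intro h b hb
        refine ((slopeOn_seeSaw val τ hne).tot_eq ?_ fun c hc => ?_).symm
        · rw [slopeOn, slopeOn, hval, hval]
          exact h a (by simp) b hb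
        · rw [slopeOn, slopeOn, hval, hval]
          exact h c (by simp [hc]) b hb
    rw [partOf]
    by_cases h3 : tot a u = α
    · rw [if_pos h3, sameSlope]
      by_cases h4 : ∀ b ∈ a :: u, slopeOn val τ b = slopeOn val τ (tot a u)
      · rw [Set.indicator_of_mem (show a :: u ∈ deltaIndex τ α from ⟨by rw [h1, h3], h2.mp h4⟩),
          tv_true h4, deltaTerm, expCoeff, one_pow, one_mul, List.length_cons]
      · rw [Set.indicator_of_notMem fun h => h4 (h2.mpr h.2), tv_false h4, zero_mul, zero_smul]
    · rw [if_neg h3, zero_smul, Set.indicator_of_notMem fun h => h3 (Subtype.ext ?_)]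
      rw [← h1, h.1]

lemma deltaSd_eq (hval : ∀ α, val α = α.1) (θ : Θ) : deltaSd τ e θ =
    ev val (fun α => Env.of 𝓛 (e.ord α)) (fun ρ => Utw.of 𝓜 (e.sd ρ))
      (zeroSlope (slopeOn val τ) τ.zero) θ := by
  have hval' : ⇑val = Subtype.val := funext hval
  rw [deltaSd, ev, finsum_mem_def, finsum_mem_def]
  refine finsum_congr fun p => ?_
  by_cases h1 : total p.1 +ᵥ p.2 = θ
  · rw [Set.indicator_of_mem (s := {p : List (NZ Γ) × Θ | (p.1.map val).sum +ᵥ p.2 = θ})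
      (by rw [Set.mem_ofPred_eq, hval']; exact h1), zeroSlope_map, hval', List.forall_mem_map]
    by_cases h2 : ∀ β ∈ p.1, τ.slope β.1 = τ.zero
    · rw [Set.indicator_of_mem (show p ∈ deltaSdIndex τ θ from ⟨h1, h2⟩), tv_true h2, one_mul]
      rfl
    · rw [Set.indicator_of_notMem fun h => h2 h.2, tv_false h2, zero_mul, zero_smul]
  · rw [Set.indicator_of_notMem fun h => h1 h.1, Set.indicator_of_notMem]
    rw [Set.mem_ofPred_eq, hval']
    exact h1

lemma ksSum_eq (hval : ∀ α, val α = α.1)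
    (hfin : FinitelyManyWords val (fun α => Env.of 𝓛 (e.ord α)) (fun ρ => Utw.of 𝓜 (e.sd ρ)))
    (θ : Θ) : (ksSum τ e θ : Utw 𝓜) =
      ev val (fun α => Env.of 𝓛 (e.ord α)) (fun ρ => Utw.of 𝓜 (e.sd ρ))
        (ksCoeff (slopeOn val τ) τ.zero) θ := by
  have hval' : ⇑val = Subtype.val := funext hval
  rw [ksCoeff, ← ev_expand val hfin (fun _ _ => delta_eq val hval) (deltaSd_eq val hval)]
  change ∑ᶠ p ∈ ksIndex τ θ, ksTerm τ e p = _
  rw [ev, finsum_mem_def, finsum_mem_def]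
  refine finsum_congr fun p => ?_
  have h0 : ksTerm τ e p = mon (delta τ e) (deltaSd τ e) p := rfl
  simp only [dec_eq, slopeOn, hval]
  by_cases h1 : total p.1 +ᵥ p.2 = θ
  · rw [Set.indicator_of_mem (s := {p : List (NZ Γ) × Θ | (p.1.map val).sum +ᵥ p.2 = θ})
      (by rw [Set.mem_ofPred_eq, hval']; exact h1)]
    by_cases h2 : p.1.Pairwise (fun α β : NZ Γ => τ.slope α.1 > τ.slope β.1) ∧
      ∀ α ∈ p.1, τ.slope α.1 > τ.zero
    · rw [Set.indicator_of_mem (mem_ksIndex.mpr ⟨h2.1, h2.2, h1⟩), tv_true h2, one_smul, h0]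
    · rw [Set.indicator_of_notMem fun h => h2 ⟨(mem_ksIndex.mp h).1, (mem_ksIndex.mp h).2.1⟩,
        tv_false h2, zero_smul]
  · rw [Set.indicator_of_notMem fun h => h1 (mem_ksIndex.mp h).2.2, Set.indicator_of_notMem]
    rw [Set.mem_ofPred_eq, hval']
    exact h1

/-- The addition of classes of non-zero objects. -/
abbrev NZ.addCommSemigroup (hpos : ∀ α β : Γ, α + β = 0 → α = 0) : AddCommSemigroup (NZ Γ) where
  add α β := ⟨α.1 + β.1, fun h => α.2 (hpos _ _ h)⟩
  add_assoc _ _ _ := Subtype.ext (add_assoc _ _ _)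
  add_comm _ _ := Subtype.ext (add_comm _ _)

end WallCrossing

end SDWallCrossing

theorem mainTheorem10
    {Γ : Type*} [AddCommMonoid Γ] [StarAddMonoid Γ]
    {K : Type*} [AddCommGroup K] (cl : Γ →+ K) (hcl : ∀ α, cl α = 0 → α = 0)
    (hpos : ∀ α β : Γ, α + β = 0 → α = 0)
    {Θ : Type*} [AddAction Γ Θ] (hbar : ∀ (α : Γ) (θ : Θ), star α +ᵥ θ = α +ᵥ θ)
    {L : Type*} [AddCommGroup L] [Module ℚ L] (𝓛 : InvGradedLie Γ L)
    {M : Type*} [AddCommGroup M] [Module ℚ M] (𝓜 : TwistedModule 𝓛 Θ M)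
    {T T' : Type*} [LinearOrder T] [LinearOrder T']
    (τ : SDStability Γ T) (τ' : SDStability Γ T')
    (e e' : Invariants 𝓜)
    (Ut : List (NZ Γ) → ℚ) (hUt : IsLieCoeff τ τ' Ut)
    (Utsd : List (List (NZ Γ)) → ℚ) (hUtsd : IsTwistedLieCoeff τ τ' Utsd)
    (hwcf : WallCrossing e e' Ut) (hwcfsd : WallCrossingSd e e' Utsd)
    (hδ : DeltaFinite τ e) (hδ' : DeltaFinite τ' e')
    (hfin : KSFinite τ e) (hfin' : KSFinite τ' e') :
    ksSum τ e = ksSum τ' e' := by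
  -- By `hpos`, sums of non-zero classes are non-zero. Hence block sums of words in `C` are again
  -- letters, and the calculus of series applies.
  let := NZ.addCommSemigroup hpos
  let val : AddHom (NZ Γ) Γ := ⟨Subtype.val, fun _ _ => rfl⟩
  have hval : ∀ α, val α = α.1 := fun _ => rfl
  have hne : ∀ α, val α ≠ 0 := fun α => α.2
  have h := finitelyManyWords val hval hbar hδ hfin
  have h' := finitelyManyWords val hval hbar hδ' hfin'
  funext θ
  refine Subtype.ext ?_
  -- Both sides become series of words; the words in invariants for τ' are expanded into words in
  -- invariants for τ, and the coefficients agree by `conv_subst_wordU`.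
  rw [ksSum_eq val hval h, ksSum_eq val hval h', ev_expand val h
    (fun ρ hρ => Env.of_wallCrossing val hval hUt hwcf h hρ)
    (Utw.of_wallCrossing val hval hbar hUtsd hwcfsd h),
    conv_subst_wordU _ _ _ (slopeOn_seeSaw val τ' hne)]
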